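/- Let $\phi(\xi)=e^{-|\xi|}$, let $\phi'(\xi)=-\operatorname{sgn}(\xi)e^{-|\xi|}$, and let $b\in\mathbb{R}$. Let functions take values in $\mathbb{K}$, where $\mathbb{K}=\mathbb{R}$ or $\mathbb{K}=\mathbb{C}$. Put $$\widetilde H^1=\{v\in H^1(\mathbb{R}): v(0)=0\},\qquad \mathrm{Dom}(L)=\{v\in\widetilde H^1:\ (1-\phi^2)v'\in\widetilde H^1\},$$ $$Lv=(1-\phi^2)v'+(4-b)\phi\phi' v+(b-3)\bigl[\phi*((\phi^2)'v)-2\,\phi'*(\phi^2v)\bigr],$$ $$\mathcal{L}_b v=Lv-4(b-3)\Bigl(\int_{\mathbb{R}}\phi^2\phi' v\,d\xi\Bigr)\phi ,\qquad v\in\mathrm{Dom}(L).$$ The operator $\mathcal{L}_b$, with domain $\mathrm{Dom}(L)$, acts in $\widetilde H^1$; it is the $H^1$-orthogonal projection of $L$ onto $\widetilde H^1$. The linearization of the $b$-Novikov equation $u_t-u_{xxt}+(b+1)u^2u_x=bu\,u_xu_{xx}+u^2u_{xxx}$ at the peakon $\phi(x-t)$ is, after subtraction from the perturbation of its value at the peak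 times $\phi$, the equation $$\tilde v_t=\mathcal{L}_b\tilde v,\qquad \tilde v(t,0)=0. \tag{1}$$ A solution of (1) is a function $\tilde v\in C(\mathbb{R},\mathrm{Dom}(L))\cap C^1(\mathbb{R},\widetilde H^1)$ satisfying (1), where $\mathrm{Dom}(L)$ carries the graph norm. The peakon is called linearly stable on $H^1(\mathbb{R})$ if for every $\tilde v_0\in\mathrm{Dom}(L)$ there are a constant $C>0$ and a unique solution $\tilde v$ of (1) with $\tilde v(0)=\tilde v_0$, and $\|\tilde v(t)\|_{H^1}\le C\|\tilde v_0\|_{H^1}$ for all $t>0$. Then: 1. The peakon is linearly stable on $H^1(\mathbb{R})$ if and only if $b=3$. 2. Let $b<3$. Every $\mu\in\mathbb{K}$ with $0<\operatorname{Re}\mu<3-b$ is an eigenvalue of $\mathcal{L}_b$: there is $w\in\mathrm{Dom}(L)$, $w\neq0$, with $\mathcal{L}_b w=\mu w$. The function $\tilde v(t)=e^{\mu t}w$ is a solution of (1), and $\|\tilde v(t)\|_{H^1}=e^{t\operatorname{Re}\mu}\|w\|_{H^1}$ with $\|w\|_{H^1}>0$. 3. Let $b>3$. Every $\mu\in\mathbb{K}$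 with $0<\operatorname{Re}\mu<b-3$ is an eigenvalue of the adjoint $\mathcal{L}_b^*$ of $\mathcal{L}_b$ with respect to the $H^1$ inner product: there is $w\in\widetilde H^1$, $w\ne0$, with $\langle w,\mathcal{L}_b v\rangle_{H^1}=\langle\mu w,v\rangle_{H^1}$ for all $v\in\mathrm{Dom}(L)$. Every solution of (1) satisfies $\langle w,\tilde v(t)\rangle_{H^1}=e^{\bar\mu t}\langle w,\tilde v(0)\rangle_{H^1}$ for all $t\in\mathbb{R}$. Moreover, there are a solution of (1) with $\langle w,\tilde v(0)\rangle_{H^1}\ne0$ and a constant $c>0$ such that $\|\tilde v(t)\|_{H^1}\ge c\,e^{t\operatorname{Re}\mu}$ for all $t\in\mathbb{R}$. -/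

import Mathlib

open MeasureTheory Filter Topology

noncomputable section

namespace Novikov

/-- The peakon profile `φ(ξ) = exp(-|ξ|)`. -/
def peakon (ξ : ℝ) : ℝ := Real.exp (-|ξ|)

/-- The piecewise continuous derivative `φ'(ξ) = -sgn(ξ) exp(-|ξ|)` of the peakon profile. -/
def peakonDeriv (ξ : ℝ) : ℝ := -(SignType.sign ξ : ℝ) * Real.exp (-|ξ|)

/-- `v ∈ H¹(ℝ)`, where `v` is the continuous representative of its class: `v` and its almost
everywhere defined derivative are square integrable, and `v` is an antiderivative of that
derivative (that is, `v` is locally absolutely continuous, so that `deriv v` is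
the weak derivative). -/
structure MemH1 {𝕜 : Type*} [RCLike 𝕜] (v : ℝ → 𝕜) : Prop where
  memLp : MemLp v 2 volume
  memLp_deriv : MemLp (deriv v) 2 volume
  sub_eq_integral : ∀ x y : ℝ, v y - v x = ∫ s in x..y, deriv v s

/-- The inner product of `H¹(ℝ)` (conjugate linear in the first argument). -/
def h1Inner {𝕜 : Type*} [RCLike 𝕜] (w v : ℝ → 𝕜) : 𝕜 :=
  (∫ ξ, inner 𝕜 (w ξ) (v ξ)) + ∫ ξ, inner 𝕜 (deriv w ξ) (deriv v ξ)

/-- The norm of `H¹(ℝ)`. -/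
def h1Norm {𝕜 : Type*} [RCLike 𝕜] (v : ℝ → 𝕜) : ℝ :=
  Real.sqrt ((∫ ξ, ‖v ξ‖ ^ 2) + ∫ ξ, ‖deriv v ξ‖ ^ 2)

/-- `v` lies in the closed subspace of those elements of `H¹(ℝ)` that vanish at the peak. -/
def MemH1Zero {𝕜 : Type*} [RCLike 𝕜] (v : ℝ → 𝕜) : Prop :=
  MemH1 v ∧ v 0 = 0

/-- The domain `{v : v ∈ H¹, v(0) = 0, (1 - φ²) v' ∈ H¹, ((1 - φ²) v')(0) = 0}` of the linearized
operator. -/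
def MemDom {𝕜 : Type*} [RCLike 𝕜] (v : ℝ → 𝕜) : Prop :=
  MemH1Zero v ∧ MemH1Zero (fun ξ => (1 - peakon ξ ^ 2) • deriv v ξ)

/-- Convolution on the line of a real kernel with a scalar function. -/
def conv {𝕜 : Type*} [RCLike 𝕜] (k : ℝ → ℝ) (f : ℝ → 𝕜) : ℝ → 𝕜 :=
  convolution k f (ContinuousLinearMap.lsmul ℝ ℝ) volume

/-- `Q v = (b - 3) [φ * ((φ²)' v) - 2 φ' * (φ² v)]`, where `(φ²)' = 2 φ φ'`. -/
def opQ {𝕜 : Type*} [RCLike 𝕜] (b : ℝ) (v : ℝ → 𝕜) (ξ : ℝ) : 𝕜 :=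
  (b - 3) • (conv peakon (fun y => (2 * peakon y * peakonDeriv y) • v y) ξ
    - (2 : ℝ) • conv peakonDeriv (fun y => (peakon y ^ 2) • v y) ξ)

/-- `L v = (1 - φ²) v' + (4 - b) φ φ' v + Q v`. -/
def opL {𝕜 : Type*} [RCLike 𝕜] (b : ℝ) (v : ℝ → 𝕜) (ξ : ℝ) : 𝕜 :=
  (1 - peakon ξ ^ 2) • deriv v ξ + ((4 - b) * peakon ξ * peakonDeriv ξ) • v ξ + opQ b v ξ

/-- The right-hand side `L v - 4 (b - 3) ⟨φ² φ', v⟩ φ` of the linearized equation, with the pairing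
of `L²(ℝ)`. For `v` in the domain this is `L v - (L v)(0) φ`, which vanishes at `0`; it is the
orthogonal projection in `H¹(ℝ)` of `L v` on the subspace of functions vanishing at `0`. -/
def linOp {𝕜 : Type*} [RCLike 𝕜] (b : ℝ) (v : ℝ → 𝕜) (ξ : ℝ) : 𝕜 :=
  opL b v ξ - peakon ξ • ((4 * (b - 3)) • ∫ y, (peakon y ^ 2 * peakonDeriv y) • v y)

/-- `u`, with `u t` the function at time `t`, is a solution on the whole time line of the linearized
equation `u_t = L u - 4 (b - 3) ⟨φ² φ', u⟩ φ`: it is continuous in time with values in the domain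
with its graph norm, and differentiable in time with values in `H¹`. -/
structure IsSolution {𝕜 : Type*} [RCLike 𝕜] (b : ℝ) (u : ℝ → ℝ → 𝕜) : Prop where
  mem_dom : ∀ t, MemDom (u t)
  continuous_h1 : ∀ t, Tendsto (fun s => h1Norm (fun ξ => u s ξ - u t ξ)) (𝓝 t) (𝓝 0)
  continuous_graph :
    ∀ t, Tendsto (fun s => h1Norm (fun ξ => opL b (u s) ξ - opL b (u t) ξ)) (𝓝 t) (𝓝 0)
  hasDeriv : ∀ t, Tendsto
    (fun h : ℝ => h1Norm (fun ξ => h⁻¹ • (u (t + h) ξ - u t ξ) - linOp b (u t) ξ)) (𝓝[≠] 0) (𝓝 0)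

/-- Linear stability of the peakon on `H¹`: for every initial datum in the domain there are a
constant and a unique solution, and the solution is bounded by the constant times the norm of the
datum at all positive times. -/
def LinearlyStable (𝕜 : Type*) [RCLike 𝕜] (b : ℝ) : Prop :=
  ∀ v₀ : ℝ → 𝕜, MemDom v₀ → ∃ C : ℝ, 0 < C ∧ ∃ u : ℝ → ℝ → 𝕜,
    IsSolution b u ∧ u 0 = v₀ ∧ (∀ u' : ℝ → ℝ → 𝕜, IsSolution b u' → u' 0 = v₀ → u' = u) ∧
      ∀ t : ℝ, 0 < t → h1Norm (u t) ≤ C * h1Norm v₀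

/-- `w` is an eigenfunction with eigenvalue `μ` of the linearized operator. -/
def IsEigenfunction {𝕜 : Type*} [RCLike 𝕜] (b : ℝ) (μ : 𝕜) (w : ℝ → 𝕜) : Prop :=
  MemDom w ∧ w ≠ 0 ∧ linOp b w = fun ξ => μ * w ξ

/-- `w` is an eigenfunction with eigenvalue `μ` of the Hilbert space adjoint, with respect to the
`H¹` inner product on the functions vanishing at `0`, of the linearized operator. -/
def IsAdjointEigenfunction {𝕜 : Type*} [RCLike 𝕜] (b : ℝ) (μ : 𝕜) (w : ℝ → 𝕜) : Prop :=
  MemH1Zero w ∧ w ≠ 0 ∧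
    ∀ v : ℝ → 𝕜, MemDom v → h1Inner w (linOp b v) = h1Inner (fun ξ => μ * w ξ) v

end Novikov

end

noncomputable section

namespace Novikov

open Set

set_option linter.unusedSectionVars false

/-- `f` is, on the set `S`, an antiderivative of the locally integrable function `f'`. -/
def IsPrimitiveOn {E : Type*} [NormedAddCommGroup E] [NormedSpace ℝ E]
    (f f' : ℝ → E) (S : Set ℝ) : Prop :=
  ∀ x ∈ S, ∀ y ∈ S, IntervalIntegrable f' volume x y ∧ ∫ t in x..y, f' t = f y - f x

namespace IsPrimitiveOn

section general

variable {E F : Type*} [NormedAddCommGroup E] [NormedSpace ℝ E] [CompleteSpace E]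
  [NormedAddCommGroup F] [NormedSpace ℝ F] [CompleteSpace F]
  {f f' g g' : ℝ → E} {S : Set ℝ}

theorem mono {T : Set ℝ} (h : IsPrimitiveOn f f' S) (hT : T ⊆ S) : IsPrimitiveOn f f' T :=
  fun x hx y hy => h x (hT hx) y (hT hy)

theorem add (hf : IsPrimitiveOn f f' S) (hg : IsPrimitiveOn g g' S) :
    IsPrimitiveOn (fun x => f x + g x) (fun x => f' x + g' x) S := fun x hx y hy =>
  ⟨(hf x hx y hy).1.add (hg x hx y hy).1, by
    rw [intervalIntegral.integral_add (hf x hx y hy).1 (hg x hx y hy).1, (hf x hx y hy).2,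
      (hg x hx y hy).2, add_sub_add_comm]⟩

theorem sub (hf : IsPrimitiveOn f f' S) (hg : IsPrimitiveOn g g' S) :
    IsPrimitiveOn (fun x => f x - g x) (fun x => f' x - g' x) S := fun x hx y hy =>
  ⟨(hf x hx y hy).1.sub (hg x hx y hy).1, by
    rw [intervalIntegral.integral_sub (hf x hx y hy).1 (hg x hx y hy).1, (hf x hx y hy).2,
      (hg x hx y hy).2, sub_sub_sub_comm]⟩

theorem clm_comp (L : E →L[ℝ] F) (hf : IsPrimitiveOn f f' S) :
    IsPrimitiveOn (fun x => L (f x)) (fun x => L (f' x)) S := fun x hx y hy =>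
  ⟨⟨L.integrable_comp (hf x hx y hy).1.1, L.integrable_comp (hf x hx y hy).1.2⟩, by
    rw [L.intervalIntegral_comp_comm (hf x hx y hy).1, (hf x hx y hy).2, map_sub]⟩

theorem congr [S.OrdConnected] (hf : IsPrimitiveOn f f' S) (h : EqOn f g S)
    (h' : ∀ᵐ x, x ∈ S → f' x = g' x) : IsPrimitiveOn g g' S := fun x hx y hy => by
  have hs : uIoc x y ⊆ S := uIoc_subset_uIcc.trans (OrdConnected.uIcc_subset ‹_› hx hy)
  have h2 : ∀ᵐ t, t ∈ uIoc x y → f' t = g' t := by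
    filter_upwards [h'] with t ht hts using ht (hs hts)
  have h3 : f' =ᵐ[volume.restrict (uIoc x y)] g' :=
    (ae_restrict_iff' measurableSet_uIoc).2 h2
  refine ⟨(hf x hx y hy).1.congr_ae h3, ?_⟩
  rw [← h hx, ← h hy, ← (hf x hx y hy).2]
  exact (intervalIntegral.integral_congr_ae h2).symm

theorem of_hasDerivAt [S.OrdConnected] (hf : ∀ x ∈ S, HasDerivAt f (f' x) x)
    (hc : ContinuousOn f' S) : IsPrimitiveOn f f' S := fun x hx y hy => by
  have hs : uIcc x y ⊆ S := OrdConnected.uIcc_subset ‹_› hx hy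
  have hi := (hc.mono hs).intervalIntegrable (μ := volume)
  exact ⟨hi, intervalIntegral.integral_eq_sub_of_hasDerivAt (fun t ht => hf t (hs ht)) hi⟩

theorem absolutelyContinuousOnInterval [S.OrdConnected] (hf : IsPrimitiveOn f f' S) {x y : ℝ}
    (hx : x ∈ S) (hy : y ∈ S) : AbsolutelyContinuousOnInterval f x y := by
  have hs : uIcc x y ⊆ S := OrdConnected.uIcc_subset ‹_› hx hy
  have hi := (hf x hx y hy).1
  have hG := hi.norm.absolutelyContinuousOnInterval_intervalIntegral (c := x) (by simp)
  refine squeeze_zero' (Eventually.of_forall fun E => Finset.sum_nonneg fun _ _ => dist_nonneg)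
    ?_ hG
  rw [eventually_inf_principal]
  refine Eventually.of_forall fun E hE => Finset.sum_le_sum fun i hi' => ?_
  have hm := hE.1 i hi'
  have h1 := hm.1
  have h2 := hm.2
  have hix1 : IntervalIntegrable f' volume x (E.2 i).1 := (hf x hx _ (hs h1)).1
  have hix2 : IntervalIntegrable f' volume x (E.2 i).2 := (hf x hx _ (hs h2)).1
  rw [dist_comm, dist_comm (∫ v in x..(E.2 i).1, ‖f' v‖), dist_eq_norm, dist_eq_norm,
    ← (hf _ (hs h1) _ (hs h2)).2,
    intervalIntegral.integral_interval_sub_left hix2.norm hix1.norm]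
  exact intervalIntegral.norm_integral_le_abs_integral_norm

theorem continuousOn [S.OrdConnected] (hS : IsOpen S) (hf : IsPrimitiveOn f f' S) :
    ContinuousOn f S := by
  intro x hx
  obtain ⟨ε, hε, hb⟩ := Metric.isOpen_iff.1 hS x hx
  have h1 : x - ε / 2 ∈ S := hb (by simp [abs_of_pos hε]; linarith)
  have h2 : x + ε / 2 ∈ S := hb (by simp [abs_of_pos hε]; linarith)
  have := (hf.absolutelyContinuousOnInterval h1 h2).continuousOn
  refine (this.continuousAt ?_).continuousWithinAt
  rw [uIcc_of_le (by linarith)]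
  exact Icc_mem_nhds (by linarith) (by linarith)

theorem ae_hasDerivAt [S.OrdConnected] (hS : IsOpen S) (hf : IsPrimitiveOn f f' S) :
    ∀ᵐ x, x ∈ S → HasDerivAt f (f' x) x := by
  have key : ∀ p q : ℚ, ∀ᵐ x : ℝ, (p : ℝ) ∈ S → (q : ℝ) ∈ S → x ∈ Ioo (p : ℝ) q →
      HasDerivAt f (f' x) x := by
    intro p q
    by_cases hp : (p : ℝ) ∈ S
    · by_cases hq : (q : ℝ) ∈ S
      · filter_upwards [(hf p hp q hq).1.ae_hasDerivAt_integral] with x hx _ _ hxx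
        have h := hx (Icc_subset_uIcc (Ioo_subset_Icc_self hxx)) p (by simp)
        have h3 : HasDerivAt (fun y => f p + ∫ t in (p : ℝ)..y, f' t) (f' x) x := h.const_add _
        refine h3.congr_of_eventuallyEq ?_
        filter_upwards [Ioo_mem_nhds hxx.1 hxx.2] with y hy
        have hyS : y ∈ S := OrdConnected.out ‹_› hp hq (Ioo_subset_Icc_self hy)
        rw [(hf p hp y hyS).2]; abel
      · exact Eventually.of_forall fun x _ h => absurd h hq
    · exact Eventually.of_forall fun x h => absurd h hp
  have key2 := ae_all_iff.2 fun p => ae_all_iff.2 fun q => key p q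
  filter_upwards [key2] with x hx hxS
  obtain ⟨ε, hε, hb⟩ := Metric.isOpen_iff.1 hS x hxS
  obtain ⟨p, hp1, hp2⟩ := exists_rat_btwn (show x - ε < x by linarith)
  obtain ⟨q, hq1, hq2⟩ := exists_rat_btwn (show x < x + ε by linarith)
  refine hx p q (hb ?_) (hb ?_) ⟨hp2, hq1⟩ <;> rw [Metric.mem_ball, Real.dist_eq, abs_lt] <;>
    constructor <;> linarith

theorem of_absolutelyContinuous [S.OrdConnected]
    (hac : ∀ x ∈ S, ∀ y ∈ S, AbsolutelyContinuousOnInterval f x y)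
    (hd : ∀ᵐ x, x ∈ S → HasDerivAt f (f' x) x)
    (hi : ∀ x ∈ S, ∀ y ∈ S, IntervalIntegrable f' volume x y) : IsPrimitiveOn f f' S := by
  intro x hx y hy
  refine ⟨hi x hx y hy, ?_⟩
  have hs : uIcc x y ⊆ S := OrdConnected.uIcc_subset ‹_› hx hy
  have hp : IsPrimitiveOn (fun z => ∫ t in x..z, f' t) f' S := fun u hu v hv =>
    ⟨hi u hu v hv, (intervalIntegral.integral_interval_sub_left (hi x hx v hv) (hi x hx u hu)).symm⟩
  have hac2 : AbsolutelyContinuousOnInterval (fun z => f z - ∫ t in x..z, f' t) x y :=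
    (hac x hx y hy).fun_sub (hp.absolutelyContinuousOnInterval hx hy)
  obtain ⟨C, hC⟩ := hac2.const_of_ae_hasDerivAt_zero (by
    filter_upwards [hd, (hi x hx y hy).ae_hasDerivAt_integral] with t h1 h2 ht
    simpa using (h1 (hs ht)).fun_sub (h2 ht x (by simp)))
  have h1 := hC x (by simp)
  have h2 := hC y (by simp)
  simp only [intervalIntegral.integral_same, sub_zero] at h1
  rw [h1, ← h2]; abel

/-- Chain rule for a continuously differentiable increasing change of variables. -/
theorem comp_of_deriv_nonneg [S.OrdConnected] {T : Set ℝ} [T.OrdConnected] {k k' : ℝ → ℝ}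
    (hf : IsPrimitiveOn f f' S) (hk : ∀ x ∈ T, HasDerivAt k (k' x) x)
    (h0 : ∀ x ∈ T, 0 ≤ k' x) (hm : MapsTo k T S) :
    IsPrimitiveOn (fun x => f (k x)) (fun x => k' x • f' (k x)) T := by
  intro x hx y hy
  have hs : uIcc x y ⊆ T := OrdConnected.uIcc_subset ‹_› hx hy
  have hc : ContinuousOn k (uIcc x y) := fun t ht => (hk t (hs ht)).continuousAt.continuousWithinAt
  have hs' : Ioo (min x y) (max x y) ⊆ uIcc x y := Ioo_subset_Icc_self
  have h1 := fun t (ht : t ∈ Ioo (min x y) (max x y)) => hk t (hs (hs' ht))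
  have h2 := fun t (ht : t ∈ Ioo (min x y) (max x y)) => h0 t (hs (hs' ht))
  refine ⟨?_, ?_⟩
  · exact (intervalIntegral.integrable_deriv_smul_comp_iff_of_deriv_nonneg hc h1 h2).2
      (hf _ (hm hx) _ (hm hy)).1
  · rw [← (hf _ (hm hx) _ (hm hy)).2]
    exact intervalIntegral.integral_deriv_smul_comp_of_deriv_nonneg hc h1 h2

end general

section product

variable {𝕜 : Type*} [RCLike 𝕜] {f f' g g' : ℝ → 𝕜} {S : Set ℝ}

theorem mul [S.OrdConnected] (hS : IsOpen S) (hf : IsPrimitiveOn f f' S)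
    (hg : IsPrimitiveOn g g' S) :
    IsPrimitiveOn (fun x => f x * g x) (fun x => f' x * g x + f x * g' x) S := by
  refine of_absolutelyContinuous (fun x hx y hy => ?_) ?_ fun x hx y hy => ?_
  · exact (hf.absolutelyContinuousOnInterval hx hy).fun_smul
      (hg.absolutelyContinuousOnInterval hx hy)
  · filter_upwards [hf.ae_hasDerivAt hS, hg.ae_hasDerivAt hS] with x h1 h2 hx
    exact (h1 hx).mul (h2 hx)
  · have hs : uIcc x y ⊆ S := OrdConnected.uIcc_subset ‹_› hx hy
    exact ((hf x hx y hy).1.mul_continuousOn ((hg.continuousOn hS).mono hs)).add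
      ((hg x hx y hy).1.continuousOn_mul ((hf.continuousOn hS).mono hs))

theorem const_mul (c : 𝕜) (hf : IsPrimitiveOn f f' S) :
    IsPrimitiveOn (fun x => c * f x) (fun x => c * f' x) S :=
  hf.clm_comp ((ContinuousLinearMap.mul 𝕜 𝕜 c).restrictScalars ℝ)

theorem conj (hf : IsPrimitiveOn f f' S) :
    IsPrimitiveOn (fun x => starRingEnd 𝕜 (f x)) (fun x => starRingEnd 𝕜 (f' x)) S :=
  hf.clm_comp (RCLike.conjCLE (K := 𝕜)).toContinuousLinearMap

theorem re (hf : IsPrimitiveOn f f' S) :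
    IsPrimitiveOn (fun x => RCLike.re (f x)) (fun x => RCLike.re (f' x)) S :=
  hf.clm_comp (RCLike.reCLM (K := 𝕜))

theorem ofReal {r r' : ℝ → ℝ} (hf : IsPrimitiveOn r r' S) :
    IsPrimitiveOn (fun x => ((r x : ℝ) : 𝕜)) (fun x => ((r' x : ℝ) : 𝕜)) S :=
  hf.clm_comp (RCLike.ofRealCLM (K := 𝕜))

theorem norm_sq [S.OrdConnected] (hS : IsOpen S) (hf : IsPrimitiveOn f f' S) :
    IsPrimitiveOn (fun x => ‖f x‖ ^ 2)
      (fun x => 2 * RCLike.re (starRingEnd 𝕜 (f x) * f' x)) S := by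
  refine ((hf.conj.mul hS hf).re).congr (fun x _ => ?_) (Eventually.of_forall fun x _ => ?_)
  · simp only [RCLike.conj_mul]
    norm_cast
  · simp only [map_add]
    rw [two_mul, ← RCLike.conj_re (_ * f x)]
    simp [mul_comm]

theorem mul_real [S.OrdConnected] (hS : IsOpen S) {r r' : ℝ → ℝ}
    (hr : ∀ x ∈ S, HasDerivAt r (r' x) x) (hc : ContinuousOn r' S)
    (hf : IsPrimitiveOn f f' S) :
    IsPrimitiveOn (fun x => (r x : 𝕜) * f x) (fun x => (r' x : 𝕜) * f x + (r x : 𝕜) * f' x) S :=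
  (of_hasDerivAt hr hc).ofReal.mul hS hf

end product

section limits

variable {𝕜 : Type*} [RCLike 𝕜] {f f' : ℝ → 𝕜} {c : ℝ}

/-- A primitive on a half-line with vanishing limits at both ends has derivative of integral `0`. -/
theorem integral_eq_zero {f f' : ℝ → 𝕜} (hf : IsPrimitiveOn f f' (Ioi 0))
    (hi : IntegrableOn f' (Ioi 0)) (h0 : Tendsto f (𝓝[>] 0) (𝓝 0))
    (h1 : Tendsto f atTop (𝓝 0)) : ∫ x in Ioi 0, f' x = 0 := by
  have hA : Tendsto (fun n : ℝ => ∫ x in n⁻¹..n, f' x) atTop (𝓝 (∫ x in Ioi 0, f' x)) := by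
    have hcov : AECover (volume.restrict (Ioi (0 : ℝ))) atTop (fun n : ℝ => Ioc n⁻¹ n) := by
      refine ⟨?_, fun _ => measurableSet_Ioc⟩
      filter_upwards [ae_restrict_mem measurableSet_Ioi] with x hx
      have hx : 0 < x := hx
      filter_upwards [eventually_ge_atTop x, eventually_gt_atTop x⁻¹] with n h1 h2
      exact ⟨inv_lt_of_inv_lt₀ hx h2, h1⟩
    refine (hcov.integral_tendsto_of_countably_generated hi).congr' ?_
    filter_upwards [eventually_ge_atTop 1] with n hn
    have hn0 : (0 : ℝ) < n⁻¹ := by positivity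
    rw [intervalIntegral.integral_of_le ((inv_le_one_of_one_le₀ hn).trans hn),
      Measure.restrict_restrict measurableSet_Ioc, inter_eq_left.2]
    exact fun x hx => hn0.trans hx.1
  have hB : Tendsto (fun n : ℝ => ∫ x in n⁻¹..n, f' x) atTop (𝓝 (0 - 0)) := by
    have h3 : Tendsto (fun n : ℝ => f n - f n⁻¹) atTop (𝓝 (0 - 0)) :=
      h1.sub (h0.comp tendsto_inv_atTop_nhdsGT_zero)
    refine h3.congr' ?_
    filter_upwards [eventually_gt_atTop 0] with n hn
    exact ((hf n⁻¹ (inv_pos.2 hn) n hn).2).symm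
  simpa using tendsto_nhds_unique hA hB

/-- A primitive on a half-line that is integrable together with its derivative vanishes at `∞`. -/
theorem tendsto_atTop_zero {E : Type*} [NormedAddCommGroup E] [NormedSpace ℝ E] [CompleteSpace E]
    {f f' : ℝ → E} (hf : IsPrimitiveOn f f' (Ioi c))
    (hi : IntegrableOn f (Ioi c)) (hi' : IntegrableOn f' (Ioi c)) :
    Tendsto f atTop (𝓝 0) := by
  have h1 : Tendsto f atTop (𝓝 (f (c + 1) + ∫ x in Ioi (c + 1), f' x)) := by
    have := intervalIntegral_tendsto_integral_Ioi (c + 1)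
      (hi'.mono_set (Ioi_subset_Ioi (by linarith))) tendsto_id
    refine (this.const_add (f (c + 1))).congr' ?_
    filter_upwards [eventually_gt_atTop c] with y hy
    simp only [id]
    rw [(hf (c + 1) (by simp) y hy).2]; abel
  have h2 : IntegrableAtFilter f atTop volume := ⟨Ioi c, Ioi_mem_atTop c, hi⟩
  have h3 := h2.eq_zero_of_tendsto (fun s hs => by
    obtain ⟨a, ha⟩ := mem_atTop_sets.1 hs
    refine top_le_iff.1 ?_
    rw [← Real.volume_Ici (a := a)]
    exact measure_mono ha) h1
  rwa [h3] at h1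

end limits

end IsPrimitiveOn

variable {𝕜 : Type*} [RCLike 𝕜]

/-! ### The Hilbert space structure of `H¹` -/

theorem _root_.MeasureTheory.MemLp.intervalIntegrable {E : Type*} [NormedAddCommGroup E]
    {f : ℝ → E} (hf : MemLp f 2 volume) (x y : ℝ) : IntervalIntegrable f volume x y := by
  have h : LocallyIntegrable f volume := hf.locallyIntegrable (by norm_num)
  exact (h.integrableOn_isCompact isCompact_uIcc).intervalIntegrable

theorem _root_.MeasureTheory.MemLp.integrable_conj_mul {μ : Measure ℝ} {f g : ℝ → 𝕜}
    (hf : MemLp f 2 μ) (hg : MemLp g 2 μ) :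
    Integrable (fun x => starRingEnd 𝕜 (f x) * g x) μ :=
  MemLp.integrable_mul hf.star hg

namespace MemH1

variable {v w v' : ℝ → 𝕜}

theorem isPrimitiveOn (hv : MemH1 v) : IsPrimitiveOn v (deriv v) univ := fun x _ y _ =>
  ⟨hv.memLp_deriv.intervalIntegrable x y, (hv.sub_eq_integral x y).symm⟩

theorem of_isPrimitiveOn (h : IsPrimitiveOn v v' univ) (h2 : MemLp v 2 volume)
    (h2' : MemLp v' 2 volume) : MemH1 v ∧ deriv v =ᵐ[volume] v' := by
  have hae : deriv v =ᵐ[volume] v' := by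
    filter_upwards [h.ae_hasDerivAt isOpen_univ] with x hx using (hx (mem_univ x)).deriv
  refine ⟨⟨h2, (memLp_congr_ae hae).2 h2', fun x y => ?_⟩, hae⟩
  rw [← (h x (mem_univ _) y (mem_univ _)).2]
  refine (intervalIntegral.integral_congr_ae ?_).symm
  filter_upwards [hae] with t ht _ using ht

theorem continuous (hv : MemH1 v) : Continuous v :=
  continuousOn_univ.1 (hv.isPrimitiveOn.continuousOn isOpen_univ)

theorem add_aux (hv : MemH1 v) (hw : MemH1 w) : MemH1 (fun x => v x + w x) ∧
    deriv (fun x => v x + w x) =ᵐ[volume] fun x => deriv v x + deriv w x :=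
  of_isPrimitiveOn (hv.isPrimitiveOn.add hw.isPrimitiveOn) (hv.memLp.add hw.memLp)
    (hv.memLp_deriv.add hw.memLp_deriv)

theorem add (hv : MemH1 v) (hw : MemH1 w) : MemH1 (fun x => v x + w x) := (hv.add_aux hw).1

theorem const_mul (c : 𝕜) (hv : MemH1 v) : MemH1 (fun x => c * v x) :=
  (of_isPrimitiveOn (hv.isPrimitiveOn.const_mul c) (hv.memLp.const_mul c)
    (hv.memLp_deriv.const_mul c)).1

theorem sub_aux (hv : MemH1 v) (hw : MemH1 w) : MemH1 (fun x => v x - w x) ∧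
    deriv (fun x => v x - w x) =ᵐ[volume] fun x => deriv v x - deriv w x :=
  of_isPrimitiveOn (hv.isPrimitiveOn.sub hw.isPrimitiveOn) (hv.memLp.sub hw.memLp)
    (hv.memLp_deriv.sub hw.memLp_deriv)

theorem sub (hv : MemH1 v) (hw : MemH1 w) : MemH1 (fun x => v x - w x) := (hv.sub_aux hw).1

theorem comp_neg (hv : MemH1 v) : MemH1 (fun x => v (-x)) := by
  have hd : deriv (fun x => v (-x)) = fun x => -deriv v (-x) := by
    ext x; exact deriv_comp_neg v x
  refine ⟨hv.memLp.comp_measurePreserving (Measure.measurePreserving_neg volume), ?_, fun x y => ?_⟩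
  · rw [hd]
    exact (hv.memLp_deriv.comp_measurePreserving (Measure.measurePreserving_neg volume)).neg
  · rw [hd, hv.sub_eq_integral (-x) (-y), intervalIntegral.integral_neg,
      intervalIntegral.integral_comp_neg, intervalIntegral.integral_symm]

/-- The pair of a function and its derivative as an element of a Hilbert space. -/
def toHilbert (hv : MemH1 v) : WithLp 2 (Lp 𝕜 2 (volume : Measure ℝ) × Lp 𝕜 2 (volume : Measure ℝ)) :=
  WithLp.toLp 2 (hv.memLp.toLp v, hv.memLp_deriv.toLp (deriv v))

theorem inner_toHilbert (hw : MemH1 w) (hv : MemH1 v) :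
    inner 𝕜 hw.toHilbert hv.toHilbert = h1Inner w v := by
  rw [WithLp.prod_inner_apply, L2.inner_def, L2.inner_def, h1Inner]
  congr 1
  · refine integral_congr_ae ?_
    filter_upwards [hw.memLp.coeFn_toLp, hv.memLp.coeFn_toLp] with x h1 h2
    simp only [toHilbert, h1, h2]
  · refine integral_congr_ae ?_
    filter_upwards [hw.memLp_deriv.coeFn_toLp, hv.memLp_deriv.coeFn_toLp] with x h1 h2
    simp only [toHilbert, h1, h2]

theorem h1Inner_self (v : ℝ → 𝕜) : h1Inner v v = ((h1Norm v ^ 2 : ℝ) : 𝕜) := by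
  rw [h1Norm, Real.sq_sqrt (by positivity), h1Inner]
  have h : ∀ f : ℝ → 𝕜, ∫ ξ, inner 𝕜 (f ξ) (f ξ) = ((∫ ξ, ‖f ξ‖ ^ 2 : ℝ) : 𝕜) := fun f => by
    simp only [inner_self_eq_norm_sq_to_K, ← RCLike.ofReal_pow]
    exact integral_ofReal
  rw [h, h, RCLike.ofReal_add]

theorem norm_toHilbert (hv : MemH1 v) : ‖hv.toHilbert‖ = h1Norm v := by
  have h : ‖hv.toHilbert‖ ^ 2 = h1Norm v ^ 2 := by
    have h1 := hv.inner_toHilbert hv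
    rw [h1Inner_self, inner_self_eq_norm_sq_to_K] at h1
    exact_mod_cast h1
  exact (pow_left_inj₀ (norm_nonneg _) (Real.sqrt_nonneg _) two_ne_zero).1 h

theorem toHilbert_add (hv : MemH1 v) (hw : MemH1 w) :
    (hv.add hw).toHilbert = hv.toHilbert + hw.toHilbert := by
  simp only [toHilbert, ← WithLp.toLp_add, Prod.mk_add_mk, ← MemLp.toLp_add]
  congr 2
  exact MemLp.toLp_congr _ _ (hv.add_aux hw).2

theorem toHilbert_sub (hv : MemH1 v) (hw : MemH1 w) :
    (hv.sub hw).toHilbert = hv.toHilbert - hw.toHilbert := by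
  simp only [toHilbert, ← WithLp.toLp_sub, Prod.mk_sub_mk, ← MemLp.toLp_sub]
  congr 2
  exact MemLp.toLp_congr _ _ (hv.sub_aux hw).2

theorem h1Norm_add_le (hv : MemH1 v) (hw : MemH1 w) :
    h1Norm (fun x => v x + w x) ≤ h1Norm v + h1Norm w := by
  rw [← hv.norm_toHilbert, ← hw.norm_toHilbert, ← (hv.add hw).norm_toHilbert, toHilbert_add]
  exact norm_add_le _ _

theorem norm_h1Inner_le (hw : MemH1 w) (hv : MemH1 v) : ‖h1Inner w v‖ ≤ h1Norm w * h1Norm v := by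
  rw [← hw.inner_toHilbert hv, ← hv.norm_toHilbert, ← hw.norm_toHilbert]
  exact norm_inner_le_norm _ _

theorem eq_zero_of_h1Norm (hv : MemH1 v) (h : h1Norm v = 0) : v = 0 := by
  have h1 : hv.toHilbert = 0 := by rw [← norm_eq_zero, norm_toHilbert, h]
  have h2 : hv.memLp.toLp v = 0 := congrArg (fun z => z.fst) h1
  rw [← MemLp.toLp_zero (MemLp.zero' (ε := 𝕜) (p := 2) (μ := (volume : Measure ℝ))), MemLp.toLp_eq_toLp_iff] at h2
  exact (hv.continuous.ae_eq_iff_eq volume continuous_zero).1 h2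

end MemH1

theorem h1Norm_nonneg (v : ℝ → 𝕜) : 0 ≤ h1Norm v := Real.sqrt_nonneg _

theorem MemH1.h1Norm_pos {v : ℝ → 𝕜} (hv : MemH1 v) (h : v ≠ 0) : 0 < h1Norm v :=
  (h1Norm_nonneg v).lt_of_ne fun h0 => h (hv.eq_zero_of_h1Norm h0.symm)

theorem deriv_const_mul_apply (c : 𝕜) (v : ℝ → 𝕜) (x : ℝ) :
    deriv (fun x => c * v x) x = c * deriv v x := deriv_const_mul_field c

theorem h1Norm_const_mul (c : 𝕜) (v : ℝ → 𝕜) : h1Norm (fun x => c * v x) = ‖c‖ * h1Norm v := by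
  simp only [h1Norm, deriv_const_mul_apply, norm_mul, mul_pow, integral_const_mul]
  rw [← mul_add, Real.sqrt_mul (by positivity), Real.sqrt_sq (norm_nonneg c)]

theorem h1Inner_const_mul_left (c : 𝕜) (w v : ℝ → 𝕜) :
    h1Inner (fun x => c * w x) v = starRingEnd 𝕜 c * h1Inner w v := by
  have h : ∀ x y : 𝕜, inner 𝕜 (c * x) y = starRingEnd 𝕜 c * inner 𝕜 x y :=
    fun x y => inner_smul_left x y c
  simp only [h1Inner, deriv_const_mul_apply, h, integral_const_mul, mul_add]

theorem h1Norm_comp_neg (v : ℝ → 𝕜) : h1Norm (fun x => v (-x)) = h1Norm v := by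
  simp only [h1Norm, deriv_comp_neg, norm_neg]
  rw [integral_neg_eq_self (fun x => ‖v x‖ ^ 2) volume,
    integral_neg_eq_self (fun x => ‖deriv v x‖ ^ 2) volume]

/-! ### Functions on the half-line -/

/-- `f` lies in `H¹₀(0, ∞)` and `f'` is its derivative there. -/
structure HalfH1 (f f' : ℝ → 𝕜) : Prop where
  prim : IsPrimitiveOn f f' (Ioi 0)
  memLp : MemLp f 2 (volume.restrict (Ioi 0))
  memLp_deriv : MemLp f' 2 (volume.restrict (Ioi 0))
  tendsto : Tendsto f (𝓝[>] 0) (𝓝 0)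

/-- The part of a function that lives on the right half-line. -/
def rightPart (f : ℝ → 𝕜) : ℝ → 𝕜 := indicator (Ioi 0) f

theorem rightPart_of_pos (f : ℝ → 𝕜) {x : ℝ} (hx : 0 < x) : rightPart f x = f x :=
  indicator_of_mem (mem_Ioi.2 hx) f

theorem rightPart_of_nonpos (f : ℝ → 𝕜) {x : ℝ} (hx : x ≤ 0) : rightPart f x = 0 :=
  indicator_of_notMem (fun h => not_lt.2 hx h) f

theorem MemH1Zero.halfH1 {v : ℝ → 𝕜} (hv : MemH1Zero v) : HalfH1 v (deriv v) where
  prim := hv.1.isPrimitiveOn.mono (subset_univ _)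
  memLp := hv.1.memLp.restrict _
  memLp_deriv := hv.1.memLp_deriv.restrict _
  tendsto := by
    have h := hv.1.continuous.tendsto 0
    rw [hv.2] at h
    exact h.mono_left nhdsWithin_le_nhds

namespace HalfH1

variable {f f' g g' : ℝ → 𝕜}

theorem isPrimitiveOn_rightPart (h : HalfH1 f f') :
    IsPrimitiveOn (rightPart f) (rightPart f') univ := by
  have hL : MemLp (rightPart f') 2 volume :=
    (memLp_indicator_iff_restrict measurableSet_Ioi).2 h.memLp_deriv
  have hi := fun x y => hL.intervalIntegrable x y
  have key : ∀ y, rightPart f y = ∫ t in (0 : ℝ)..y, rightPart f' t := by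
    intro y
    rcases le_or_gt y 0 with hy | hy
    · rw [rightPart_of_nonpos f hy, eq_comm]
      refine intervalIntegral.integral_zero_ae (Eventually.of_forall fun t ht => ?_)
      rw [uIoc_of_ge hy] at ht
      exact rightPart_of_nonpos _ ht.2
    · have hc : Continuous fun e => ∫ t in e..y, rightPart f' t := by
        simp_rw [intervalIntegral.integral_symm y]
        exact (intervalIntegral.continuous_primitive hi y).neg
      have h1 : Tendsto (fun e => ∫ t in e..y, rightPart f' t) (𝓝[>] 0)
          (𝓝 (∫ t in (0 : ℝ)..y, rightPart f' t)) :=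
        (hc.tendsto 0).mono_left nhdsWithin_le_nhds
      have h2 : Tendsto (fun e => ∫ t in e..y, rightPart f' t) (𝓝[>] 0) (𝓝 (f y - 0)) := by
        refine (tendsto_const_nhds.sub h.tendsto).congr' ?_
        filter_upwards [self_mem_nhdsWithin] with e he
        rw [← (h.prim e he y hy).2]
        refine intervalIntegral.integral_congr_ae (Eventually.of_forall fun t ht => ?_)
        exact (rightPart_of_pos f' (lt_of_lt_of_le (lt_min he hy) ht.1.le)).symm
      rw [rightPart_of_pos f hy, tendsto_nhds_unique h1 h2, sub_zero]
  intro x _ y _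
  refine ⟨hi x y, ?_⟩
  rw [key x, key y, intervalIntegral.integral_interval_sub_left (hi 0 y) (hi 0 x)]

theorem rightPart_aux (h : HalfH1 f f') : MemH1 (rightPart f) ∧
    deriv (rightPart f) =ᵐ[volume] rightPart f' :=
  MemH1.of_isPrimitiveOn h.isPrimitiveOn_rightPart
    ((memLp_indicator_iff_restrict measurableSet_Ioi).2 h.memLp)
    ((memLp_indicator_iff_restrict measurableSet_Ioi).2 h.memLp_deriv)

theorem memH1Zero (h : HalfH1 f f') : MemH1Zero (rightPart f) :=
  ⟨h.rightPart_aux.1, rightPart_of_nonpos f le_rfl⟩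

theorem congr (h : HalfH1 f f') (hf : EqOn f g (Ioi 0)) (hf' : ∀ᵐ x, x ∈ Ioi 0 → f' x = g' x) :
    HalfH1 g g' where
  prim := h.prim.congr hf hf'
  memLp := h.memLp.ae_eq ((ae_restrict_iff' measurableSet_Ioi).2 (Eventually.of_forall hf))
  memLp_deriv := h.memLp_deriv.ae_eq ((ae_restrict_iff' measurableSet_Ioi).2 hf')
  tendsto := h.tendsto.congr' (eventually_nhdsWithin_of_forall hf)

theorem add (hf : HalfH1 f f') (hg : HalfH1 g g') :
    HalfH1 (fun x => f x + g x) (fun x => f' x + g' x) where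
  prim := hf.prim.add hg.prim
  memLp := hf.memLp.add hg.memLp
  memLp_deriv := hf.memLp_deriv.add hg.memLp_deriv
  tendsto := by simpa using hf.tendsto.add hg.tendsto

theorem const_mul (c : 𝕜) (hf : HalfH1 f f') :
    HalfH1 (fun x => c * f x) (fun x => c * f' x) where
  prim := hf.prim.const_mul c
  memLp := hf.memLp.const_mul c
  memLp_deriv := hf.memLp_deriv.const_mul c
  tendsto := by simpa using hf.tendsto.const_mul c

/-- Multiplication by a bounded function with bounded derivative. -/
theorem mul_real {r r' : ℝ → ℝ} {C : ℝ} (hf : HalfH1 f f')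
    (hr : ∀ x ∈ Ioi (0 : ℝ), HasDerivAt r (r' x) x) (hc : ContinuousOn r' (Ioi 0))
    (hb : ∀ x ∈ Ioi (0 : ℝ), |r x| ≤ C) (hb' : ∀ x ∈ Ioi (0 : ℝ), |r' x| ≤ C) :
    HalfH1 (fun x => (r x : 𝕜) * f x) (fun x => (r' x : 𝕜) * f x + (r x : 𝕜) * f' x) := by
  have hrc : ContinuousOn r (Ioi 0) := fun x hx => (hr x hx).continuousAt.continuousWithinAt
  have key : ∀ (k : ℝ → ℝ) (q : ℝ → 𝕜), ContinuousOn k (Ioi 0) → (∀ x ∈ Ioi (0 : ℝ), |k x| ≤ C) →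
      MemLp q 2 (volume.restrict (Ioi 0)) →
      MemLp (fun x => (k x : 𝕜) * q x) 2 (volume.restrict (Ioi 0)) := by
    intro k q hk hkb hq
    refine (hq.norm.const_mul C).mono'
      (((RCLike.continuous_ofReal.comp_continuousOn hk).aestronglyMeasurable
        measurableSet_Ioi).mul hq.1) ?_
    filter_upwards [ae_restrict_mem measurableSet_Ioi] with x hx
    rw [norm_mul, RCLike.norm_ofReal]
    exact mul_le_mul_of_nonneg_right (hkb x hx) (norm_nonneg _)
  refine ⟨hf.prim.mul_real isOpen_Ioi hr hc, key r f hrc hb hf.memLp,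
    (key r' f hc hb' hf.memLp).add (key r f' hrc hb hf.memLp_deriv), ?_⟩
  refine squeeze_zero_norm' ?_ (by simpa using hf.tendsto.norm.const_mul C)
  filter_upwards [self_mem_nhdsWithin] with x hx
  rw [norm_mul, RCLike.norm_ofReal]
  exact mul_le_mul_of_nonneg_right (hb x hx) (norm_nonneg _)

theorem integrableOn_norm_sq (hf : HalfH1 f f') : IntegrableOn (fun x => ‖f x‖ ^ 2) (Ioi 0) :=
  hf.memLp.norm.integrable_sq

theorem integrableOn_deriv_norm_sq (hf : HalfH1 f f') :
    IntegrableOn (fun x => ‖f' x‖ ^ 2) (Ioi 0) :=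
  hf.memLp_deriv.norm.integrable_sq

theorem tendsto_atTop (hf : HalfH1 f f') : Tendsto f atTop (𝓝 0) := by
  have h1 := (hf.prim.norm_sq isOpen_Ioi).tendsto_atTop_zero hf.integrableOn_norm_sq (by
    have h : IntegrableOn (fun x => starRingEnd 𝕜 (f x) * f' x) (Ioi 0) := hf.memLp.integrable_conj_mul hf.memLp_deriv
    exact h.re.const_mul 2)
  have h2 : Tendsto (fun x => ‖f x‖) atTop (𝓝 0) := by
    have := h1.sqrt
    simpa [Real.sqrt_sq (norm_nonneg _)] using this
  exact tendsto_zero_iff_norm_tendsto_zero.2 h2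

theorem h1Norm_rightPart_sq (hf : HalfH1 f f') :
    h1Norm (rightPart f) ^ 2 = (∫ x in Ioi 0, ‖f x‖ ^ 2) + ∫ x in Ioi 0, ‖f' x‖ ^ 2 := by
  rw [h1Norm, Real.sq_sqrt (by positivity)]
  have h : ∀ q : ℝ → 𝕜, (∫ x, ‖rightPart q x‖ ^ 2) = ∫ x in Ioi 0, ‖q x‖ ^ 2 := by
    intro q
    rw [← integral_indicator measurableSet_Ioi]
    congr 1; ext x
    by_cases hx : x ∈ Ioi (0 : ℝ) <;> simp [rightPart, hx]
  congr 1
  · exact h f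
  · rw [← h f']
    refine integral_congr_ae ?_
    filter_upwards [hf.rightPart_aux.2] with x hx
    rw [hx]

/-- Near `0`, an element of `H¹₀(0, ∞)` is `o(√x)`. -/
theorem tendsto_norm_sq_div (hf : HalfH1 f f') :
    Tendsto (fun x => ‖f x‖ ^ 2 / x) (𝓝[>] 0) (𝓝 0) := by
  have hL : MemLp (rightPart f') 2 volume :=
    (memLp_indicator_iff_restrict measurableSet_Ioi).2 hf.memLp_deriv
  have hsq : Integrable (fun x => ‖rightPart f' x‖ ^ 2) := hL.norm.integrable_sq
  have hcont : Tendsto (fun x => ∫ t in (0 : ℝ)..x, ‖rightPart f' t‖ ^ 2) (𝓝[>] 0) (𝓝 0) := by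
    have hc := intervalIntegral.continuous_primitive (μ := volume)
      (fun a b => hsq.intervalIntegrable (a := a) (b := b)) 0
    have := hc.tendsto 0
    simp only [intervalIntegral.integral_same] at this
    exact this.mono_left nhdsWithin_le_nhds
  refine squeeze_zero' ?_ ?_ hcont
  · filter_upwards [self_mem_nhdsWithin] with x hx
    have : (0 : ℝ) < x := hx
    positivity
  · filter_upwards [self_mem_nhdsWithin] with x hx
    have hx : (0 : ℝ) < x := hx
    have h1 : f x = ∫ t in (0 : ℝ)..x, rightPart f' t := by
      have := (hf.isPrimitiveOn_rightPart 0 (mem_univ _) x (mem_univ _)).2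
      rw [this, rightPart_of_pos f hx, rightPart_of_nonpos f le_rfl, sub_zero]
    have h2 : ‖f x‖ ≤ ∫ t in (0 : ℝ)..x, ‖rightPart f' t‖ := by
      rw [h1]; exact intervalIntegral.norm_integral_le_integral_norm hx.le
    have hcs : (∫ t in (0 : ℝ)..x, ‖rightPart f' t‖) ^ 2 ≤
        x * ∫ t in (0 : ℝ)..x, ‖rightPart f' t‖ ^ 2 := by
      set A := ∫ t in (0 : ℝ)..x, ‖rightPart f' t‖ with hA
      have hI : IntervalIntegrable (fun t => ‖rightPart f' t‖) volume 0 x :=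
        (hL.intervalIntegrable 0 x).norm
      have h3 : 0 ≤ ∫ t in (0 : ℝ)..x, (‖rightPart f' t‖ - A / x) ^ 2 :=
        intervalIntegral.integral_nonneg hx.le fun t _ => sq_nonneg _
      have h4 : ∫ t in (0 : ℝ)..x, (‖rightPart f' t‖ - A / x) ^ 2 =
          (∫ t in (0 : ℝ)..x, ‖rightPart f' t‖ ^ 2) - 2 * (A / x) * A + x * (A / x) ^ 2 := by
        have : ∀ t, (‖rightPart f' t‖ - A / x) ^ 2 =
            ‖rightPart f' t‖ ^ 2 - 2 * (A / x) * ‖rightPart f' t‖ + (A / x) ^ 2 := fun t => by ring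
        simp_rw [this]
        rw [intervalIntegral.integral_add
          (hsq.intervalIntegrable.sub (hI.const_mul _)) intervalIntegrable_const,
          intervalIntegral.integral_sub hsq.intervalIntegrable (hI.const_mul _),
          intervalIntegral.integral_const_mul, intervalIntegral.integral_const]
        simp [hA]
      rw [h4] at h3
      have h5 : x * ((∫ t in (0 : ℝ)..x, ‖rightPart f' t‖ ^ 2) - 2 * (A / x) * A + x * (A / x) ^ 2)
          = x * (∫ t in (0 : ℝ)..x, ‖rightPart f' t‖ ^ 2) - A ^ 2 := by
        field_simp; ring
      nlinarith [mul_nonneg hx.le h3]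
    rw [div_le_iff₀ hx, mul_comm]
    exact (pow_le_pow_left₀ (norm_nonneg _) h2 2).trans hcs

theorem h1Inner_rightPart {v : ℝ → 𝕜} (hf : HalfH1 f f') (hv : MemH1 v) :
    h1Inner (rightPart f) v = ∫ x in Ioi 0,
      (starRingEnd 𝕜 (f x) * v x + starRingEnd 𝕜 (f' x) * deriv v x) := by
  have h : ∀ q k : ℝ → 𝕜, (∫ x, inner 𝕜 (rightPart q x) (k x)) =
      ∫ x in Ioi 0, starRingEnd 𝕜 (q x) * k x := by
    intro q k
    rw [← integral_indicator measurableSet_Ioi]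
    congr 1; ext x
    by_cases hx : x ∈ Ioi (0 : ℝ) <;> simp [rightPart, hx, mul_comm]
  rw [h1Inner, h, integral_add]
  · congr 1
    rw [← h]
    refine integral_congr_ae ?_
    filter_upwards [hf.rightPart_aux.2] with x hx
    rw [hx]
  · exact hf.memLp.integrable_conj_mul (hv.memLp.restrict _)
  · exact hf.memLp_deriv.integrable_conj_mul (hv.memLp_deriv.restrict _)

end HalfH1

theorem eq_rightPart_add {f : ℝ → 𝕜} (h0 : f 0 = 0) :
    f = fun x => rightPart f x + rightPart (fun y => f (-y)) (-x) := by
  ext x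
  rcases lt_trichotomy x 0 with h | h | h
  · simp [rightPart_of_nonpos f h.le, rightPart_of_pos _ (neg_pos.2 h)]
  · simp [h, rightPart, h0]
  · simp [rightPart_of_pos f h, rightPart_of_nonpos _ (neg_nonpos.2 h.le)]

theorem MemH1Zero.add {f g : ℝ → 𝕜} (hf : MemH1Zero f) (hg : MemH1Zero g) :
    MemH1Zero (fun x => f x + g x) := ⟨hf.1.add hg.1, by simp [hf.2, hg.2]⟩

theorem MemH1Zero.const_mul {f : ℝ → 𝕜} (c : 𝕜) (hf : MemH1Zero f) :
    MemH1Zero (fun x => c * f x) := ⟨hf.1.const_mul c, by simp [hf.2]⟩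

theorem MemH1Zero.comp_neg {f : ℝ → 𝕜} (hf : MemH1Zero f) : MemH1Zero (fun x => f (-x)) :=
  ⟨hf.1.comp_neg, by simp [hf.2]⟩

theorem HalfH1.glue {f f' g' : ℝ → 𝕜} (hf : HalfH1 f f') (hg : HalfH1 (fun x => f (-x)) g')
    (h0 : f 0 = 0) : MemH1Zero f := by
  rw [eq_rightPart_add h0]
  exact hf.memH1Zero.add hg.memH1Zero.comp_neg

/-- The `H¹` inner product as a sum of two integrals over the half-line. -/
theorem h1Inner_eq_add {v w : ℝ → 𝕜} (hv : MemH1 v) (hw : MemH1 w) :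
    h1Inner v w =
      (∫ x in Ioi 0, (starRingEnd 𝕜 (v x) * w x + starRingEnd 𝕜 (deriv v x) * deriv w x)) +
      ∫ x in Ioi 0, (starRingEnd 𝕜 (v (-x)) * w (-x) +
        starRingEnd 𝕜 (deriv v (-x)) * deriv w (-x)) := by
  have h1 : Integrable (fun x => starRingEnd 𝕜 (v x) * w x) := hv.memLp.integrable_conj_mul hw.memLp
  have h2 : Integrable (fun x => starRingEnd 𝕜 (deriv v x) * deriv w x) := by
    exact hv.memLp_deriv.integrable_conj_mul hw.memLp_deriv
  have h3 : Integrable (fun x => starRingEnd 𝕜 (v x) * w x +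
      starRingEnd 𝕜 (deriv v x) * deriv w x) := h1.add h2
  have h4 : h1Inner v w =
      ∫ x, (starRingEnd 𝕜 (v x) * w x + starRingEnd 𝕜 (deriv v x) * deriv w x) := by
    rw [integral_add h1 h2, h1Inner]
    simp only [RCLike.inner_apply, mul_comm]
  rw [h4, ← integral_add_compl measurableSet_Ioi (s := Ioi (0 : ℝ)) h3, compl_Ioi]
  congr 1
  rw [integral_comp_neg_Ioi (c := (0 : ℝ)) (f := fun x =>
    starRingEnd 𝕜 (v x) * w x + starRingEnd 𝕜 (deriv v x) * deriv w x), neg_zero]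

/-! ### The peakon profile -/

theorem peakon_of_nonneg {x : ℝ} (hx : 0 ≤ x) : peakon x = Real.exp (-x) := by
  rw [peakon, abs_of_nonneg hx]

theorem peakon_of_nonpos {x : ℝ} (hx : x ≤ 0) : peakon x = Real.exp x := by
  rw [peakon, abs_of_nonpos hx, neg_neg]

theorem peakonDeriv_of_pos {x : ℝ} (hx : 0 < x) : peakonDeriv x = -Real.exp (-x) := by
  simp [peakonDeriv, hx, abs_of_pos hx]

theorem peakonDeriv_of_neg {x : ℝ} (hx : x < 0) : peakonDeriv x = Real.exp x := by
  simp [peakonDeriv, hx, abs_of_neg hx]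

theorem peakonDeriv_zero : peakonDeriv 0 = 0 := by simp [peakonDeriv]

theorem peakon_zero : peakon 0 = 1 := by simp [peakon]

theorem peakon_neg (x : ℝ) : peakon (-x) = peakon x := by simp [peakon]

theorem peakonDeriv_neg (x : ℝ) : peakonDeriv (-x) = -peakonDeriv x := by
  rcases lt_trichotomy x 0 with h | rfl | h
  · rw [peakonDeriv_of_neg h, peakonDeriv_of_pos (neg_pos.2 h), neg_neg]
  · simp [peakonDeriv_zero]
  · rw [peakonDeriv_of_pos h, peakonDeriv_of_neg (neg_lt_zero.2 h), neg_neg]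

theorem peakon_pos (x : ℝ) : 0 < peakon x := Real.exp_pos _

theorem peakon_le_one (x : ℝ) : peakon x ≤ 1 := by simp [peakon]

theorem abs_peakonDeriv_le (x : ℝ) : |peakonDeriv x| ≤ peakon x := by
  rcases lt_trichotomy x 0 with h | rfl | h
  · rw [peakonDeriv_of_neg h, peakon_of_nonpos h.le, abs_of_pos (Real.exp_pos _)]
  · simp [peakonDeriv_zero, (peakon_pos 0).le]
  · rw [peakonDeriv_of_pos h, peakon_of_nonneg h.le, abs_neg, abs_of_pos (Real.exp_pos _)]

theorem continuous_peakon : Continuous peakon := by unfold peakon; fun_prop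

theorem measurable_peakonDeriv : Measurable peakonDeriv := by
  have : peakonDeriv = fun x => if 0 < x then -Real.exp (-x) else if x < 0 then Real.exp x else 0 := by
    ext x
    rcases lt_trichotomy x 0 with h | rfl | h
    · simp [peakonDeriv_of_neg h, h, h.le.not_gt]
    · simp [peakonDeriv_zero]
    · simp [peakonDeriv_of_pos h, h]
  rw [this]
  refine Measurable.ite measurableSet_Ioi (by fun_prop) (Measurable.ite measurableSet_Iio ?_ ?_)
  · fun_prop
  · fun_prop

theorem integrableOn_exp_neg {c : ℝ} (hc : 0 < c) : IntegrableOn (fun x => Real.exp (-c * x)) (Ioi 0) :=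
  integrableOn_exp_mul_Ioi (neg_lt_zero.2 hc) 0

theorem memLp_exp_neg {c : ℝ} (hc : 0 < c) :
    MemLp (fun x : ℝ => Real.exp (-c * x)) 2 (volume.restrict (Ioi 0)) := by
  rw [memLp_two_iff_integrable_sq (by fun_prop)]
  refine (integrableOn_exp_neg (c := 2 * c) (by positivity)).congr_fun (fun x _ => ?_)
    measurableSet_Ioi
  simp only [← Real.exp_nat_mul]
  congr 1; push_cast; ring

theorem memLp_peakon : MemLp peakon 2 volume := by
  rw [memLp_two_iff_integrable_sq continuous_peakon.aestronglyMeasurable]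
  have h1 : IntegrableOn (fun x => peakon x ^ 2) (Ioi 0) := by
    refine (integrableOn_exp_neg (c := 2) (by positivity)).congr_fun (fun x hx => ?_)
      measurableSet_Ioi
    simp only [peakon_of_nonneg (le_of_lt hx), ← Real.exp_nat_mul]
    congr 1; push_cast; ring
  have h2 : IntegrableOn (fun x => peakon x ^ 2) (Iic 0) := by
    have := ((integrableOn_Ici_iff_integrableOn_Ioi).2 h1)
    rw [← (Measure.measurePreserving_neg volume).integrableOn_comp_preimage
      (MeasurableEquiv.neg ℝ).measurableEmbedding] at this
    simpa [Function.comp_def, peakon_neg] using this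
  have := h2.union h1
  rwa [Iic_union_Ioi, integrableOn_univ] at this

theorem memH1_peakon : MemH1 (fun x => (peakon x : 𝕜)) := by
  have hp : MemLp (fun x => (peakon x : 𝕜)) 2 volume := memLp_peakon.ofReal
  have hd : MemLp (fun x => (peakonDeriv x : 𝕜)) 2 volume :=
    (memLp_peakon.mono measurable_peakonDeriv.aestronglyMeasurable
      (Eventually.of_forall fun x => by
        rw [Real.norm_eq_abs, Real.norm_eq_abs, abs_of_pos (peakon_pos x)]
        exact abs_peakonDeriv_le x)).ofReal
  refine (MemH1.of_isPrimitiveOn (IsPrimitiveOn.ofReal ?_) hp hd).1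
  intro x _ y _
  have hi : IntervalIntegrable peakonDeriv volume x y := by
    have := (hd.intervalIntegrable x y)
    exact ⟨by simpa [IntegrableOn] using this.1.re, by simpa [IntegrableOn] using this.2.re⟩
  refine ⟨hi, integral_eq_of_hasDerivAt_off_countable peakon peakonDeriv
    (countable_singleton 0) continuous_peakon.continuousOn (fun t ht => ?_) hi⟩
  have ht0 : t ≠ 0 := fun h => ht.2 h
  rcases lt_or_gt_of_ne ht0 with h | h
  · rw [peakonDeriv_of_neg h]
    refine (Real.hasDerivAt_exp t).congr_of_eventuallyEq ?_
    filter_upwards [Iio_mem_nhds h] with s hs using peakon_of_nonpos (le_of_lt hs)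
  · rw [peakonDeriv_of_pos h]
    have := (Real.hasDerivAt_exp (-t)).comp t (hasDerivAt_neg t)
    simp only [mul_neg, mul_one] at this
    refine this.congr_of_eventuallyEq ?_
    filter_upwards [Ioi_mem_nhds h] with s hs using peakon_of_nonneg (le_of_lt hs)

/-! ### An integral formula for the linearized operator -/

theorem integrable_smul_of_abs_le_peakon {v : ℝ → 𝕜} (hv : MemLp v 2 volume) {k : ℝ → ℝ} {C : ℝ}
    (hk : AEStronglyMeasurable k volume) (hb : ∀ x, |k x| ≤ C * peakon x) :
    Integrable (fun x => k x • v x) := by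
  have hkL : MemLp k 2 volume := (memLp_peakon.const_mul C).mono hk
    (Eventually.of_forall fun x => by
      rw [Real.norm_eq_abs, Real.norm_eq_abs]
      exact (hb x).trans (le_abs_self _))
  have h := MemLp.integrable_mul (hkL.ofReal (K := 𝕜)) hv
  refine h.congr (Eventually.of_forall fun x => ?_)
  simp [RCLike.real_smul_eq_coe_mul]

/-- The integral kernel of the nonlocal part of the linearized operator. -/
def linKernel (ξ y : ℝ) : ℝ :=
  peakon (ξ - y) * (2 * peakon y * peakonDeriv y) - 2 * (peakonDeriv (ξ - y) * peakon y ^ 2)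
    - 4 * peakon ξ * (peakon y ^ 2 * peakonDeriv y)

theorem integrable_peakon_sq_smul {v : ℝ → 𝕜} (hv : MemLp v 2 volume) :
    Integrable (fun y => (peakon y ^ 2 * peakonDeriv y) • v y) := by
  refine integrable_smul_of_abs_le_peakon hv (C := 1)
    ((continuous_peakon.measurable.pow_const 2).mul measurable_peakonDeriv).aestronglyMeasurable
    fun x => ?_
  rw [abs_mul, abs_of_pos (pow_pos (peakon_pos x) 2), one_mul]
  calc _ ≤ peakon x ^ 2 * peakon x :=
        mul_le_mul_of_nonneg_left (abs_peakonDeriv_le x) (by positivity)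
    _ ≤ 1 * peakon x := mul_le_mul_of_nonneg_right
        (pow_le_one₀ (peakon_pos x).le (peakon_le_one x)) (peakon_pos x).le
    _ = peakon x := one_mul _

theorem linOp_eq_kernel {v : ℝ → 𝕜} (hv : MemLp v 2 volume) (b ξ : ℝ) :
    Integrable (fun y => linKernel ξ y • v y) ∧
    linOp b v ξ = (1 - peakon ξ ^ 2) • deriv v ξ + ((4 - b) * peakon ξ * peakonDeriv ξ) • v ξ +
      (b - 3) • ∫ y, linKernel ξ y • v y := by
  have m1 : Measurable fun y => peakon (ξ - y) :=
    continuous_peakon.measurable.comp (measurable_const.sub measurable_id)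
  have m2 : Measurable fun y => peakonDeriv (ξ - y) :=
    measurable_peakonDeriv.comp (measurable_const.sub measurable_id)
  have i1 : Integrable (fun y => (peakon (ξ - y) * (2 * peakon y * peakonDeriv y)) • v y) := by
    refine integrable_smul_of_abs_le_peakon hv (C := 2)
      (m1.mul ((continuous_peakon.measurable.const_mul 2).mul
        measurable_peakonDeriv)).aestronglyMeasurable fun x => ?_
    rw [abs_mul, abs_mul, abs_of_pos (peakon_pos _), abs_of_pos (mul_pos two_pos (peakon_pos _))]
    have h1 := peakon_le_one (ξ - x)
    have h2 := (abs_peakonDeriv_le x).trans (peakon_le_one x)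
    have h3 : 0 ≤ 2 * peakon x := by have := peakon_pos x; positivity
    calc _ ≤ 1 * (2 * peakon x * 1) := mul_le_mul h1 (mul_le_mul_of_nonneg_left h2 h3)
          (mul_nonneg h3 (abs_nonneg _)) zero_le_one
      _ = _ := by ring
  have i2 : Integrable (fun y => (peakonDeriv (ξ - y) * peakon y ^ 2) • v y) := by
    refine integrable_smul_of_abs_le_peakon hv (C := 1)
      (m2.mul (continuous_peakon.measurable.pow_const 2)).aestronglyMeasurable fun x => ?_
    rw [abs_mul, abs_of_pos (pow_pos (peakon_pos x) 2)]
    have h1 := (abs_peakonDeriv_le (ξ - x)).trans (peakon_le_one _)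
    have h3 : peakon x ^ 2 ≤ peakon x := by nlinarith [peakon_pos x, peakon_le_one x]
    exact mul_le_mul h1 h3 (by positivity) zero_le_one
  have i3 := integrable_peakon_sq_smul hv
  have e : (fun y => linKernel ξ y • v y) = fun y =>
      (peakon (ξ - y) * (2 * peakon y * peakonDeriv y)) • v y
      - (2 : ℝ) • ((peakonDeriv (ξ - y) * peakon y ^ 2) • v y)
      - (4 * peakon ξ) • ((peakon y ^ 2 * peakonDeriv y) • v y) := by
    ext y; simp only [linKernel, sub_smul, mul_smul]
  refine ⟨by rw [e]; exact (i1.sub (i2.smul (2 : ℝ))).sub (i3.smul (4 * peakon ξ)), ?_⟩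
  have hQ : ∫ y, linKernel ξ y • v y =
      (∫ y, (peakon (ξ - y) * (2 * peakon y * peakonDeriv y)) • v y)
      - (2 : ℝ) • (∫ y, (peakonDeriv (ξ - y) * peakon y ^ 2) • v y)
      - (4 * peakon ξ) • ∫ y, (peakon y ^ 2 * peakonDeriv y) • v y := by
    have i2' : Integrable fun y => (2 : ℝ) • ((peakonDeriv (ξ - y) * peakon y ^ 2) • v y) :=
      i2.smul (2 : ℝ)
    rw [← integral_smul, ← integral_smul, ← integral_sub i1 i2', e]
    exact integral_sub (i1.sub i2') (i3.smul (4 * peakon ξ))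
  rw [hQ, linOp, opL, opQ]
  simp only [conv, convolution_eq_swap, ContinuousLinearMap.lsmul_apply, smul_smul]
  module

theorem linKernel_neg (ξ y : ℝ) : linKernel ξ (-y) = -linKernel (-ξ) y := by
  simp only [linKernel, peakon_neg, peakonDeriv_neg]
  rw [show ξ - -y = -(-ξ - y) by ring, peakon_neg, peakonDeriv_neg]
  ring

theorem linOp_comp_neg {v : ℝ → 𝕜} (hv : MemLp v 2 volume) (b ξ : ℝ) :
    linOp b (fun x => v (-x)) ξ = -linOp b v (-ξ) := by
  have hv' : MemLp (fun x => v (-x)) 2 volume :=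
    hv.comp_measurePreserving (Measure.measurePreserving_neg volume)
  rw [(linOp_eq_kernel hv' b ξ).2,
    (linOp_eq_kernel hv b (-ξ)).2, deriv_comp_neg, peakon_neg, peakonDeriv_neg,
    ← integral_neg_eq_self (fun y => linKernel ξ y • v (-y))]
  simp only [linKernel_neg, neg_neg, neg_smul, integral_neg]
  module

theorem linOp_zero {v : ℝ → 𝕜} (hv : MemLp v 2 volume) (b : ℝ) : linOp b v 0 = 0 := by
  have h : ∀ y, linKernel 0 y = 0 := fun y => by
    rw [linKernel, zero_sub, peakon_neg, peakonDeriv_neg, peakon_zero]; ring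
  rw [(linOp_eq_kernel hv b 0).2]
  simp [h, peakon_zero, peakonDeriv_zero]

/-- `∫_x^∞ e^{-3y} v(y) dy`. -/
def tail (v : ℝ → 𝕜) (x : ℝ) : 𝕜 := ∫ y in Ioi x, (Real.exp (-3 * y) : 𝕜) * v y

theorem integrableOn_exp_mul {v : ℝ → 𝕜} (hv : MemLp v 2 volume) {c : ℝ} (hc : 0 < c) (x : ℝ) :
    IntegrableOn (fun y => (Real.exp (-c * y) : 𝕜) * v y) (Ioi x) := by
  have h : MemLp (fun y => (Real.exp (-c * y) : 𝕜)) 2 (volume.restrict (Ioi x)) := by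
    refine MemLp.ofReal ?_
    rw [memLp_two_iff_integrable_sq (by fun_prop)]
    refine (integrableOn_exp_mul_Ioi (a := -(2 * c)) (by linarith) x).congr_fun (fun y _ => ?_)
      measurableSet_Ioi
    simp only [← Real.exp_nat_mul]
    congr 1; push_cast; ring
  exact MemLp.integrable_mul h (hv.restrict _)

/-- The linearized operator on the right half-line. -/
theorem linOp_of_pos {v : ℝ → 𝕜} (hv : MemLp v 2 volume) (b : ℝ) {ξ : ℝ} (hξ : 0 < ξ) :
    linOp b v ξ = ((1 - Real.exp (-2 * ξ) : ℝ) : 𝕜) * deriv v ξ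
      + (((b - 4) * Real.exp (-2 * ξ) : ℝ) : 𝕜) * v ξ
      + ((4 * (b - 3) : ℝ) : 𝕜) * ((Real.exp (-ξ) : 𝕜) * tail v 0 - (Real.exp ξ : 𝕜) * tail v ξ) := by
  have hker : ∫ y, linKernel ξ y • v y =
      4 * ((Real.exp (-ξ) : 𝕜) * tail v 0 - (Real.exp ξ : 𝕜) * tail v ξ) := by
    have i0 := integrableOn_exp_mul hv (c := 3) (by norm_num) 0
    have i1 := integrableOn_exp_mul hv (c := 3) (by norm_num) ξ
    have e : (fun y => linKernel ξ y • v y) =ᵐ[volume] fun y =>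
        (4 * (Real.exp (-ξ) : 𝕜)) * indicator (Ioi 0) (fun y => (Real.exp (-3 * y) : 𝕜) * v y) y -
        (4 * (Real.exp ξ : 𝕜)) * indicator (Ioi ξ) (fun y => (Real.exp (-3 * y) : 𝕜) * v y) y := by
      have hne : ∀ c : ℝ, ∀ᵐ y : ℝ, y ≠ c := fun c => by simp [ae_iff]
      filter_upwards [hne 0, hne ξ] with y h0 h1
      rw [RCLike.real_smul_eq_coe_mul]
      rcases lt_or_gt_of_ne h0 with hy | hy
      · have : linKernel ξ y = 0 := by
          have h2 : 0 < ξ - y := by linarith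
          rw [linKernel, peakon_of_nonneg h2.le, peakonDeriv_of_pos h2, peakon_of_nonpos hy.le,
            peakonDeriv_of_neg hy, peakon_of_nonneg hξ.le,
            show -(ξ - y) = -ξ + y by ring, Real.exp_add]
          ring
        rw [this, indicator_of_notMem (by simpa using hy.le),
          indicator_of_notMem (by simpa using (hy.trans hξ).le)]
        simp
      · have hexp : Real.exp (-3 * y) = Real.exp (-y) ^ 3 := by
          rw [← Real.exp_nat_mul]; congr 1; push_cast; ring
        have hi : Real.exp (-y) * Real.exp y = 1 := by rw [← Real.exp_add]; simp
        have hi2 : Real.exp (-ξ) * Real.exp ξ = 1 := by rw [← Real.exp_add]; simp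
        rcases lt_or_gt_of_ne h1 with hy1 | hy1
        · have h2 : 0 < ξ - y := by linarith
          have : linKernel ξ y = 4 * Real.exp (-ξ) * Real.exp (-3 * y) := by
            rw [linKernel, peakon_of_nonneg h2.le, peakonDeriv_of_pos h2, peakon_of_nonneg hy.le,
              peakonDeriv_of_pos hy, peakon_of_nonneg hξ.le,
              show -(ξ - y) = -ξ + y by ring, Real.exp_add, hexp]
            ring
          rw [this, indicator_of_mem (by simpa using hy), indicator_of_notMem (by simpa using hy1.le)]
          push_cast
          ring
        · have h2 : ξ - y < 0 := by linarith
          have : linKernel ξ y = 4 * Real.exp (-ξ) * Real.exp (-3 * y)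
              - 4 * Real.exp ξ * Real.exp (-3 * y) := by
            rw [linKernel, peakon_of_nonpos h2.le, peakonDeriv_of_neg h2, peakon_of_nonneg hy.le,
              peakonDeriv_of_pos hy, peakon_of_nonneg hξ.le,
              show ξ - y = ξ + -y by ring, Real.exp_add, hexp]
            ring
          rw [this, indicator_of_mem (by simpa using hy), indicator_of_mem (by simpa using hy1)]
          push_cast
          ring
    rw [integral_congr_ae e, integral_sub, integral_const_mul, integral_const_mul,
      integral_indicator measurableSet_Ioi, integral_indicator measurableSet_Ioi, tail, tail]
    · ring
    · exact (i0.integrable_indicator measurableSet_Ioi).const_mul _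
    · exact (i1.integrable_indicator measurableSet_Ioi).const_mul _
  rw [(linOp_eq_kernel hv b ξ).2, hker, peakon_of_nonneg hξ.le, peakonDeriv_of_pos hξ]
  have hexp : Real.exp (-2 * ξ) = Real.exp (-ξ) ^ 2 := by
    rw [← Real.exp_nat_mul]; congr 1; push_cast; ring
  rw [hexp]
  simp only [RCLike.real_smul_eq_coe_mul]
  push_cast
  ring

theorem hasDerivAt_tail {v : ℝ → 𝕜} (hv : MemH1 v) (x : ℝ) :
    HasDerivAt (tail v) (-((Real.exp (-3 * x) : 𝕜) * v x)) x := by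
  have hc : Continuous fun y => (Real.exp (-3 * y) : 𝕜) * v y :=
    (RCLike.continuous_ofReal.comp (by fun_prop)).mul hv.continuous
  have h1 : tail v = fun z => tail v x - ∫ y in x..z, (Real.exp (-3 * y) : 𝕜) * v y := by
    ext z
    rw [tail, tail, ← intervalIntegral.integral_Ioi_sub_Ioi' (integrableOn_exp_mul hv.memLp three_pos x)
      (integrableOn_exp_mul hv.memLp three_pos z)]
    ring
  rw [h1]
  exact (intervalIntegral.integral_hasDerivAt_right (hc.intervalIntegrable _ _)
    (hc.stronglyMeasurableAtFilter _ _) hc.continuousAt).const_sub _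

theorem norm_tail_le {v : ℝ → 𝕜} (hv : MemLp v 2 volume) {x : ℝ} (hx : 0 ≤ x) :
    ‖tail v x‖ ≤ Real.exp (-2 * x) * ∫ y in Ioi 0, ‖(Real.exp (-1 * y) : 𝕜) * v y‖ := by
  have i1 : IntegrableOn (fun y => ‖(Real.exp (-1 * y) : 𝕜) * v y‖) (Ioi 0) :=
    (integrableOn_exp_mul hv one_pos 0).norm
  rw [← integral_const_mul]
  refine (norm_integral_le_integral_norm _).trans ?_
  refine (setIntegral_mono_on (integrableOn_exp_mul hv three_pos x).norm
    ((i1.mono_set (Ioi_subset_Ioi hx)).const_mul _) measurableSet_Ioi fun y hy => ?_).trans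
    (setIntegral_mono_set (i1.const_mul _) (Eventually.of_forall fun y => ?_)
      (Ioi_subset_Ioi hx).eventuallyLE)
  · have hy : x < y := hy
    simp only [norm_mul, RCLike.norm_ofReal, abs_of_pos (Real.exp_pos _)]
    rw [← mul_assoc, ← Real.exp_add]
    refine mul_le_mul_of_nonneg_right (Real.exp_le_exp.2 (by linarith)) (norm_nonneg _)
  · simp only [Pi.zero_apply]; positivity

/-! ### The domain of the linearized operator -/

/-- The transport term `(1 - φ²) v'`. -/
def flux (v : ℝ → 𝕜) (ξ : ℝ) : 𝕜 := (1 - peakon ξ ^ 2) • deriv v ξ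

theorem one_sub_peakon_sq_pos {x : ℝ} (hx : x ≠ 0) : 0 < 1 - peakon x ^ 2 := by
  have h : peakon x < 1 := by
    rw [peakon, Real.exp_lt_one_iff]
    simpa using hx
  nlinarith [peakon_pos x]

theorem MemDom.memH1 {v : ℝ → 𝕜} (hv : MemDom v) : MemH1 v := hv.1.1

theorem MemDom.memH1_flux {v : ℝ → 𝕜} (hv : MemDom v) : MemH1 (flux v) := hv.2.1

theorem MemDom.continuousAt_deriv {v : ℝ → 𝕜} (hv : MemDom v) {x : ℝ} (hx : x ≠ 0) :
    ContinuousAt (deriv v) x := by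
  have h1 : ContinuousAt (fun y => (1 - peakon y ^ 2)⁻¹ • flux v y) x :=
    (((continuous_const.sub (continuous_peakon.pow 2)).continuousAt).inv₀
      (one_sub_peakon_sq_pos hx).ne').smul hv.memH1_flux.continuous.continuousAt
  refine h1.congr ?_
  filter_upwards [isOpen_ne.mem_nhds hx] with y hy
  rw [flux, smul_smul, inv_mul_cancel₀ (one_sub_peakon_sq_pos hy).ne', one_smul]

theorem MemDom.hasDerivAt {v : ℝ → 𝕜} (hv : MemDom v) {x : ℝ} (hx : x ≠ 0) :
    HasDerivAt v (deriv v x) x := by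
  have h := intervalIntegral.integral_hasDerivAt_right
    (hv.memH1.memLp_deriv.intervalIntegrable x x)
    (measurable_deriv v).stronglyMeasurable.stronglyMeasurableAtFilter (hv.continuousAt_deriv hx)
  refine (h.const_add (v x)).congr_of_eventuallyEq (Eventually.of_forall fun y => ?_)
  show v y = v x + _
  rw [← hv.memH1.sub_eq_integral]; ring

theorem MemDom.flux_add {u v : ℝ → 𝕜} (hu : MemDom u) (hv : MemDom v) :
    flux (fun x => u x + v x) = fun x => flux u x + flux v x := by
  ext x
  by_cases hx : x = 0
  · simp [flux, hx, peakon_zero]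
  · rw [flux, ((hu.hasDerivAt hx).fun_add (hv.hasDerivAt hx)).deriv, smul_add]; rfl

theorem flux_const_mul (c : 𝕜) (v : ℝ → 𝕜) : flux (fun x => c * v x) = fun x => c * flux v x := by
  ext x
  rw [flux, deriv_const_mul_apply, flux, mul_smul_comm]

theorem flux_comp_neg (v : ℝ → 𝕜) : flux (fun x => v (-x)) = fun x => -flux v (-x) := by
  ext x
  rw [flux, deriv_comp_neg, flux, peakon_neg, smul_neg]

theorem MemDom.add {u v : ℝ → 𝕜} (hu : MemDom u) (hv : MemDom v) :
    MemDom (fun x => u x + v x) := by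
  refine ⟨hu.1.add hv.1, ?_⟩
  have h := MemH1Zero.add hu.2 hv.2
  have e := hu.flux_add hv
  simp only [flux] at e
  rwa [← e] at h

theorem MemDom.const_mul {v : ℝ → 𝕜} (c : 𝕜) (hv : MemDom v) : MemDom (fun x => c * v x) := by
  refine ⟨hv.1.const_mul c, ?_⟩
  have h := hv.2.const_mul c
  have e := flux_const_mul c v
  simp only [flux] at e
  rwa [← e] at h

theorem MemDom.comp_neg {v : ℝ → 𝕜} (hv : MemDom v) : MemDom (fun x => v (-x)) := by
  refine ⟨hv.1.comp_neg, ?_⟩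
  have h := (hv.2.comp_neg).const_mul (-1)
  have e := flux_comp_neg v
  simp only [flux] at e
  simp only [neg_one_mul] at h
  rwa [← e] at h

/-! ### The linearized operator maps its domain into `H¹` -/

theorem linOp_eq_flux {v : ℝ → 𝕜} (hv : MemLp v 2 volume) (b : ℝ) {ξ : ℝ} (hξ : 0 < ξ) :
    linOp b v ξ = flux v ξ + (((b - 4) * Real.exp (-2 * ξ) : ℝ) : 𝕜) * v ξ
      + ((4 * (b - 3) : ℝ) : 𝕜) * ((Real.exp (-ξ) : 𝕜) * tail v 0 - (Real.exp ξ : 𝕜) * tail v ξ) := by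
  rw [linOp_of_pos hv b hξ, flux, peakon_of_nonneg hξ.le, ← Real.exp_nat_mul,
    RCLike.real_smul_eq_coe_mul]
  congr 4; push_cast; ring_nf

theorem hasDerivAt_ofReal {r : ℝ → ℝ} {r' x : ℝ} (h : HasDerivAt r r' x) :
    HasDerivAt (fun x => (r x : 𝕜)) (r' : 𝕜) x :=
  (RCLike.ofRealCLM (K := 𝕜)).hasFDerivAt.comp_hasDerivAt x h

theorem hasDerivAt_exp_const_mul (c x : ℝ) :
    HasDerivAt (fun x => Real.exp (c * x)) (c * Real.exp (c * x)) x := by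
  simpa [mul_comm] using ((hasDerivAt_id x).const_mul c).exp

theorem halfH1_exp_mul {f f' : ℝ → 𝕜} (hf : HalfH1 f f') :
    HalfH1 (fun x => (Real.exp (-2 * x) : 𝕜) * f x)
      (fun x => ((-2 * Real.exp (-2 * x) : ℝ) : 𝕜) * f x + (Real.exp (-2 * x) : 𝕜) * f' x) := by
  have h1 : ∀ x ∈ Ioi (0 : ℝ), Real.exp (-2 * x) ≤ 1 := fun x hx => by
    rw [Real.exp_le_one_iff]; have : (0 : ℝ) < x := hx; linarith
  refine hf.mul_real (C := 2) (fun x _ => hasDerivAt_exp_const_mul (-2) x) (by fun_prop)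
    (fun x hx => ?_) (fun x hx => ?_)
  · rw [abs_of_pos (Real.exp_pos _)]; linarith [h1 x hx]
  · rw [abs_mul, abs_of_pos (Real.exp_pos _), abs_neg, abs_two]; linarith [h1 x hx]

/-- The nonlocal term on the right half-line. -/
theorem halfH1_tail {v : ℝ → 𝕜} (hv : MemH1 v) :
    HalfH1 (fun x => (Real.exp (-x) : 𝕜) * tail v 0 - (Real.exp x : 𝕜) * tail v x)
      (fun x => -((Real.exp (-x) : 𝕜) * tail v 0) - (Real.exp x : 𝕜) * tail v x
        + (Real.exp (-2 * x) : 𝕜) * v x) := by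
  have htc : Continuous (tail v) :=
    continuous_iff_continuousAt.2 fun x => (hasDerivAt_tail hv x).continuousAt
  have hexp : ∀ x, HasDerivAt (fun x => (Real.exp x : 𝕜)) (Real.exp x : 𝕜) x := fun x =>
    hasDerivAt_ofReal (Real.hasDerivAt_exp x)
  have hexpn : ∀ x, HasDerivAt (fun x => (Real.exp (-x) : 𝕜)) (-(Real.exp (-x) : 𝕜)) x := fun x => by
    have := hasDerivAt_ofReal (𝕜 := 𝕜) ((hasDerivAt_neg x).exp)
    simpa using this
  have c1 : Continuous fun x => (Real.exp x : 𝕜) := RCLike.continuous_ofReal.comp (by fun_prop)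
  have c2 : Continuous fun x => (Real.exp (-x) : 𝕜) := RCLike.continuous_ofReal.comp (by fun_prop)
  have c3 : Continuous fun x => (Real.exp (-2 * x) : 𝕜) := RCLike.continuous_ofReal.comp (by fun_prop)
  have hL1 : MemLp (fun x => (Real.exp (-x) : 𝕜) * tail v 0) 2 (volume.restrict (Ioi 0)) := by
    have := (memLp_exp_neg one_pos).ofReal (K := 𝕜)
    simpa using this.mul_const (tail v 0)
  have hL2 : MemLp (fun x => (Real.exp x : 𝕜) * tail v x) 2 (volume.restrict (Ioi 0)) := by
    refine ((memLp_exp_neg one_pos).const_mul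
      (∫ y in Ioi 0, ‖(Real.exp (-1 * y) : 𝕜) * v y‖)).mono' (c1.mul htc).aestronglyMeasurable ?_
    filter_upwards [ae_restrict_mem measurableSet_Ioi] with x hx
    have hx : (0 : ℝ) < x := hx
    rw [norm_mul, RCLike.norm_ofReal, abs_of_pos (Real.exp_pos _)]
    calc _ ≤ Real.exp x * (Real.exp (-2 * x) * _) :=
          mul_le_mul_of_nonneg_left (norm_tail_le hv.memLp hx.le) (Real.exp_pos _).le
      _ = _ := by
        rw [← mul_assoc, ← Real.exp_add, mul_comm]
        congr 2; ring
  have hL3 : MemLp (fun x => (Real.exp (-2 * x) : 𝕜) * v x) 2 (volume.restrict (Ioi 0)) := by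
    refine (hv.memLp.restrict _).mono (c3.mul hv.continuous).aestronglyMeasurable ?_
    filter_upwards [ae_restrict_mem measurableSet_Ioi] with x hx
    have hx : (0 : ℝ) < x := hx
    rw [norm_mul, RCLike.norm_ofReal, abs_of_pos (Real.exp_pos _)]
    exact mul_le_of_le_one_left (norm_nonneg _) (by rw [Real.exp_le_one_iff]; linarith)
  refine ⟨IsPrimitiveOn.of_hasDerivAt (fun x _ => ?_) ?_, hL1.sub hL2, (hL1.neg.sub hL2).add hL3, ?_⟩
  · have h := ((hexpn x).mul_const (tail v 0)).fun_sub ((hexp x).fun_mul (hasDerivAt_tail hv x))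
    convert h using 1
    have : Real.exp (-2 * x) = Real.exp x * Real.exp (-3 * x) := by
      rw [← Real.exp_add]; congr 1; ring
    rw [this]; push_cast; ring
  · exact ((((c2.mul continuous_const).neg.sub (c1.mul htc)).add
      (c3.mul hv.continuous))).continuousOn
  · have : Tendsto (fun x => (Real.exp (-x) : 𝕜) * tail v 0 - (Real.exp x : 𝕜) * tail v x) (𝓝 0)
        (𝓝 0) := by
      have h := ((c2.mul continuous_const).sub (c1.mul htc)).tendsto (0 : ℝ) (f := fun x =>
        (Real.exp (-x) : 𝕜) * tail v 0 - (Real.exp x : 𝕜) * tail v x)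
      simpa using h
    exact this.mono_left nhdsWithin_le_nhds

theorem halfH1_linOp {v : ℝ → 𝕜} (hv : MemDom v) (b : ℝ) :
    HalfH1 (linOp b v) (fun x => deriv (flux v) x + (((b - 4 : ℝ) : 𝕜) *
      (((-2 * Real.exp (-2 * x) : ℝ) : 𝕜) * v x + (Real.exp (-2 * x) : 𝕜) * deriv v x)) +
      ((4 * (b - 3) : ℝ) : 𝕜) * (-((Real.exp (-x) : 𝕜) * tail v 0) - (Real.exp x : 𝕜) * tail v x
        + (Real.exp (-2 * x) : 𝕜) * v x)) := by
  have hF : MemH1Zero (flux v) := hv.2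
  have h := (hF.halfH1.add ((halfH1_exp_mul hv.1.halfH1).const_mul ((b - 4 : ℝ) : 𝕜))).add
    ((halfH1_tail hv.memH1).const_mul ((4 * (b - 3) : ℝ) : 𝕜))
  refine h.congr (fun x hx => ?_) (Eventually.of_forall fun x _ => rfl)
  rw [linOp_eq_flux hv.memH1.memLp b hx]
  push_cast; ring

theorem MemDom.memH1Zero_linOp {v : ℝ → 𝕜} (hv : MemDom v) (b : ℝ) : MemH1Zero (linOp b v) := by
  have h2 := (halfH1_linOp hv.comp_neg b).const_mul (-1 : 𝕜)
  refine (halfH1_linOp hv b).glue (h2.congr (fun x _ => ?_) (Eventually.of_forall fun x _ => rfl))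
    (linOp_zero hv.memH1.memLp b)
  simp only [linOp_comp_neg hv.memH1.memLp]
  ring

theorem linOp_add {u v : ℝ → 𝕜} (hu : MemDom u) (hv : MemDom v) (b : ℝ) :
    linOp b (fun x => u x + v x) = fun x => linOp b u x + linOp b v x := by
  ext ξ
  have h1 := linOp_eq_kernel hu.memH1.memLp b ξ
  have h2 := linOp_eq_kernel hv.memH1.memLp b ξ
  have h := congrFun (hu.flux_add hv) ξ
  simp only [flux] at h
  rw [(linOp_eq_kernel (hu.add hv).memH1.memLp b ξ).2, h1.2, h2.2, h]
  simp only [smul_add]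
  rw [integral_add h1.1 h2.1]
  module

theorem linOp_const_mul {v : ℝ → 𝕜} (c : 𝕜) (hv : MemLp v 2 volume) (b : ℝ) :
    linOp b (fun x => c * v x) = fun x => c * linOp b v x := by
  ext ξ
  rw [(linOp_eq_kernel (hv.const_mul c) b ξ).2, (linOp_eq_kernel hv b ξ).2, deriv_const_mul_apply]
  simp only [← mul_smul_comm, integral_const_mul, mul_add]

/-- The functional whose product with the peakon is subtracted in the linearized equation. -/
def peakPairing (b : ℝ) (v : ℝ → 𝕜) : 𝕜 :=
  (4 * (b - 3)) • ∫ y, (peakon y ^ 2 * peakonDeriv y) • v y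

theorem opL_eq (b : ℝ) (v : ℝ → 𝕜) :
    opL b v = fun ξ => linOp b v ξ + peakPairing b v * (peakon ξ : 𝕜) := by
  ext ξ
  rw [linOp, peakPairing, RCLike.real_smul_eq_coe_mul (peakon ξ)]
  ring

theorem peakPairing_add (b : ℝ) {u v : ℝ → 𝕜} (hu : MemH1 u) (hv : MemH1 v) :
    peakPairing b (fun x => u x + v x) = peakPairing b u + peakPairing b v := by
  simp only [peakPairing, smul_add]
  rw [integral_add (integrable_peakon_sq_smul hu.memLp) (integrable_peakon_sq_smul hv.memLp),
    smul_add]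

theorem peakPairing_const_mul (b : ℝ) (c : 𝕜) (v : ℝ → 𝕜) :
    peakPairing b (fun x => c * v x) = c * peakPairing b v := by
  simp only [peakPairing, ← mul_smul_comm, integral_const_mul]

theorem peakPairing_comp_neg (b : ℝ) (v : ℝ → 𝕜) :
    peakPairing b (fun x => v (-x)) = -peakPairing b v := by
  rw [peakPairing, peakPairing,
    ← integral_neg_eq_self (fun y => (peakon y ^ 2 * peakonDeriv y) • v (-y))]
  simp only [peakon_neg, peakonDeriv_neg, neg_neg, mul_neg, neg_smul, integral_neg, smul_neg]

theorem exists_norm_peakPairing_le (b : ℝ) :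
    ∃ C : ℝ, ∀ v : ℝ → 𝕜, MemH1 v → ‖peakPairing b v‖ ≤ C * h1Norm v := by
  have hk : MemLp (fun y => ((peakon y ^ 2 * peakonDeriv y : ℝ) : 𝕜)) 2 volume := by
    refine MemLp.ofReal (memLp_peakon.mono
      ((continuous_peakon.measurable.pow_const 2).mul measurable_peakonDeriv).aestronglyMeasurable
      (Eventually.of_forall fun x => ?_))
    rw [Real.norm_eq_abs, Real.norm_eq_abs, abs_of_pos (peakon_pos x), abs_mul,
      abs_of_pos (pow_pos (peakon_pos x) 2)]
    have h3 := pow_le_one₀ (n := 2) (peakon_pos x).le (peakon_le_one x)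
    exact (mul_le_mul h3 (abs_peakonDeriv_le x) (abs_nonneg _) zero_le_one).trans (one_mul _).le
  refine ⟨|4 * (b - 3)| * ‖hk.toLp _‖, fun v hv => ?_⟩
  have e : ∫ y, (peakon y ^ 2 * peakonDeriv y) • v y =
      inner 𝕜 (hk.toLp _) (hv.memLp.toLp v) := by
    rw [L2.inner_def]
    refine integral_congr_ae ?_
    filter_upwards [hk.coeFn_toLp, hv.memLp.coeFn_toLp] with x h1 h2
    rw [h1, h2, RCLike.inner_apply, RCLike.conj_ofReal, RCLike.real_smul_eq_coe_mul, mul_comm]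
  have h1 : ‖hv.memLp.toLp v‖ ≤ h1Norm v := by
    rw [← hv.norm_toHilbert]
    exact WithLp.norm_fst_le _ hv.toHilbert
  rw [peakPairing, norm_smul, Real.norm_eq_abs, e, mul_assoc]
  exact mul_le_mul_of_nonneg_left ((norm_inner_le_norm _ _).trans
    (mul_le_mul_of_nonneg_left h1 (norm_nonneg _))) (abs_nonneg _)

theorem opL_add {u v : ℝ → 𝕜} (hu : MemDom u) (hv : MemDom v) (b : ℝ) :
    opL b (fun x => u x + v x) = fun x => opL b u x + opL b v x := by
  simp only [opL_eq, linOp_add hu hv, peakPairing_add b hu.memH1 hv.memH1]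
  ext ξ; ring

theorem opL_const_mul {v : ℝ → 𝕜} (c : 𝕜) (hv : MemLp v 2 volume) (b : ℝ) :
    opL b (fun x => c * v x) = fun x => c * opL b v x := by
  simp only [opL_eq, linOp_const_mul c hv, peakPairing_const_mul]
  ext ξ; ring

theorem opL_comp_neg {v : ℝ → 𝕜} (hv : MemLp v 2 volume) (b : ℝ) :
    opL b (fun x => v (-x)) = fun x => -opL b v (-x) := by
  simp only [opL_eq, peakPairing_comp_neg]
  ext ξ
  rw [linOp_comp_neg hv, peakon_neg]; ring

theorem MemDom.memH1_opL {v : ℝ → 𝕜} (hv : MemDom v) (b : ℝ) : MemH1 (opL b v) := by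
  rw [opL_eq]
  exact (hv.memH1Zero_linOp b).1.add (memH1_peakon.const_mul _)

/-! ### Solutions -/

namespace IsSolution

variable {b : ℝ} {u v : ℝ → ℝ → 𝕜}

theorem add (hu : IsSolution b u) (hv : IsSolution b v) :
    IsSolution b (fun t ξ => u t ξ + v t ξ) where
  mem_dom t := (hu.mem_dom t).add (hv.mem_dom t)
  continuous_h1 t := by
    refine squeeze_zero (fun _ => h1Norm_nonneg _) (fun s => ?_)
      (by simpa using (hu.continuous_h1 t).add (hv.continuous_h1 t))
    refine le_of_eq_of_le ?_ (((hu.mem_dom s).memH1.sub (hu.mem_dom t).memH1).h1Norm_add_le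
      ((hv.mem_dom s).memH1.sub (hv.mem_dom t).memH1))
    congr 1; ext ξ; ring
  continuous_graph t := by
    refine squeeze_zero (fun _ => h1Norm_nonneg _) (fun s => ?_)
      (by simpa using (hu.continuous_graph t).add (hv.continuous_graph t))
    refine le_of_eq_of_le ?_ ((((hu.mem_dom s).memH1_opL b).sub
      ((hu.mem_dom t).memH1_opL b)).h1Norm_add_le
      (((hv.mem_dom s).memH1_opL b).sub ((hv.mem_dom t).memH1_opL b)))
    rw [opL_add (hu.mem_dom s) (hv.mem_dom s), opL_add (hu.mem_dom t) (hv.mem_dom t)]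
    congr 1; ext ξ; ring
  hasDeriv t := by
    have key : ∀ {u : ℝ → ℝ → 𝕜}, IsSolution b u → ∀ h : ℝ, MemH1 fun ξ =>
        h⁻¹ • (u (t + h) ξ - u t ξ) - linOp b (u t) ξ := fun hu h => by
      simp only [RCLike.real_smul_eq_coe_mul]
      exact (((hu.mem_dom (t + h)).memH1.sub (hu.mem_dom t).memH1).const_mul _).sub
        ((hu.mem_dom t).memH1Zero_linOp b).1
    refine squeeze_zero (fun _ => h1Norm_nonneg _) (fun h => ?_)
      (by simpa using (hu.hasDeriv t).add (hv.hasDeriv t))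
    refine le_of_eq_of_le ?_ ((key hu h).h1Norm_add_le (key hv h))
    rw [linOp_add (hu.mem_dom t) (hv.mem_dom t)]
    congr 1; ext ξ; module

theorem const_mul (c : 𝕜) (hu : IsSolution b u) : IsSolution b (fun t ξ => c * u t ξ) where
  mem_dom t := (hu.mem_dom t).const_mul c
  continuous_h1 t := by
    simp only [← mul_sub, h1Norm_const_mul]
    simpa using (hu.continuous_h1 t).const_mul ‖c‖
  continuous_graph t := by
    simp only [opL_const_mul c (hu.mem_dom _).memH1.memLp, ← mul_sub, h1Norm_const_mul]
    simpa using (hu.continuous_graph t).const_mul ‖c‖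
  hasDeriv t := by
    simp only [linOp_const_mul c (hu.mem_dom _).memH1.memLp, ← mul_sub, ← mul_smul_comm,
      h1Norm_const_mul]
    simpa using (hu.hasDeriv t).const_mul ‖c‖

theorem sub (hu : IsSolution b u) (hv : IsSolution b v) :
    IsSolution b (fun t ξ => u t ξ - v t ξ) := by
  simpa [sub_eq_add_neg] using hu.add (hv.const_mul (-1))

theorem reflect (hu : IsSolution b u) : IsSolution b (fun t ξ => u (-t) (-ξ)) where
  mem_dom t := (hu.mem_dom (-t)).comp_neg
  continuous_h1 t := by
    have h := (hu.continuous_h1 (-t)).comp (continuous_neg.tendsto t)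
    refine h.congr fun s => ?_
    exact (h1Norm_comp_neg fun ξ => u (-s) ξ - u (-t) ξ).symm
  continuous_graph t := by
    have h := (hu.continuous_graph (-t)).comp (continuous_neg.tendsto t)
    refine h.congr fun s => ?_
    simp only [Function.comp, opL_comp_neg (hu.mem_dom _).memH1.memLp]
    rw [← h1Norm_comp_neg]
    have := h1Norm_const_mul (-1 : 𝕜) fun ξ => opL b (u (-s)) (-ξ) - opL b (u (-t)) (-ξ)
    simp only [norm_neg, norm_one, one_mul] at this
    rw [← this]
    congr 1; ext ξ; ring
  hasDeriv t := by
    have hn : Tendsto (fun h : ℝ => -h) (𝓝[≠] 0) (𝓝[≠] 0) := by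
      refine tendsto_nhdsWithin_iff.2 ⟨?_, ?_⟩
      · exact (by simpa using continuous_neg.tendsto (0 : ℝ) :
          Tendsto (fun h : ℝ => -h) (𝓝 0) (𝓝 0)).mono_left nhdsWithin_le_nhds
      · filter_upwards [self_mem_nhdsWithin] with h hh
        simpa using hh
    refine ((hu.hasDeriv (-t)).comp hn).congr fun h => ?_
    simp only [Function.comp]
    rw [← h1Norm_comp_neg, ← one_mul (h1Norm _), ← norm_one (α := 𝕜), ← norm_neg,
      ← h1Norm_const_mul]
    congr 1; ext ξ
    rw [linOp_comp_neg (hu.mem_dom _).memH1.memLp, neg_add]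
    simp only [inv_neg, neg_smul]
    ring

theorem of_linOp (hd : ∀ t, MemDom (u t))
    (h1 : ∀ t, Tendsto (fun s => h1Norm (fun ξ => u s ξ - u t ξ)) (𝓝 t) (𝓝 0))
    (h2 : ∀ t, Tendsto (fun s => h1Norm (fun ξ => linOp b (u s) ξ - linOp b (u t) ξ)) (𝓝 t) (𝓝 0))
    (h3 : ∀ t, Tendsto
      (fun h : ℝ => h1Norm (fun ξ => h⁻¹ • (u (t + h) ξ - u t ξ) - linOp b (u t) ξ)) (𝓝[≠] 0) (𝓝 0)) :
    IsSolution b u where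
  mem_dom := hd
  continuous_h1 := h1
  continuous_graph t := by
    obtain ⟨C, hC⟩ := exists_norm_peakPairing_le (𝕜 := 𝕜) b
    refine squeeze_zero (fun _ => h1Norm_nonneg _) (fun s => ?_)
      (by simpa using (h2 t).add (((h1 t).const_mul C).mul_const (h1Norm fun x => (peakon x : 𝕜))))
    have hp : peakPairing b (u s) - peakPairing b (u t) =
        peakPairing b (fun ξ => u s ξ - u t ξ) := by
      have := peakPairing_add b (hd s).memH1 ((hd t).memH1.const_mul (-1))
      rw [peakPairing_const_mul] at this
      simp only [neg_one_mul, ← sub_eq_add_neg] at this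
      exact this.symm
    have e : (fun ξ => opL b (u s) ξ - opL b (u t) ξ) = fun ξ =>
        (linOp b (u s) ξ - linOp b (u t) ξ) +
          peakPairing b (fun ξ => u s ξ - u t ξ) * (peakon ξ : 𝕜) := by
      ext ξ; rw [opL_eq, opL_eq, ← hp]; ring
    rw [e]
    refine ((((hd s).memH1Zero_linOp b).1.sub ((hd t).memH1Zero_linOp b).1).h1Norm_add_le
      (memH1_peakon.const_mul _)).trans ?_
    rw [h1Norm_const_mul]
    exact add_le_add_right (mul_le_mul_of_nonneg_right (hC _ ((hd s).memH1.sub (hd t).memH1))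
      (h1Norm_nonneg _)) _
  hasDeriv := h3

theorem hasDerivAt_toHilbert (hu : IsSolution b u) (t : ℝ) :
    HasDerivAt (fun t => (hu.mem_dom t).memH1.toHilbert)
      ((hu.mem_dom t).memH1Zero_linOp b).1.toHilbert t := by
  rw [hasDerivAt_iff_tendsto_slope_zero, tendsto_iff_norm_sub_tendsto_zero]
  refine (hu.hasDeriv t).congr fun h => ?_
  have hm := ((hu.mem_dom (t + h)).memH1.sub (hu.mem_dom t).memH1)
  have hs : MemH1 (fun ξ => h⁻¹ • (u (t + h) ξ - u t ξ)) := by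
    simp only [RCLike.real_smul_eq_coe_mul]; exact hm.const_mul _
  have e : hs.toHilbert = h⁻¹ • hm.toHilbert := by
    simp only [MemH1.toHilbert, ← WithLp.toLp_smul, Prod.smul_mk, ← MemLp.toLp_const_smul]
    congr 2
    refine MemLp.toLp_congr _ _ (Eventually.of_forall fun x => ?_)
    simp only [RCLike.real_smul_eq_coe_mul, deriv_const_mul_apply, Pi.smul_apply]
  rw [← MemH1.toHilbert_sub, ← e, ← MemH1.toHilbert_sub, MemH1.norm_toHilbert]

theorem hasDerivAt_h1Inner (hu : IsSolution b u) {w : ℝ → 𝕜} (hw : MemH1 w) (t : ℝ) :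
    HasDerivAt (fun t => h1Inner w (u t)) (h1Inner w (linOp b (u t))) t := by
  have h := HasDerivAt.inner 𝕜 (hasDerivAt_const t hw.toHilbert) (hu.hasDerivAt_toHilbert t)
  simpa only [MemH1.inner_toHilbert, inner_zero_left, add_zero] using h

theorem hasDerivAt_h1Norm_sq (hu : IsSolution b u) (t : ℝ) :
    HasDerivAt (fun t => h1Norm (u t) ^ 2) (2 * RCLike.re (h1Inner (u t) (linOp b (u t)))) t := by
  have h := HasDerivAt.inner 𝕜 (hu.hasDerivAt_toHilbert t) (hu.hasDerivAt_toHilbert t)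
  have h2 := (RCLike.reCLM (K := 𝕜)).hasFDerivAt.comp_hasDerivAt t h
  simp only [RCLike.reCLM_apply, MemH1.inner_toHilbert, map_add] at h2
  refine (h2.congr_of_eventuallyEq (Eventually.of_forall fun s => ?_)).congr_deriv ?_
  · simp only [Function.comp, MemH1.h1Inner_self, RCLike.ofReal_re]
  · rw [← MemH1.inner_toHilbert (hu.mem_dom t).memH1 ((hu.mem_dom t).memH1Zero_linOp b).1,
      ← MemH1.inner_toHilbert ((hu.mem_dom t).memH1Zero_linOp b).1 (hu.mem_dom t).memH1,
      inner_re_symm, two_mul]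

end IsSolution

/-! ### The exponential function and complex powers -/

theorem norm_exp_eq (z : 𝕜) : ‖NormedSpace.exp z‖ = Real.exp (RCLike.re z) := by
  have h1 : starRingEnd 𝕜 (NormedSpace.exp z) = NormedSpace.exp (starRingEnd 𝕜 z) :=
    NormedSpace.map_exp (starRingEnd 𝕜) RCLike.continuous_conj z
  have h2 : ((‖NormedSpace.exp z‖ ^ 2 : ℝ) : 𝕜) = ((Real.exp (RCLike.re z) ^ 2 : ℝ) : 𝕜) := by
    rw [RCLike.ofReal_pow, ← RCLike.conj_mul, h1, ← NormedSpace.exp_add, add_comm, RCLike.add_conj,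
      ← Real.exp_nat_mul]
    have h3 := NormedSpace.map_exp (algebraMap ℝ 𝕜) RCLike.continuous_ofReal (2 * RCLike.re z)
    rw [← Real.exp_eq_exp_ℝ] at h3
    have h4 : algebraMap ℝ 𝕜 (2 * RCLike.re z) = 2 * (RCLike.re z : 𝕜) := by
      rw [map_mul, map_ofNat]
    rw [h4] at h3
    rw [← h3]
    push_cast
    rfl
  have h3 : ‖NormedSpace.exp z‖ ^ 2 = Real.exp (RCLike.re z) ^ 2 := by exact_mod_cast h2
  exact (pow_left_inj₀ (norm_nonneg _) (Real.exp_pos _).le two_ne_zero).1 h3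

theorem hasDerivAt_exp_comp {f : ℝ → 𝕜} {f' : 𝕜} {x : ℝ} (hf : HasDerivAt f f' x) :
    HasDerivAt (fun x => NormedSpace.exp (f x)) (f' * NormedSpace.exp (f x)) x := by
  have h := HasDerivAt.scomp x (hasDerivAt_exp (𝕂 := 𝕜) (x := f x)) hf
  rw [smul_eq_mul] at h
  exact h

/-- `1 - e^{-2x}`. -/
def speed (x : ℝ) : ℝ := 1 - Real.exp (-2 * x)

theorem speed_pos {x : ℝ} (hx : 0 < x) : 0 < speed x := by
  rw [speed, sub_pos, Real.exp_lt_one_iff]; linarith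

theorem speed_lt_one (x : ℝ) : speed x < 1 := by
  rw [speed]; linarith [Real.exp_pos (-2 * x)]

theorem speed_zero : speed 0 = 0 := by simp [speed]

theorem speed_eq_peakon {x : ℝ} (hx : 0 ≤ x) : speed x = 1 - peakon x ^ 2 := by
  rw [speed, peakon_of_nonneg hx, ← Real.exp_nat_mul, show ((2 : ℕ) : ℝ) * -x = -2 * x by
    push_cast; ring]

theorem hasDerivAt_speed (x : ℝ) : HasDerivAt speed (2 * Real.exp (-2 * x)) x := by
  have := (hasDerivAt_exp_const_mul (-2) x).const_sub 1
  exact this.congr_deriv (by ring)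

theorem continuous_speed : Continuous speed := by unfold speed; fun_prop

theorem speed_mono : Monotone speed := fun x y h => by
  simp only [speed]; linarith [Real.exp_le_exp.2 (show -2 * y ≤ -2 * x by linarith)]

/-- The weight `(1 - e^{-2x})^p e^{-lx}`. -/
def weight (p l x : ℝ) : ℝ := speed x ^ p * Real.exp (-l * x)

theorem weight_nonneg {p l x : ℝ} (hx : 0 < x) : 0 ≤ weight p l x :=
  mul_nonneg (Real.rpow_nonneg (speed_pos hx).le _) (Real.exp_pos _).le

theorem weight_pos {p l x : ℝ} (hx : 0 < x) : 0 < weight p l x :=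
  mul_pos (Real.rpow_pos_of_pos (speed_pos hx) _) (Real.exp_pos _)

theorem weight_le_weight {p q l k x : ℝ} (hx : 0 < x) (hp : q ≤ p) (hl : k ≤ l) :
    weight p l x ≤ weight q k x :=
  mul_le_mul (Real.rpow_le_rpow_of_exponent_ge (speed_pos hx) (speed_lt_one x).le hp)
    (Real.exp_le_exp.2 (by nlinarith)) (Real.exp_pos _).le (Real.rpow_nonneg (speed_pos hx).le _)

theorem speed_mul_weight {p l x : ℝ} (hx : 0 < x) :
    speed x * weight p l x = weight (p + 1) l x := by
  rw [weight, weight, Real.rpow_add (speed_pos hx), Real.rpow_one]; ring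

theorem continuousOn_weight (p l : ℝ) : ContinuousOn (weight p l) (Ioi 0) :=
  (continuous_speed.continuousOn.rpow_const fun _ hx => Or.inl (speed_pos hx).ne').mul (by fun_prop)

theorem hasDerivAt_speed_rpow {p x : ℝ} (hx : 0 < x) :
    HasDerivAt (fun x => speed x ^ p) (2 * p * (speed x ^ (p - 1) * Real.exp (-2 * x))) x := by
  have := (hasDerivAt_speed x).rpow_const (p := p) (Or.inl (speed_pos hx).ne')
  convert this using 1; ring

theorem tendsto_speed_atTop : Tendsto speed atTop (𝓝 1) := by
  have h : Tendsto (fun x : ℝ => Real.exp (-2 * x)) atTop (𝓝 0) :=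
    Real.tendsto_exp_atBot.comp (tendsto_id.const_mul_atTop_of_neg (by norm_num))
  have h2 := h.const_sub 1
  rwa [sub_zero] at h2

/-- The weight is integrable at `0` when its exponent is greater than `-1`. -/
theorem integrableOn_weight_two {p : ℝ} (hp : -1 < p) : IntegrableOn (weight p 2) (Ioi 0) := by
  have hp' : 0 < p + 1 := by linarith
  have h := integrableOn_Ioi_deriv_of_nonneg (a := 0) (g := fun x => speed x ^ (p + 1))
    (g' := fun x => 2 * (p + 1) * (speed x ^ p * Real.exp (-2 * x))) (l := 1 ^ (p + 1))
    (continuous_speed.continuousAt.rpow_const (Or.inr hp'.le)).continuousWithinAt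
    (fun x hx => by simpa using hasDerivAt_speed_rpow (p := p + 1) hx)
    (fun x hx => by
      have := weight_nonneg (p := p) (l := 2) hx
      rw [weight] at this; positivity)
    (tendsto_speed_atTop.rpow_const (Or.inr hp'.le))
  have h2 := h.const_mul (2 * (p + 1))⁻¹
  refine h2.congr (Eventually.of_forall fun x => ?_)
  simp only [weight]
  field_simp

theorem integrableOn_weight {p l : ℝ} (hp : -1 < p) (hl : 0 < l) :
    IntegrableOn (weight p l) (Ioi 0) := by
  refine ((integrableOn_exp_neg hl).add (integrableOn_weight_two hp)).mono'
    ((continuousOn_weight p l).aestronglyMeasurable measurableSet_Ioi) ?_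
  filter_upwards [ae_restrict_mem measurableSet_Ioi] with x hx
  have hx : 0 < x := hx
  rw [Real.norm_of_nonneg (weight_nonneg hx)]
  have e : weight p l x = speed x ^ (p + 1) * Real.exp (-l * x) + weight p 2 x * Real.exp (-l * x) := by
    simp only [weight]
    rw [Real.rpow_add (speed_pos hx), Real.rpow_one]
    have : speed x = 1 - Real.exp (-2 * x) := rfl
    rw [show speed x ^ p * speed x = speed x ^ p * (1 - Real.exp (-2 * x)) by rw [← this]]
    ring
  rw [e]
  have h1 : speed x ^ (p + 1) ≤ 1 :=
    Real.rpow_le_one (speed_pos hx).le (speed_lt_one x).le (by linarith)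
  have h2 : Real.exp (-l * x) ≤ 1 := by rw [Real.exp_le_one_iff]; nlinarith
  exact add_le_add (mul_le_of_le_one_left (Real.exp_pos _).le h1)
    (mul_le_of_le_one_right (weight_nonneg hx) h2)

theorem weight_sq {p l x : ℝ} (hx : 0 < x) : weight p l x ^ 2 = weight (2 * p) (2 * l) x := by
  rw [weight, weight, mul_pow, ← Real.exp_nat_mul, ← Real.rpow_natCast, ← Real.rpow_mul
    (speed_pos hx).le]
  congr 2 <;> (push_cast; ring)

theorem memLp_weight {p l : ℝ} (hp : -(1 / 2) < p) (hl : 0 < l) :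
    MemLp (weight p l) 2 (volume.restrict (Ioi 0)) := by
  rw [memLp_two_iff_integrable_sq ((continuousOn_weight p l).aestronglyMeasurable measurableSet_Ioi)]
  exact (integrableOn_weight (p := 2 * p) (l := 2 * l) (by linarith) (by linarith)).congr_fun
    (fun x hx => (weight_sq hx).symm) measurableSet_Ioi

theorem memLp_of_norm_le_weight {f : ℝ → 𝕜} {p l C : ℝ} (hp : -(1 / 2) < p) (hl : 0 < l)
    (hf : ContinuousOn f (Ioi 0)) (hb : ∀ x, 0 < x → ‖f x‖ ≤ C * weight p l x) :
    MemLp f 2 (volume.restrict (Ioi 0)) := by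
  refine ((memLp_weight hp hl).const_mul C).mono' (hf.aestronglyMeasurable measurableSet_Ioi) ?_
  filter_upwards [ae_restrict_mem measurableSet_Ioi] with x hx using hb x hx

theorem tendsto_zero_of_norm_le_weight {f : ℝ → 𝕜} {p l C : ℝ} (hp : 0 < p)
    (hb : ∀ x, 0 < x → ‖f x‖ ≤ C * weight p l x) : Tendsto f (𝓝[>] 0) (𝓝 0) := by
  have h1 : ContinuousAt (fun x => C * weight p l x) 0 :=
    continuousAt_const.mul ((continuous_speed.continuousAt.rpow_const (Or.inr hp.le)).mul
      (by fun_prop))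
  have h2 : Tendsto (fun x => C * weight p l x) (𝓝[>] 0) (𝓝 0) := by
    have := h1.tendsto.mono_left (nhdsWithin_le_nhds (s := Ioi 0))
    simpa [weight, speed_zero, Real.zero_rpow hp.ne'] using this
  exact squeeze_zero_norm' (eventually_nhdsWithin_of_forall fun x hx => hb x hx) h2

theorem tendsto_weight_atTop (p : ℝ) {l : ℝ} (hl : 0 < l) : Tendsto (weight p l) atTop (𝓝 0) := by
  have h1 := tendsto_speed_atTop.rpow_const (p := p) (Or.inl one_ne_zero)
  have h2 : Tendsto (fun x : ℝ => Real.exp (-l * x)) atTop (𝓝 0) :=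
    Real.tendsto_exp_atBot.comp (tendsto_id.const_mul_atTop_of_neg (by linarith))
  have h := h1.mul h2
  rwa [mul_zero] at h

theorem HalfH1.tendsto_norm_sq_div_speed {f f' : ℝ → 𝕜} (hf : HalfH1 f f') :
    Tendsto (fun x => ‖f x‖ ^ 2 / speed x) (𝓝[>] 0) (𝓝 0) := by
  have h1 : Tendsto (fun x : ℝ => ‖f x‖ ^ 2 / x * Real.exp (2 * x)) (𝓝[>] 0)
      (𝓝 (0 * Real.exp (2 * 0))) :=
    hf.tendsto_norm_sq_div.mul (((Real.continuous_exp.comp (continuous_const_mul 2)).tendsto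
      0).mono_left nhdsWithin_le_nhds)
  rw [zero_mul] at h1
  refine squeeze_zero' ?_ ?_ h1
  · filter_upwards [self_mem_nhdsWithin] with x hx
    have := speed_pos hx
    positivity
  · filter_upwards [self_mem_nhdsWithin] with x hx
    have hx : 0 < x := hx
    have h2 : x ≤ speed x * Real.exp (2 * x) := by
      have h3 := Real.add_one_le_exp (2 * x)
      have h4 : speed x * Real.exp (2 * x) = Real.exp (2 * x) - 1 := by
        rw [speed, sub_mul, ← Real.exp_add]; simp
      rw [h4]; linarith
    rw [div_mul_eq_mul_div, div_le_div_iff₀ (speed_pos hx) hx]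
    nlinarith [mul_le_mul_of_nonneg_left h2 (sq_nonneg ‖f x‖)]

theorem tendsto_mul_zero_of_norm_le_weight {w f f' : ℝ → 𝕜} {p l C : ℝ} (hp : -(1 / 2) ≤ p)
    (hl : 0 ≤ l) (hw : ∀ x, 0 < x → ‖w x‖ ≤ C * weight p l x) (hf : HalfH1 f f') :
    Tendsto (fun x => w x * f x) (𝓝[>] 0) (𝓝 0) := by
  have h1 := (hf.tendsto_norm_sq_div_speed.sqrt).const_mul |C|
  rw [Real.sqrt_zero, mul_zero] at h1
  refine squeeze_zero_norm' ?_ h1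
  filter_upwards [self_mem_nhdsWithin] with x hx
  have hx : 0 < x := hx
  have h2 : weight p l x ≤ weight (-(1 / 2)) 0 x := weight_le_weight hx hp hl
  have h3 : weight (-(1 / 2)) 0 x = (Real.sqrt (speed x))⁻¹ := by
    rw [weight, Real.rpow_neg (speed_pos hx).le, ← Real.sqrt_eq_rpow]; simp
  rw [norm_mul, Real.sqrt_div (by positivity), Real.sqrt_sq (norm_nonneg _), div_eq_inv_mul,
    ← mul_assoc, ← h3]
  refine mul_le_mul_of_nonneg_right ((hw x hx).trans ?_) (norm_nonneg _)
  exact (mul_le_mul_of_nonneg_right (le_abs_self C) (weight_nonneg hx)).trans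
    (mul_le_mul_of_nonneg_left h2 (abs_nonneg C))

/-- The scalar function `(1 - e^{-2x})^q e^{-μx}`. -/
def weightPow (q μ : 𝕜) (x : ℝ) : 𝕜 :=
  NormedSpace.exp ((Real.log (speed x) : 𝕜) * q - (x : 𝕜) * μ)

theorem norm_weightPow (q μ : 𝕜) {x : ℝ} (hx : 0 < x) :
    ‖weightPow q μ x‖ = weight (RCLike.re q) (RCLike.re μ) x := by
  rw [weightPow, norm_exp_eq, weight, Real.rpow_def_of_pos (speed_pos hx), ← Real.exp_add, map_sub,
    RCLike.re_ofReal_mul, RCLike.re_ofReal_mul]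
  congr 1; ring

theorem hasDerivAt_weightPow (q μ : 𝕜) {x : ℝ} (hx : 0 < x) :
    HasDerivAt (weightPow q μ)
      ((2 * q * (Real.exp (-2 * x) : 𝕜) / (speed x : 𝕜) - μ) * weightPow q μ x) x := by
  have h1 := hasDerivAt_ofReal (𝕜 := 𝕜) ((hasDerivAt_speed x).log (speed_pos hx).ne')
  have h2 := hasDerivAt_ofReal (𝕜 := 𝕜) (hasDerivAt_id x)
  have h := hasDerivAt_exp_comp ((h1.mul_const q).fun_sub (h2.mul_const μ))
  refine h.congr_deriv ?_
  simp only [weightPow, id]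
  push_cast
  ring

theorem speed_cast_ne {x : ℝ} (hx : 0 < x) : (speed x : 𝕜) ≠ 0 := by
  exact_mod_cast (speed_pos hx).ne'

theorem conj_weightPow (q μ : 𝕜) (x : ℝ) : starRingEnd 𝕜 (weightPow q μ x) =
    weightPow (starRingEnd 𝕜 q) (starRingEnd 𝕜 μ) x := by
  rw [weightPow, weightPow]
  have h := NormedSpace.map_exp (starRingEnd 𝕜) RCLike.continuous_conj
    ((Real.log (speed x) : 𝕜) * q - (x : 𝕜) * μ)
  rw [h]
  simp

/-! ### The adjoint eigenfunction -/

theorem HalfH1.ae_deriv_eq {f f' : ℝ → 𝕜} (hf : HalfH1 f f') :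
    ∀ᵐ x, x ∈ Ioi 0 → deriv f x = f' x := by
  filter_upwards [hf.prim.ae_hasDerivAt isOpen_Ioi] with x hx h using (hx h).deriv

/-- `H¹` estimates for `w = (1 - e^{-2x})^q e^{-μx}`. -/
theorem halfH1_weightPow {q μ : 𝕜} (hq : 1 / 2 < RCLike.re q) (hμ : 0 < RCLike.re μ) :
    HalfH1 (weightPow q μ) (fun x =>
      (2 * q * (Real.exp (-2 * x) : 𝕜) / (speed x : 𝕜) - μ) * weightPow q μ x) ∧
    ∀ x, 0 < x → ‖(2 * q * (Real.exp (-2 * x) : 𝕜) / (speed x : 𝕜) - μ) * weightPow q μ x‖ ≤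
      (2 * ‖q‖ + ‖μ‖) * weight (RCLike.re q - 1) (RCLike.re μ) x := by
  have hc : ContinuousOn (weightPow q μ) (Ioi 0) := fun x hx =>
    (hasDerivAt_weightPow q μ hx).continuousAt.continuousWithinAt
  have c3 : Continuous fun x => (Real.exp (-2 * x) : 𝕜) := RCLike.continuous_ofReal.comp (by fun_prop)
  have c4 : Continuous fun x => (speed x : 𝕜) := RCLike.continuous_ofReal.comp continuous_speed
  have hc' : ContinuousOn (fun x =>
      (2 * q * (Real.exp (-2 * x) : 𝕜) / (speed x : 𝕜) - μ) * weightPow q μ x) (Ioi 0) :=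
    (((continuous_const.mul c3).continuousOn.div c4.continuousOn
      fun x hx => speed_cast_ne hx).sub continuousOn_const).mul hc
  have hb : ∀ x, 0 < x → ‖weightPow q μ x‖ ≤ 1 * weight (RCLike.re q) (RCLike.re μ) x :=
    fun x hx => by rw [norm_weightPow q μ hx, one_mul]
  have hb' : ∀ x, 0 < x → ‖(2 * q * (Real.exp (-2 * x) : 𝕜) / (speed x : 𝕜) - μ) * weightPow q μ x‖ ≤
      (2 * ‖q‖ + ‖μ‖) * weight (RCLike.re q - 1) (RCLike.re μ) x := by
    intro x hx
    have hs := speed_pos hx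
    have h0 : weight (RCLike.re q) (RCLike.re μ) x =
        speed x * weight (RCLike.re q - 1) (RCLike.re μ) x := by
      rw [speed_mul_weight hx]; congr 1; ring
    have h1 : ‖2 * q * (Real.exp (-2 * x) : 𝕜) / (speed x : 𝕜) - μ‖ ≤
        (2 * ‖q‖ + ‖μ‖) / speed x := by
      refine (norm_sub_le _ _).trans ?_
      rw [norm_div, norm_mul, norm_mul, RCLike.norm_ofReal, RCLike.norm_ofReal, RCLike.norm_two,
        abs_of_pos hs, abs_of_pos (Real.exp_pos _), add_div]
      refine add_le_add (div_le_div_of_nonneg_right (mul_le_of_le_one_right (by positivity) ?_) hs.le)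
        ?_
      · rw [Real.exp_le_one_iff]; linarith
      · rw [le_div_iff₀ hs]
        exact mul_le_of_le_one_right (norm_nonneg _) (speed_lt_one x).le
    rw [norm_mul, norm_weightPow q μ hx, h0]
    refine (mul_le_mul_of_nonneg_right h1 (mul_nonneg hs.le (weight_nonneg hx))).trans (le_of_eq ?_)
    field_simp
  refine ⟨⟨IsPrimitiveOn.of_hasDerivAt (fun x hx => hasDerivAt_weightPow q μ hx) hc',
    memLp_of_norm_le_weight (by linarith) hμ hc hb,
    memLp_of_norm_le_weight (by linarith) hμ hc' hb',
    tendsto_zero_of_norm_le_weight (by linarith) hb⟩, hb'⟩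

theorem tendsto_exp_mul_tail {v : ℝ → 𝕜} (hv : MemH1 v) :
    Tendsto (fun x => (Real.exp x : 𝕜) * tail v x) atTop (𝓝 0) := by
  have h : Tendsto (fun x => Real.exp (-x) * ∫ y in Ioi 0, ‖(Real.exp (-1 * y) : 𝕜) * v y‖)
      atTop (𝓝 (0 * ∫ y in Ioi 0, ‖(Real.exp (-1 * y) : 𝕜) * v y‖)) :=
    (Real.tendsto_exp_neg_atTop_nhds_zero).mul_const _
  rw [zero_mul] at h
  refine squeeze_zero_norm' ?_ h
  filter_upwards [eventually_ge_atTop 0] with x hx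
  rw [norm_mul, RCLike.norm_ofReal, abs_of_pos (Real.exp_pos _)]
  refine (mul_le_mul_of_nonneg_left (norm_tail_le hv.memLp hx) (Real.exp_pos _).le).trans
    (le_of_eq ?_)
  rw [← mul_assoc, ← Real.exp_add]
  congr 2; ring

theorem adjoint_identity {b : ℝ} {m q : 𝕜} (hq : q = ((b - 2 : ℝ) - m) / 2)
    (hm : 0 < RCLike.re m) (hmb : RCLike.re m < b - 3) {v : ℝ → 𝕜} (hv : MemDom v) :
    ∫ x in Ioi 0, (weightPow q m x * linOp b v x +
      (2 * q * (Real.exp (-2 * x) : 𝕜) / (speed x : 𝕜) - m) * weightPow q m x *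
        deriv (linOp b v) x) =
    m * ∫ x in Ioi 0, (weightPow q m x * v x +
      (2 * q * (Real.exp (-2 * x) : 𝕜) / (speed x : 𝕜) - m) * weightPow q m x * deriv v x) := by
  have hqre : 1 / 2 < RCLike.re q := by
    have : (2 : ℝ) * RCLike.re q = b - 2 - RCLike.re m := by
      have h2 : ((2 : ℝ) : 𝕜) * q = ((b - 2 : ℝ) : 𝕜) - m := by rw [hq]; push_cast; ring
      have := congrArg RCLike.re h2
      rwa [RCLike.re_ofReal_mul, map_sub, RCLike.ofReal_re] at this
    linarith
  obtain ⟨hW, hWb⟩ := halfH1_weightPow (𝕜 := 𝕜) hqre hm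
  set W := weightPow q m with hWdef
  set W1 : ℝ → 𝕜 := fun x => (2 * q * (Real.exp (-2 * x) : 𝕜) / (speed x : 𝕜) - m) * W x with hW1
  have hF := halfH1_linOp hv b
  have hF' := hF.ae_deriv_eq
  have hLW := hW.memLp
  have hLW1 := hW.memLp_deriv
  have hLF := (hv.memH1Zero_linOp b).1
  have iA : IntegrableOn (fun x => W x * linOp b v x + W1 x * deriv (linOp b v) x) (Ioi 0) :=
    (MemLp.integrable_mul hLW (hLF.memLp.restrict _)).add
      (MemLp.integrable_mul hLW1 (hLF.memLp_deriv.restrict _))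
  have iB : IntegrableOn (fun x => W x * v x + W1 x * deriv v x) (Ioi 0) :=
    (MemLp.integrable_mul hLW (hv.memH1.memLp.restrict _)).add
      (MemLp.integrable_mul hLW1 (hv.memH1.memLp_deriv.restrict _))
  rw [← integral_const_mul, ← sub_eq_zero, ← integral_sub iA (iB.const_mul m)]
  -- the antiderivative
  have c3 : Continuous fun x => (Real.exp (-2 * x) : 𝕜) := RCLike.continuous_ofReal.comp (by fun_prop)
  have c4 : Continuous fun x => (speed x : 𝕜) := RCLike.continuous_ofReal.comp continuous_speed
  have hprim1 : IsPrimitiveOn W1 (fun x => (((((b - 2 : ℝ) : 𝕜) * (Real.exp (-2 * x) : 𝕜) - m) * W1 x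
      - 2 * ((b - 2 : ℝ) : 𝕜) * (Real.exp (-2 * x) : 𝕜) * W x
      - 2 * (Real.exp (-2 * x) : 𝕜) * W1 x) / (speed x : 𝕜))) (Ioi 0) := by
    refine IsPrimitiveOn.of_hasDerivAt (fun x hx => ?_) ?_
    · have h1 := hasDerivAt_weightPow q m hx
      have h2 := hasDerivAt_ofReal (𝕜 := 𝕜) (hasDerivAt_exp_const_mul (-2) x)
      have h3 := hasDerivAt_ofReal (𝕜 := 𝕜) (hasDerivAt_speed x)
      have hne : (speed x : 𝕜) ≠ 0 := speed_cast_ne hx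
      have h4 := (((h2.const_mul (2 * q)).fun_div h3 hne).sub_const m).fun_mul h1
      refine h4.congr_deriv ?_
      have hs : (speed x : 𝕜) = 1 - (Real.exp (-2 * x) : 𝕜) := by rw [speed]; push_cast; ring
      have hb : ((b - 2 : ℝ) : 𝕜) = 2 * q + m := by rw [hq]; ring
      simp only [hW1, hWdef, hb, RCLike.ofReal_mul, RCLike.ofReal_neg, RCLike.ofReal_ofNat]
      have hne2 : (1 - (Real.exp (-2 * x) : 𝕜)) ≠ 0 := hs ▸ hne
      rw [hs]
      generalize (Real.exp (-2 * x) : 𝕜) = X at hne2 ⊢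
      field_simp
      ring
    · have cW := hW.prim.continuousOn isOpen_Ioi
      have cW1 : ContinuousOn W1 (Ioi 0) :=
        ((continuousOn_const.mul c3.continuousOn).div c4.continuousOn
          (fun x hx => speed_cast_ne hx)).sub continuousOn_const |>.mul cW
      exact ((((continuousOn_const.mul c3.continuousOn).sub continuousOn_const).mul cW1).sub
        ((continuousOn_const.mul c3.continuousOn).mul cW)).sub
        ((continuousOn_const.mul c3.continuousOn).mul cW1) |>.div c4.continuousOn
          (fun x hx => speed_cast_ne hx)
  have hflux : HalfH1 (flux v) (deriv (flux v)) := MemH1Zero.halfH1 hv.2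
  have hv1 := hv.1.halfH1
  have pE : IsPrimitiveOn (tail v) (fun x => -((Real.exp (-3 * x) : 𝕜) * v x)) (Ioi 0) :=
    IsPrimitiveOn.of_hasDerivAt (fun x _ => hasDerivAt_tail hv.memH1 x)
      ((RCLike.continuous_ofReal.comp (by fun_prop : Continuous fun x : ℝ => Real.exp (-3 * x))).mul
        hv.memH1.continuous).neg.continuousOn
  have hα : ∀ x ∈ Ioi (0 : ℝ), HasDerivAt (fun x => 1 + (2 * b - 5) * Real.exp (-2 * x))
      ((2 * b - 5) * (-2 * Real.exp (-2 * x))) x := fun x _ =>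
    ((hasDerivAt_exp_const_mul (-2) x).const_mul _).const_add 1
  have pα := (hW.prim.mul_real isOpen_Ioi hα (by fun_prop)).mul isOpen_Ioi hv1.prim
  have pe1 := hW.prim.mul_real isOpen_Ioi (fun x _ => (hasDerivAt_neg x).exp) (by fun_prop)
  have pe2 := (hW.prim.mul_real isOpen_Ioi (fun x _ => Real.hasDerivAt_exp x) (by fun_prop)).mul
    isOpen_Ioi pE
  have pB := (((hprim1.mul isOpen_Ioi hflux.prim).add pα).sub
    (pe1.const_mul (((4 * (b - 3) : ℝ) : 𝕜) * tail v 0))).sub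
    (pe2.const_mul ((4 * (b - 3) : ℝ) : 𝕜))
  have hpB := pB.congr (g' := fun x => W x * linOp b v x + W1 x * deriv (linOp b v) x -
      m * (W x * v x + W1 x * deriv v x)) (fun x _ => rfl) (by
    filter_upwards [hF'] with x hx hx0
    have hx0' : 0 < x := hx0
    rw [hx hx0, linOp_eq_flux hv.memH1.memLp b hx0', flux, ← speed_eq_peakon hx0'.le,
      RCLike.real_smul_eq_coe_mul]
    have hs : (speed x : 𝕜) = 1 - (Real.exp (-2 * x) : 𝕜) := by rw [speed]; push_cast; ring
    have hne : (speed x : 𝕜) ≠ 0 := speed_cast_ne hx0'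
    have hb : 2 * q = ((b - 2 : ℝ) : 𝕜) - m := by rw [hq]; ring
    have h1 : W1 x * (speed x : 𝕜) = (((b - 2 : ℝ) : 𝕜) * (Real.exp (-2 * x) : 𝕜) - m) * W x := by
      simp only [hW1, hb]
      field_simp
      rw [hs]; ring_nf
    have h2 : ∀ y : 𝕜, y / (speed x : 𝕜) * (speed x : 𝕜) = y := fun y => div_mul_cancel₀ y hne
    have h3 : (Real.exp x : 𝕜) * (Real.exp (-3 * x) : 𝕜) = (Real.exp (-2 * x) : 𝕜) := by
      rw [← RCLike.ofReal_mul, ← Real.exp_add]; congr 2; ring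
    have h2' := h2 ((((b - 2 : ℝ) : 𝕜) * (Real.exp (-2 * x) : 𝕜) - m) * W1 x
      - 2 * ((b - 2 : ℝ) : 𝕜) * (Real.exp (-2 * x) : 𝕜) * W x
      - 2 * (Real.exp (-2 * x) : 𝕜) * W1 x)
    rw [hs] at h1 h2' ⊢
    push_cast at h1 h2' ⊢
    linear_combination (deriv v x) * h2' + v x * h1 + (4 * ((b : 𝕜) - 3)) * W x * v x * h3)
  refine hpB.integral_eq_zero (iA.sub (iB.const_mul m)) ?_ ?_
  · have t1 := tendsto_mul_zero_of_norm_le_weight (by linarith : -(1 / 2) ≤ RCLike.re q - 1) hm.le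
      hWb hflux
    have cα : Continuous fun x => ((1 + (2 * b - 5) * Real.exp (-2 * x) : ℝ) : 𝕜) :=
      RCLike.continuous_ofReal.comp (by fun_prop)
    have ce : Continuous fun x => (Real.exp x : 𝕜) := RCLike.continuous_ofReal.comp (by fun_prop)
    have ce' : Continuous fun x => (Real.exp (-x) : 𝕜) :=
      RCLike.continuous_ofReal.comp (by fun_prop)
    have htc : Continuous (tail v) :=
      continuous_iff_continuousAt.2 fun x => (hasDerivAt_tail hv.memH1 x).continuousAt
    have lim : ∀ {k : ℝ → 𝕜}, Continuous k → Tendsto k (𝓝[>] 0) (𝓝 (k 0)) := fun hk =>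
      (hk.tendsto 0).mono_left nhdsWithin_le_nhds
    have t := ((t1.add (((lim cα).mul hW.tendsto).mul hv1.tendsto)).sub
      (((lim ce').mul hW.tendsto).const_mul (((4 * (b - 3) : ℝ) : 𝕜) * tail v 0))).sub
      ((((lim ce).mul hW.tendsto).mul (lim htc)).const_mul ((4 * (b - 3) : ℝ) : 𝕜))
    simpa only [mul_zero, zero_mul, add_zero, sub_zero] using t
  · have t1 : Tendsto W1 atTop (𝓝 0) :=
      squeeze_zero_norm' ((eventually_gt_atTop 0).mono hWb)
        (by simpa using (tendsto_weight_atTop (RCLike.re q - 1) hm).const_mul (2 * ‖q‖ + ‖m‖))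
    have e0 : Tendsto (fun x : ℝ => Real.exp (-2 * x)) atTop (𝓝 0) :=
      Real.tendsto_exp_atBot.comp (tendsto_id.const_mul_atTop_of_neg (by norm_num))
    have tα := (RCLike.continuous_ofReal (K := 𝕜)).continuousAt.tendsto.comp
      ((e0.const_mul (2 * b - 5)).const_add 1)
    have te := (RCLike.continuous_ofReal (K := 𝕜)).continuousAt.tendsto.comp
      Real.tendsto_exp_neg_atTop_nhds_zero
    have t := (((t1.mul hflux.tendsto_atTop).add ((tα.mul hW.tendsto_atTop).mul
      hv1.tendsto_atTop)).sub
      ((te.mul hW.tendsto_atTop).const_mul (((4 * (b - 3) : ℝ) : 𝕜) * tail v 0))).sub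
      ((hW.tendsto_atTop.mul (tendsto_exp_mul_tail hv.memH1)).const_mul ((4 * (b - 3) : ℝ) : 𝕜))
    simp only [mul_zero, add_zero, sub_zero] at t
    refine t.congr fun x => ?_
    simp only [Function.comp]
    ring

/-! ### The Dirichlet problem `v - v'' = M` on the half-line -/

/-- `M` is continuous on the half-line and bounded by a multiple of a weight. -/
structure SourceBound (p l C : ℝ) (M : ℝ → 𝕜) : Prop where
  cont : ContinuousOn M (Ioi 0)
  bound : ∀ x, 0 < x → ‖M x‖ ≤ C * weight (-p) l x

/-- `∫_0^x sinh(z) M(z) dz`. -/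
def greenInner (M : ℝ → 𝕜) (x : ℝ) : 𝕜 := ∫ z in (0 : ℝ)..x, (Real.sinh z : 𝕜) * M z

/-- `∫_x^∞ e^{-z} M(z) dz`. -/
def greenOuter (M : ℝ → 𝕜) (x : ℝ) : 𝕜 := ∫ z in Ioi x, (Real.exp (-z) : 𝕜) * M z

/-- The solution of `v - v'' = M` on the half-line with `v(0) = 0`. -/
def green (M : ℝ → 𝕜) (x : ℝ) : 𝕜 :=
  (Real.exp (-x) : 𝕜) * greenInner M x + (Real.sinh x : 𝕜) * greenOuter M x

/-- The derivative of `green M`. -/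
def greenDeriv (M : ℝ → 𝕜) (x : ℝ) : 𝕜 :=
  -((Real.exp (-x) : 𝕜) * greenInner M x) + (Real.cosh x : 𝕜) * greenOuter M x

theorem sinh_eq_speed (x : ℝ) : Real.sinh x = Real.exp x * speed x / 2 := by
  rw [Real.sinh_eq, speed, mul_sub, ← Real.exp_add]; ring_nf

theorem weight_mul_exp (p l c x : ℝ) : weight p l x * Real.exp (c * x) = weight p (l - c) x := by
  rw [weight, weight, mul_assoc, ← Real.exp_add]; congr 2; ring

theorem weight_mul_weight {p q l k x : ℝ} (hx : 0 < x) :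
    weight p l x * weight q k x = weight (p + q) (l + k) x := by
  rw [weight, weight, weight, Real.rpow_add (speed_pos hx), neg_add, add_mul, Real.exp_add]; ring

theorem continuous_sinh_cast : Continuous fun x => (Real.sinh x : 𝕜) :=
  RCLike.continuous_ofReal.comp Real.continuous_sinh

theorem continuous_expNeg_cast : Continuous fun x => (Real.exp (-x) : 𝕜) :=
  RCLike.continuous_ofReal.comp (by fun_prop)

/-- The integral of a weight over the half-line. -/
def weightMass (p l : ℝ) : ℝ := ∫ x in Ioi 0, weight p l x

theorem weightMass_nonneg (p l : ℝ) : 0 ≤ weightMass p l :=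
  setIntegral_nonneg measurableSet_Ioi fun _ hx => weight_nonneg hx

namespace SourceBound

variable {p l C : ℝ} {M : ℝ → 𝕜}

theorem nonneg (h : SourceBound p l C M) : 0 ≤ C :=
  nonneg_of_mul_nonneg_left ((norm_nonneg _).trans (h.bound 1 one_pos)) (weight_pos one_pos)

theorem norm_sinh_mul_le (h : SourceBound p l C M) {x z : ℝ} (hz : 0 < z) (hzx : z ≤ x)
    (hl2 : l ≤ 2) : ‖(Real.sinh z : 𝕜) * M z‖ ≤
      C * weight (1 / 4) (l / 2 - 1) x * weight (3 / 4 - p) (l / 2) z := by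
  have hx := hz.trans_le hzx
  rw [norm_mul, RCLike.norm_ofReal, abs_of_pos (Real.sinh_pos_iff.2 hz), sinh_eq_speed]
  have h1 := mul_le_mul_of_nonneg_left (h.bound z hz)
    (mul_nonneg (Real.exp_pos z).le (speed_pos hz).le)
  have h2 : weight (1 / 4) (l / 2 - 1) z ≤ weight (1 / 4) (l / 2 - 1) x :=
    mul_le_mul (Real.rpow_le_rpow (speed_pos hz).le (speed_mono hzx) (by norm_num))
      (Real.exp_le_exp.2 (by nlinarith)) (Real.exp_pos _).le (Real.rpow_nonneg (speed_pos hx).le _)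
  have h3 : Real.exp z * speed z * (C * weight (-p) l z) =
      C * (weight (1 / 4) (l / 2 - 1) z * weight (3 / 4 - p) (l / 2) z) := by
    rw [weight_mul_weight hz]
    have := weight_mul_exp (1 - p) l 1 z
    rw [one_mul] at this
    rw [show Real.exp z * speed z * (C * weight (-p) l z) =
      C * (speed z * weight (-p) l z * Real.exp z) by ring, speed_mul_weight hz,
      show -p + 1 = 1 - p by ring, this]
    congr 2 <;> ring
  have h4 := mul_le_mul_of_nonneg_left (mul_le_mul_of_nonneg_right h2
    (weight_nonneg (p := 3 / 4 - p) (l := l / 2) hz)) h.nonneg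
  have h5 : 0 ≤ Real.exp z * speed z * ‖M z‖ :=
    mul_nonneg (mul_nonneg (Real.exp_pos z).le (speed_pos hz).le) (norm_nonneg _)
  rw [h3] at h1
  nlinarith

theorem intervalIntegrable_sinh (h : SourceBound p l C M) (hp : p < 3 / 2) (hl : 0 < l)
    (hl2 : l ≤ 2) {x : ℝ} (hx : 0 < x) :
    IntervalIntegrable (fun z => (Real.sinh z : 𝕜) * M z) volume 0 x := by
  rw [intervalIntegrable_iff_integrableOn_Ioc_of_le hx.le]
  have hi := (integrableOn_weight (p := 3 / 4 - p) (l := l / 2) (by linarith) (by linarith)).mono_set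
    (fun z hz => hz.1 : Ioc 0 x ⊆ Ioi 0)
  refine (hi.const_mul (C * weight (1 / 4) (l / 2 - 1) x)).mono' ?_ ?_
  · exact ((continuous_sinh_cast.continuousOn.mul h.cont).mono
      Ioc_subset_Ioi_self).aestronglyMeasurable measurableSet_Ioc
  · filter_upwards [ae_restrict_mem measurableSet_Ioc] with z hz
    exact h.norm_sinh_mul_le hz.1 hz.2 hl2

theorem norm_greenInner_le (h : SourceBound p l C M) (hp : p < 3 / 2) (hl : 0 < l)
    (hl2 : l ≤ 2) {x : ℝ} (hx : 0 < x) :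
    ‖greenInner M x‖ ≤ C * weight (1 / 4) (l / 2 - 1) x * weightMass (3 / 4 - p) (l / 2) := by
  have hi := integrableOn_weight (p := 3 / 4 - p) (l := l / 2) (by linarith) (by linarith)
  rw [greenInner, intervalIntegral.integral_of_le hx.le, weightMass, ← integral_const_mul]
  refine (norm_integral_le_integral_norm _).trans ((setIntegral_mono_on
    ((intervalIntegrable_iff_integrableOn_Ioc_of_le hx.le).1
      (h.intervalIntegrable_sinh hp hl hl2 hx)).norm
    ((hi.mono_set Ioc_subset_Ioi_self).const_mul _) measurableSet_Ioc
    fun z hz => h.norm_sinh_mul_le hz.1 hz.2 hl2).trans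
    (setIntegral_mono_set (hi.const_mul _) ?_ Ioc_subset_Ioi_self.eventuallyLE))
  filter_upwards [ae_restrict_mem measurableSet_Ioi] with z hz
  exact mul_nonneg (mul_nonneg h.nonneg (weight_nonneg hx)) (weight_nonneg hz)

theorem norm_exp_mul_le (h : SourceBound p l C M) (hp1 : 1 ≤ p) (hl : 0 < l)
    {x z : ℝ} (hx : 0 < x) (hxz : x ≤ z) : ‖(Real.exp (-z) : 𝕜) * M z‖ ≤
      C * weight (-(p / 2 - 1 / 4)) (1 + l / 2) x * weight (-(p / 2 + 1 / 4)) (l / 2) z := by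
  have hz := hx.trans_le hxz
  rw [norm_mul, RCLike.norm_ofReal, abs_of_pos (Real.exp_pos _)]
  have h1 := mul_le_mul_of_nonneg_left (h.bound z hz) (Real.exp_pos (-z)).le
  have h2 : weight (-(p / 2 - 1 / 4)) (1 + l / 2) z ≤ weight (-(p / 2 - 1 / 4)) (1 + l / 2) x :=
    mul_le_mul (Real.rpow_le_rpow_of_nonpos (speed_pos hx) (speed_mono hxz) (by linarith))
      (Real.exp_le_exp.2 (by nlinarith)) (Real.exp_pos _).le (Real.rpow_nonneg (speed_pos hx).le _)
  have h3 : Real.exp (-z) * (C * weight (-p) l z) =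
      C * (weight (-(p / 2 - 1 / 4)) (1 + l / 2) z * weight (-(p / 2 + 1 / 4)) (l / 2) z) := by
    rw [weight_mul_weight hz]
    have := weight_mul_exp (-p) l (-1) z
    rw [neg_one_mul] at this
    rw [mul_left_comm, mul_comm (Real.exp (-z)), this]
    congr 2 <;> ring
  have h4 := mul_le_mul_of_nonneg_left (mul_le_mul_of_nonneg_right h2
    (weight_nonneg (p := -(p / 2 + 1 / 4)) (l := l / 2) hz)) h.nonneg
  rw [h3] at h1
  linarith

theorem integrableOn_exp (h : SourceBound p l C M) (hp1 : 1 ≤ p) (hp : p < 3 / 2) (hl : 0 < l)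
    {x : ℝ} (hx : 0 < x) : IntegrableOn (fun z => (Real.exp (-z) : 𝕜) * M z) (Ioi x) := by
  have hi := (integrableOn_weight (p := -(p / 2 + 1 / 4)) (l := l / 2) (by linarith)
    (by linarith)).mono_set (Ioi_subset_Ioi hx.le)
  refine (hi.const_mul (C * weight (-(p / 2 - 1 / 4)) (1 + l / 2) x)).mono' ?_ ?_
  · exact ((continuous_expNeg_cast.continuousOn.mul h.cont).mono
      (Ioi_subset_Ioi hx.le)).aestronglyMeasurable measurableSet_Ioi
  · filter_upwards [ae_restrict_mem measurableSet_Ioi] with z hz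
    exact h.norm_exp_mul_le hp1 hl hx (le_of_lt hz)

theorem norm_greenOuter_le (h : SourceBound p l C M) (hp1 : 1 ≤ p) (hp : p < 3 / 2) (hl : 0 < l)
    {x : ℝ} (hx : 0 < x) : ‖greenOuter M x‖ ≤
      C * weight (-(p / 2 - 1 / 4)) (1 + l / 2) x * weightMass (-(p / 2 + 1 / 4)) (l / 2) := by
  have hi := integrableOn_weight (p := -(p / 2 + 1 / 4)) (l := l / 2) (by linarith) (by linarith)
  rw [greenOuter, weightMass, ← integral_const_mul]
  refine (norm_integral_le_integral_norm _).trans ((setIntegral_mono_on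
    (h.integrableOn_exp hp1 hp hl hx).norm
    ((hi.mono_set (Ioi_subset_Ioi hx.le)).const_mul _) measurableSet_Ioi
    fun z hz => h.norm_exp_mul_le hp1 hl hx (le_of_lt hz)).trans
    (setIntegral_mono_set (hi.const_mul _) ?_ (Ioi_subset_Ioi hx.le).eventuallyLE))
  filter_upwards [ae_restrict_mem measurableSet_Ioi] with z hz
  exact mul_nonneg (mul_nonneg h.nonneg (weight_nonneg hx)) (weight_nonneg hz)

/-- The constant in the estimates for the Green operator. -/
def _root_.Novikov.greenConst (p l : ℝ) : ℝ :=
  weightMass (3 / 4 - p) (l / 2) + weightMass (-(p / 2 + 1 / 4)) (l / 2)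

theorem norm_expNeg_mul_greenInner_le (h : SourceBound p l C M) (hp : p < 3 / 2) (hl : 0 < l)
    (hl2 : l ≤ 2) {x : ℝ} (hx : 0 < x) : ‖(Real.exp (-x) : 𝕜) * greenInner M x‖ ≤
      C * weightMass (3 / 4 - p) (l / 2) * weight (1 / 4) (l / 2) x := by
  rw [norm_mul, RCLike.norm_ofReal, abs_of_pos (Real.exp_pos _)]
  refine (mul_le_mul_of_nonneg_left (h.norm_greenInner_le hp hl hl2 hx)
    (Real.exp_pos _).le).trans (le_of_eq ?_)
  have := weight_mul_exp (1 / 4) (l / 2 - 1) (-1) x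
  rw [neg_one_mul, sub_neg_eq_add, sub_add_cancel] at this
  rw [← this]; ring

theorem norm_green_le (h : SourceBound p l C M) (hp1 : 1 ≤ p) (hp : p < 3 / 2) (hl : 0 < l)
    (hl2 : l ≤ 2) {x : ℝ} (hx : 0 < x) :
    ‖green M x‖ ≤ C * greenConst p l * weight (1 / 4) (l / 2) x := by
  have h1 := h.norm_expNeg_mul_greenInner_le hp hl hl2 hx
  have h2 : ‖(Real.sinh x : 𝕜) * greenOuter M x‖ ≤
      C * weightMass (-(p / 2 + 1 / 4)) (l / 2) * weight (1 / 4) (l / 2) x := by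
    rw [norm_mul, RCLike.norm_ofReal, abs_of_pos (Real.sinh_pos_iff.2 hx), sinh_eq_speed]
    have h3 := mul_le_mul_of_nonneg_left (h.norm_greenOuter_le hp1 hp hl hx)
      (mul_nonneg (Real.exp_pos x).le (speed_pos hx).le)
    have h4 : Real.exp x * speed x * weight (-(p / 2 - 1 / 4)) (1 + l / 2) x ≤
        weight (1 / 4) (l / 2) x := by
      have := weight_mul_exp (-(p / 2 - 1 / 4) + 1) (1 + l / 2) 1 x
      rw [one_mul] at this
      rw [mul_assoc, speed_mul_weight hx, mul_comm, this]
      exact weight_le_weight hx (by linarith) (by linarith)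
    have h5 := mul_le_mul_of_nonneg_left h4 (mul_nonneg h.nonneg
      (weightMass_nonneg (-(p / 2 + 1 / 4)) (l / 2)))
    have h6 : 0 ≤ Real.exp x * speed x * ‖greenOuter M x‖ :=
      mul_nonneg (mul_nonneg (Real.exp_pos x).le (speed_pos hx).le) (norm_nonneg _)
    nlinarith
  refine (norm_add_le _ _).trans ((add_le_add h1 h2).trans (le_of_eq ?_))
  rw [greenConst]; ring

theorem norm_greenDeriv_le (h : SourceBound p l C M) (hp1 : 1 ≤ p) (hp : p < 3 / 2) (hl : 0 < l)
    (hl2 : l ≤ 2) {x : ℝ} (hx : 0 < x) :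
    ‖greenDeriv M x‖ ≤ C * greenConst p l * weight (-(p / 2 - 1 / 4)) (l / 2) x := by
  have h1 : ‖-((Real.exp (-x) : 𝕜) * greenInner M x)‖ ≤
      C * weightMass (3 / 4 - p) (l / 2) * weight (-(p / 2 - 1 / 4)) (l / 2) x := by
    rw [norm_neg]
    exact (h.norm_expNeg_mul_greenInner_le hp hl hl2 hx).trans (mul_le_mul_of_nonneg_left
      (weight_le_weight hx (by linarith) le_rfl) (mul_nonneg h.nonneg (weightMass_nonneg _ _)))
  have h2 : ‖(Real.cosh x : 𝕜) * greenOuter M x‖ ≤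
      C * weightMass (-(p / 2 + 1 / 4)) (l / 2) * weight (-(p / 2 - 1 / 4)) (l / 2) x := by
    rw [norm_mul, RCLike.norm_ofReal, abs_of_pos (Real.cosh_pos x)]
    have h3 : Real.cosh x ≤ Real.exp x := by
      rw [Real.cosh_eq]; linarith [Real.exp_le_exp.2 (show -x ≤ x by linarith)]
    refine (mul_le_mul h3 (h.norm_greenOuter_le hp1 hp hl hx) (norm_nonneg _)
      (Real.exp_pos x).le).trans (le_of_eq ?_)
    have := weight_mul_exp (-(p / 2 - 1 / 4)) (1 + l / 2) 1 x
    rw [one_mul, add_sub_cancel_left] at this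
    rw [← this]; ring
  refine (norm_add_le _ _).trans ((add_le_add h1 h2).trans (le_of_eq ?_))
  rw [greenConst]; ring

theorem hasDerivAt_greenInner (h : SourceBound p l C M) (hp : p < 3 / 2) (hl : 0 < l)
    (hl2 : l ≤ 2) {x : ℝ} (hx : 0 < x) :
    HasDerivAt (greenInner M) ((Real.sinh x : 𝕜) * M x) x := by
  have hc : ContinuousOn (fun z => (Real.sinh z : 𝕜) * M z) (Ioi 0) :=
    continuous_sinh_cast.continuousOn.mul h.cont
  exact intervalIntegral.integral_hasDerivAt_right (h.intervalIntegrable_sinh hp hl hl2 hx)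
    (hc.stronglyMeasurableAtFilter isOpen_Ioi x hx) (hc.continuousAt (Ioi_mem_nhds hx))

theorem hasDerivAt_greenOuter (h : SourceBound p l C M) (hp1 : 1 ≤ p) (hp : p < 3 / 2) (hl : 0 < l)
    {x : ℝ} (hx : 0 < x) : HasDerivAt (greenOuter M) (-((Real.exp (-x) : 𝕜) * M x)) x := by
  have hc : ContinuousOn (fun z => (Real.exp (-z) : 𝕜) * M z) (Ioi 0) :=
    continuous_expNeg_cast.continuousOn.mul h.cont
  have h2 := (intervalIntegral.integral_hasDerivAt_right (a := x) (b := x) (by simp)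
    (hc.stronglyMeasurableAtFilter isOpen_Ioi x hx) (hc.continuousAt (Ioi_mem_nhds hx))).const_sub
    (greenOuter M x)
  refine h2.congr_of_eventuallyEq ?_
  filter_upwards [Ioi_mem_nhds hx] with z hz
  rw [greenOuter, greenOuter, ← intervalIntegral.integral_Ioi_sub_Ioi'
    (h.integrableOn_exp hp1 hp hl hx) (h.integrableOn_exp hp1 hp hl hz)]
  ring

theorem hasDerivAt_green (h : SourceBound p l C M) (hp1 : 1 ≤ p) (hp : p < 3 / 2) (hl : 0 < l)
    (hl2 : l ≤ 2) {x : ℝ} (hx : 0 < x) : HasDerivAt (green M) (greenDeriv M x) x := by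
  have h1 := hasDerivAt_ofReal (𝕜 := 𝕜) (hasDerivAt_neg x).exp
  have h2 := hasDerivAt_ofReal (𝕜 := 𝕜) (Real.hasDerivAt_sinh x)
  refine ((h1.fun_mul (h.hasDerivAt_greenInner hp hl hl2 hx)).fun_add
    (h2.fun_mul (h.hasDerivAt_greenOuter hp1 hp hl hx))).congr_deriv ?_
  rw [greenDeriv]
  push_cast
  ring

theorem hasDerivAt_greenDeriv (h : SourceBound p l C M) (hp1 : 1 ≤ p) (hp : p < 3 / 2) (hl : 0 < l)
    (hl2 : l ≤ 2) {x : ℝ} (hx : 0 < x) : HasDerivAt (greenDeriv M) (green M x - M x) x := by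
  have h1 := hasDerivAt_ofReal (𝕜 := 𝕜) (hasDerivAt_neg x).exp
  have h2 := hasDerivAt_ofReal (𝕜 := 𝕜) (Real.hasDerivAt_cosh x)
  refine (((h1.fun_mul (h.hasDerivAt_greenInner hp hl hl2 hx)).fun_neg).fun_add
    (h2.fun_mul (h.hasDerivAt_greenOuter hp1 hp hl hx))).congr_deriv ?_
  have h3 : (Real.exp (-x) : 𝕜) * ((Real.sinh x : 𝕜) + (Real.cosh x : 𝕜)) = 1 := by
    rw [← RCLike.ofReal_add, Real.sinh_add_cosh, ← RCLike.ofReal_mul, ← Real.exp_add]; simp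
  rw [green]
  push_cast at h3 ⊢
  linear_combination (-M x) * h3

theorem halfH1_green (h : SourceBound p l C M) (hp1 : 1 ≤ p) (hp : p < 3 / 2) (hl : 0 < l)
    (hl2 : l ≤ 2) : HalfH1 (green M) (greenDeriv M) := by
  have c1 : ContinuousOn (green M) (Ioi 0) := fun x hx =>
    (h.hasDerivAt_green hp1 hp hl hl2 hx).continuousAt.continuousWithinAt
  have c2 : ContinuousOn (greenDeriv M) (Ioi 0) := fun x hx =>
    (h.hasDerivAt_greenDeriv hp1 hp hl hl2 hx).continuousAt.continuousWithinAt
  exact ⟨IsPrimitiveOn.of_hasDerivAt (fun x hx => h.hasDerivAt_green hp1 hp hl hl2 hx) c2,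
    memLp_of_norm_le_weight (by norm_num) (by linarith) c1
      (fun x hx => h.norm_green_le hp1 hp hl hl2 hx),
    memLp_of_norm_le_weight (by linarith) (by linarith) c2
      (fun x hx => h.norm_greenDeriv_le hp1 hp hl hl2 hx),
    tendsto_zero_of_norm_le_weight (by norm_num) (fun x hx => h.norm_green_le hp1 hp hl hl2 hx)⟩

theorem halfH1_speed_mul_greenDeriv (h : SourceBound p l C M) (hp1 : 1 ≤ p) (hp : p < 3 / 2)
    (hl : 0 < l) (hl2 : l ≤ 2) : HalfH1 (fun x => (speed x : 𝕜) * greenDeriv M x)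
      (fun x => 2 * (Real.exp (-2 * x) : 𝕜) * greenDeriv M x +
        (speed x : 𝕜) * (green M x - M x)) := by
  have c0 : Continuous fun x => (speed x : 𝕜) := RCLike.continuous_ofReal.comp continuous_speed
  have c3 : Continuous fun x => (Real.exp (-2 * x) : 𝕜) := RCLike.continuous_ofReal.comp (by fun_prop)
  have c1 : ContinuousOn (green M) (Ioi 0) := fun x hx =>
    (h.hasDerivAt_green hp1 hp hl hl2 hx).continuousAt.continuousWithinAt
  have c2 : ContinuousOn (greenDeriv M) (Ioi 0) := fun x hx =>
    (h.hasDerivAt_greenDeriv hp1 hp hl hl2 hx).continuousAt.continuousWithinAt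
  have hb : ∀ x, 0 < x → ‖(speed x : 𝕜) * greenDeriv M x‖ ≤
      C * greenConst p l * weight (-(p / 2 - 1 / 4) + 1) (l / 2) x := fun x hx => by
    rw [norm_mul, RCLike.norm_ofReal, abs_of_pos (speed_pos hx), ← speed_mul_weight hx,
      mul_left_comm]
    exact mul_le_mul_of_nonneg_left (h.norm_greenDeriv_le hp1 hp hl hl2 hx) (speed_pos hx).le
  have hG := h.halfH1_green hp1 hp hl hl2
  refine ⟨IsPrimitiveOn.of_hasDerivAt (fun x hx => ?_) ?_,
    memLp_of_norm_le_weight (by linarith) (by linarith) (c0.continuousOn.mul c2) hb, ?_,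
    tendsto_zero_of_norm_le_weight (by linarith) hb⟩
  · have h1 := hasDerivAt_ofReal (𝕜 := 𝕜) (hasDerivAt_speed x)
    refine (h1.fun_mul (h.hasDerivAt_greenDeriv hp1 hp hl hl2 hx)).congr_deriv ?_
    push_cast; ring
  · exact ((continuousOn_const.mul c3.continuousOn).mul c2).add
      (c0.continuousOn.mul (c1.sub h.cont))
  · have l1 : MemLp (fun x => 2 * (Real.exp (-2 * x) : 𝕜) * greenDeriv M x) 2
        (volume.restrict (Ioi 0)) := by
      refine memLp_of_norm_le_weight (p := -(p / 2 - 1 / 4)) (l := l / 2)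
        (C := 2 * (C * greenConst p l)) (by linarith) (by linarith)
        ((continuousOn_const.mul c3.continuousOn).mul c2) fun x hx => ?_
      rw [norm_mul, norm_mul, RCLike.norm_two, RCLike.norm_ofReal, abs_of_pos (Real.exp_pos _),
        mul_assoc, mul_assoc]
      refine mul_le_mul_of_nonneg_left (le_trans ?_ (h.norm_greenDeriv_le hp1 hp hl hl2 hx))
        two_pos.le
      exact mul_le_of_le_one_left (norm_nonneg _) (by rw [Real.exp_le_one_iff]; linarith)
    have l2 : MemLp (fun x => (speed x : 𝕜) * green M x) 2 (volume.restrict (Ioi 0)) := by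
      refine memLp_of_norm_le_weight (p := 1 / 4) (l := l / 2) (C := C * greenConst p l) (by norm_num)
        (by linarith) (c0.continuousOn.mul c1) fun x hx => ?_
      rw [norm_mul, RCLike.norm_ofReal, abs_of_pos (speed_pos hx)]
      exact (mul_le_of_le_one_left (norm_nonneg _) (speed_lt_one x).le).trans
        (h.norm_green_le hp1 hp hl hl2 hx)
    have l3 : MemLp (fun x => (speed x : 𝕜) * M x) 2 (volume.restrict (Ioi 0)) := by
      refine memLp_of_norm_le_weight (p := -p + 1) (l := l) (C := C) (by linarith) hl
        (c0.continuousOn.mul h.cont) fun x hx => ?_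
      rw [norm_mul, RCLike.norm_ofReal, abs_of_pos (speed_pos hx), ← speed_mul_weight hx,
        mul_left_comm]
      exact mul_le_mul_of_nonneg_left (h.bound x hx) (speed_pos hx).le
    refine (l1.add (l2.sub l3)).ae_eq (Eventually.of_forall fun x => ?_)
    simp only [Pi.add_apply, Pi.sub_apply]; ring

end SourceBound

/-- Boundedness of the Green operator. -/
theorem exists_h1Norm_green_le {p l : ℝ} (hp1 : 1 ≤ p) (hp : p < 3 / 2) (hl : 0 < l) (hl2 : l ≤ 2) :
    ∃ K : ℝ, ∀ (C : ℝ) (M : ℝ → 𝕜), SourceBound p l C M →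
      h1Norm (rightPart (green M)) ≤ K * C := by
  set A := (∫ x in Ioi 0, weight (1 / 4) (l / 2) x ^ 2) +
    ∫ x in Ioi 0, weight (-(p / 2 - 1 / 4)) (l / 2) x ^ 2 with hA
  have hA0 : 0 ≤ A := by positivity
  have hg0 : 0 ≤ greenConst p l := add_nonneg (weightMass_nonneg _ _) (weightMass_nonneg _ _)
  refine ⟨greenConst p l * Real.sqrt A, fun C M h => ?_⟩
  have hG := h.halfH1_green hp1 hp hl hl2
  have hC := h.nonneg
  refine le_of_sq_le_sq (b := greenConst p l * Real.sqrt A * C) ?_ (by positivity)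
  rw [hG.h1Norm_rightPart_sq, mul_pow, mul_pow, Real.sq_sqrt hA0]
  have key : ∀ {f : ℝ → 𝕜} {q : ℝ}, -(1 / 2) < q →
      (∀ x, 0 < x → ‖f x‖ ≤ C * greenConst p l * weight q (l / 2) x) →
      MemLp f 2 (volume.restrict (Ioi 0)) →
      ∫ x in Ioi 0, ‖f x‖ ^ 2 ≤ (C * greenConst p l) ^ 2 * ∫ x in Ioi 0, weight q (l / 2) x ^ 2 := by
    intro f q hq hf hL
    rw [← integral_const_mul]
    refine setIntegral_mono_on hL.norm.integrable_sq
      ((memLp_weight hq (by linarith)).integrable_sq.const_mul _) measurableSet_Ioi fun x hx => ?_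
    rw [← mul_pow]
    exact pow_le_pow_left₀ (norm_nonneg _) (hf x hx) 2
  have k1 := key (by norm_num) (fun x hx => h.norm_green_le hp1 hp hl hl2 hx) hG.memLp
  have k2 := key (by linarith) (fun x hx => h.norm_greenDeriv_le hp1 hp hl hl2 hx) hG.memLp_deriv
  refine (add_le_add k1 k2).trans (le_of_eq ?_)
  rw [← mul_add, ← hA]; ring

theorem deriv_rightPart_of_pos {f : ℝ → 𝕜} {f' : 𝕜} {x : ℝ} (hx : 0 < x) (hf : HasDerivAt f f' x) :
    HasDerivAt (rightPart f) f' x := by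
  refine hf.congr_of_eventuallyEq ?_
  filter_upwards [Ioi_mem_nhds hx] with y hy using rightPart_of_pos f hy

theorem deriv_rightPart_of_neg (f : ℝ → 𝕜) {x : ℝ} (hx : x < 0) : deriv (rightPart f) x = 0 := by
  have : HasDerivAt (rightPart f) 0 x := by
    refine (hasDerivAt_const x (0 : 𝕜)).congr_of_eventuallyEq ?_
    filter_upwards [Iio_mem_nhds hx] with y hy using rightPart_of_nonpos f (le_of_lt hy)
  exact this.deriv

theorem flux_rightPart {f f' : ℝ → 𝕜} (hf : ∀ x, 0 < x → HasDerivAt f (f' x) x) :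
    flux (rightPart f) = rightPart fun x => (speed x : 𝕜) * f' x := by
  ext x
  rcases lt_trichotomy x 0 with h | rfl | h
  · rw [flux, deriv_rightPart_of_neg f h, rightPart_of_nonpos _ h.le, smul_zero]
  · rw [flux, peakon_zero, rightPart_of_nonpos _ le_rfl]; simp
  · rw [flux, (deriv_rightPart_of_pos h (hf x h)).deriv, rightPart_of_pos _ h,
      speed_eq_peakon h.le, RCLike.real_smul_eq_coe_mul]

theorem memDom_rightPart {f f' g' : ℝ → 𝕜} (hf : HalfH1 f f')
    (hd : ∀ x, 0 < x → HasDerivAt f (f' x) x) (hg : HalfH1 (fun x => (speed x : 𝕜) * f' x) g') :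
    MemDom (rightPart f) := by
  refine ⟨hf.memH1Zero, ?_⟩
  have h := hg.memH1Zero
  rw [← flux_rightPart hd] at h
  exact h

theorem linOp_rightPart_of_nonpos {f : ℝ → 𝕜} (hf : MemLp (rightPart f) 2 volume) (b : ℝ) {x : ℝ}
    (hx : x ≤ 0) : linOp b (rightPart f) x = 0 := by
  rcases hx.lt_or_eq with h | rfl
  · have hf' : MemLp (fun x => rightPart f (-x)) 2 volume :=
      hf.comp_measurePreserving (Measure.measurePreserving_neg volume)
    have h1 := linOp_comp_neg hf b (-x)
    rw [neg_neg] at h1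
    have ht : ∀ y, 0 ≤ y → tail (fun x => rightPart f (-x)) y = 0 := fun y hy => by
      rw [tail]
      refine setIntegral_eq_zero_of_forall_eq_zero fun z hz => ?_
      have hz : y < z := hz
      rw [rightPart_of_nonpos f (by linarith), mul_zero]
    rw [linOp_of_pos hf' b (neg_pos.2 h), deriv_comp_neg, neg_neg, deriv_rightPart_of_neg f h,
      rightPart_of_nonpos f h.le, ht 0 le_rfl, ht (-x) (by linarith)] at h1
    simpa using h1.symm
  · exact linOp_zero hf b

/-- A function with `D'' = D` on the half-line that vanishes at `0` and at `∞` is zero. -/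
theorem eq_zero_of_second_deriv_eq {D D1 : ℝ → 𝕜} (h1 : ∀ x, 0 < x → HasDerivAt D (D1 x) x)
    (h2 : ∀ x, 0 < x → HasDerivAt D1 (D x) x) (h0 : Tendsto D (𝓝[>] 0) (𝓝 0))
    (hinf : Tendsto D atTop (𝓝 0)) : ∀ x, 0 < x → D x = 0 := by
  have hexp : ∀ x, HasDerivAt (fun x => (Real.exp x : 𝕜)) (Real.exp x : 𝕜) x := fun x =>
    hasDerivAt_ofReal (Real.hasDerivAt_exp x)
  have hexpn : ∀ x, HasDerivAt (fun x => (Real.exp (-x) : 𝕜)) (-(Real.exp (-x) : 𝕜)) x := fun x => by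
    simpa using hasDerivAt_ofReal (𝕜 := 𝕜) ((hasDerivAt_neg x).exp)
  have konst : ∀ k : ℝ → 𝕜, (∀ x, 0 < x → HasDerivAt k 0 x) → ∀ x, 0 < x → k x = k 1 := by
    intro k hk x hx
    have hp : IsPrimitiveOn k (fun _ => 0) (Ioi 0) :=
      IsPrimitiveOn.of_hasDerivAt (fun x hx => hk x hx) continuousOn_const
    have := (hp 1 (mem_Ioi.2 one_pos) x hx).2
    simp only [intervalIntegral.integral_zero] at this
    exact (sub_eq_zero.1 this.symm)
  have k1 := konst (fun x => (Real.exp x : 𝕜) * (D1 x - D x)) fun x hx => by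
    refine ((hexp x).fun_mul ((h2 x hx).fun_sub (h1 x hx))).congr_deriv ?_
    ring
  have k2 := konst (fun x => (Real.exp (-x) : 𝕜) * (D1 x + D x)) fun x hx => by
    refine ((hexpn x).fun_mul ((h2 x hx).fun_add (h1 x hx))).congr_deriv ?_
    ring
  set c := (Real.exp 1 : 𝕜) * (D1 1 - D 1)
  set c' := (Real.exp (-1) : 𝕜) * (D1 1 + D 1)
  have hD : ∀ x, 0 < x → 2 * D x = (Real.exp x : 𝕜) * c' - (Real.exp (-x) : 𝕜) * c := fun x hx => by
    have e : (Real.exp x : 𝕜) * (Real.exp (-x) : 𝕜) = 1 := by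
      rw [← RCLike.ofReal_mul, ← Real.exp_add]; simp
    have h3 := k1 x hx
    have h4 := k2 x hx
    rw [← h3, ← h4]
    linear_combination (-2 * D x) * e
  have hc' : c' = 0 := by
    have t1 : Tendsto (fun x : ℝ => (Real.exp (-x) : 𝕜)) atTop (𝓝 0) := by
      have := (RCLike.continuous_ofReal (K := 𝕜)).continuousAt.tendsto.comp
        Real.tendsto_exp_neg_atTop_nhds_zero
      simpa [Function.comp_def] using this
    have t : Tendsto (fun x : ℝ => (Real.exp (-x) : 𝕜) * (2 * D x) +
        (Real.exp (-x) : 𝕜) * (Real.exp (-x) : 𝕜) * c) atTop (𝓝 0) := by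
      simpa using (t1.mul (hinf.const_mul 2)).add ((t1.mul t1).mul_const c)
    refine tendsto_nhds_unique (tendsto_const_nhds.congr' ?_) t
    filter_upwards [eventually_gt_atTop 0] with x hx
    have e : (Real.exp x : 𝕜) * (Real.exp (-x) : 𝕜) = 1 := by
      rw [← RCLike.ofReal_mul, ← Real.exp_add]; simp
    rw [hD x hx]
    linear_combination (-c') * e
  have hc : c = 0 := by
    have t : Tendsto (fun x : ℝ => -((Real.exp x : 𝕜) * (2 * D x))) (𝓝[>] 0) (𝓝 0) := by
      have t1 : Tendsto (fun x : ℝ => (Real.exp x : 𝕜)) (𝓝[>] 0) (𝓝 ((Real.exp 0 : ℝ) : 𝕜)) :=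
        (((RCLike.continuous_ofReal (K := 𝕜)).comp Real.continuous_exp).tendsto 0).mono_left
          nhdsWithin_le_nhds
      simpa using (t1.mul (h0.const_mul 2)).neg
    refine tendsto_nhds_unique (tendsto_const_nhds.congr' ?_) t
    filter_upwards [self_mem_nhdsWithin] with x hx
    have e : (Real.exp x : 𝕜) * (Real.exp (-x) : 𝕜) = 1 := by
      rw [← RCLike.ofReal_mul, ← Real.exp_add]; simp
    rw [hD x hx, hc']
    linear_combination (-c) * e
  intro x hx
  have := hD x hx
  rw [hc, hc', mul_zero, mul_zero, sub_zero] at this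
  exact (mul_eq_zero.1 this).resolve_left two_ne_zero

/-- On the half-line, the linearized operator acts on `M = v - v''` as a transport operator. -/
theorem linOp_green {p l C₁ C₂ b : ℝ} {M M' : ℝ → 𝕜} (hp1 : 1 ≤ p) (hp : p < 3 / 2) (hl : 0 < l)
    (hl2 : l ≤ 2) (hM : SourceBound p l C₁ M) (hd : ∀ x, 0 < x → HasDerivAt M (M' x) x)
    (hN : SourceBound p l C₂ fun x => (speed x : 𝕜) * M' x + b * (Real.exp (-2 * x) : 𝕜) * M x) :
    MemDom (rightPart (green M)) ∧ linOp b (rightPart (green M)) =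
      rightPart (green fun x => (speed x : 𝕜) * M' x + b * (Real.exp (-2 * x) : 𝕜) * M x) := by
  set N : ℝ → 𝕜 := fun x => (speed x : 𝕜) * M' x + b * (Real.exp (-2 * x) : 𝕜) * M x with hNdef
  have hG := hM.halfH1_green hp1 hp hl hl2
  have hGd := fun x (hx : 0 < x) => hM.hasDerivAt_green hp1 hp hl hl2 hx
  have hdom : MemDom (rightPart (green M)) :=
    memDom_rightPart hG hGd (hM.halfH1_speed_mul_greenDeriv hp1 hp hl hl2)
  refine ⟨hdom, ?_⟩
  set v := rightPart (green M) with hv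
  have hvd := fun x (hx : 0 < x) => deriv_rightPart_of_pos hx (hGd x hx)
  have hflux := flux_rightPart hGd
  set E := tail v
  have hE : ∀ x, HasDerivAt E (-((Real.exp (-3 * x) : 𝕜) * v x)) x := hasDerivAt_tail hdom.memH1
  set F : ℝ → 𝕜 := fun x => (speed x : 𝕜) * greenDeriv M x +
    ((b - 4 : ℝ) : 𝕜) * ((Real.exp (-2 * x) : 𝕜) * green M x) +
    ((4 * (b - 3) : ℝ) : 𝕜) * ((Real.exp (-x) : 𝕜) * E 0 - (Real.exp x : 𝕜) * E x) with hF
  have hFv : ∀ x, 0 < x → linOp b v x = F x := fun x hx => by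
    rw [linOp_eq_flux hdom.memH1.memLp b hx, hflux, rightPart_of_pos _ hx, hv, rightPart_of_pos _ hx,
      hF]
    push_cast
    ring
  set F1 : ℝ → 𝕜 := fun x => (2 * (Real.exp (-2 * x) : 𝕜) * greenDeriv M x +
      (speed x : 𝕜) * (green M x - M x)) +
    ((b - 4 : ℝ) : 𝕜) * (-2 * (Real.exp (-2 * x) : 𝕜) * green M x +
      (Real.exp (-2 * x) : 𝕜) * greenDeriv M x) +
    ((4 * (b - 3) : ℝ) : 𝕜) * (-((Real.exp (-x) : 𝕜) * E 0) - (Real.exp x : 𝕜) * E x +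
      (Real.exp (-2 * x) : 𝕜) * green M x) with hF1
  have e3 : ∀ x : ℝ, (Real.exp x : 𝕜) * (Real.exp (-3 * x) : 𝕜) = (Real.exp (-2 * x) : 𝕜) := fun x => by
    rw [← RCLike.ofReal_mul, ← Real.exp_add]; congr 2; ring
  have hexp : ∀ x, HasDerivAt (fun x => (Real.exp x : 𝕜)) (Real.exp x : 𝕜) x := fun x =>
    hasDerivAt_ofReal (Real.hasDerivAt_exp x)
  have hexpn : ∀ x, HasDerivAt (fun x => (Real.exp (-x) : 𝕜)) (-(Real.exp (-x) : 𝕜)) x := fun x => by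
    simpa using hasDerivAt_ofReal (𝕜 := 𝕜) ((hasDerivAt_neg x).exp)
  have hexp2 : ∀ x, HasDerivAt (fun x => (Real.exp (-2 * x) : 𝕜)) (-2 * (Real.exp (-2 * x) : 𝕜)) x :=
    fun x => (hasDerivAt_ofReal (hasDerivAt_exp_const_mul (-2) x)).congr_deriv (by push_cast; ring)
  have hsp : ∀ x, HasDerivAt (fun x => (speed x : 𝕜)) (2 * (Real.exp (-2 * x) : 𝕜)) x :=
    fun x => (hasDerivAt_ofReal (hasDerivAt_speed x)).congr_deriv (by push_cast; ring)
  have hG2 := fun x (hx : 0 < x) => hM.hasDerivAt_greenDeriv hp1 hp hl hl2 hx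
  have dF : ∀ x, 0 < x → HasDerivAt F (F1 x) x := fun x hx => by
    refine ((((hsp x).fun_mul (hG2 x hx)).fun_add
      (((hexp2 x).fun_mul (hGd x hx)).const_mul ((b - 4 : ℝ) : 𝕜))).fun_add
      ((((hexpn x).mul_const (E 0)).fun_sub ((hexp x).fun_mul (hE x))).const_mul
        ((4 * (b - 3) : ℝ) : 𝕜))).congr_deriv ?_
    have e := e3 x
    rw [hv, rightPart_of_pos _ hx]
    simp only [hF1]
    linear_combination (((4 * (b - 3) : ℝ) : 𝕜) * green M x) * e
  have dF1 : ∀ x, 0 < x → HasDerivAt F1 (F x - N x) x := fun x hx => by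
    refine (((((hexp2 x).const_mul 2).fun_mul (hG2 x hx)).fun_add
      ((hsp x).fun_mul ((hGd x hx).fun_sub (hd x hx)))).fun_add
      (((((hexp2 x).const_mul (-2)).fun_mul (hGd x hx)).fun_add
        ((hexp2 x).fun_mul (hG2 x hx))).const_mul ((b - 4 : ℝ) : 𝕜)) |>.fun_add
      ((((((hexpn x).mul_const (E 0)).fun_neg).fun_sub ((hexp x).fun_mul (hE x))).fun_add
        ((hexp2 x).fun_mul (hGd x hx))).const_mul ((4 * (b - 3) : ℝ) : 𝕜))).congr_deriv ?_
    have e := e3 x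
    rw [hv, rightPart_of_pos _ hx]
    simp only [hF, hNdef, speed]
    push_cast at e ⊢
    linear_combination (4 * ((b : 𝕜) - 3) * green M x) * e
  have hHN := hN.halfH1_green hp1 hp hl hl2
  have hHF := halfH1_linOp hdom b
  have tF0 : Tendsto F (𝓝[>] 0) (𝓝 0) :=
    hHF.tendsto.congr' (eventually_nhdsWithin_of_forall fun x hx => hFv x hx)
  have tF1 : Tendsto F atTop (𝓝 0) :=
    hHF.tendsto_atTop.congr' ((eventually_gt_atTop 0).mono fun x hx => hFv x hx)
  have hD := eq_zero_of_second_deriv_eq (D := fun x => F x - green N x)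
    (D1 := fun x => F1 x - greenDeriv N x)
    (fun x hx => (dF x hx).fun_sub (hN.hasDerivAt_green hp1 hp hl hl2 hx))
    (fun x hx => ((dF1 x hx).fun_sub (hN.hasDerivAt_greenDeriv hp1 hp hl hl2 hx)).congr_deriv
      (by ring))
    (by simpa using tF0.sub hHN.tendsto) (by simpa using tF1.sub hHN.tendsto_atTop)
  ext x
  rcases le_or_gt x 0 with hx | hx
  · rw [linOp_rightPart_of_nonpos hdom.memH1.memLp b hx, rightPart_of_nonpos _ hx]
  · rw [hFv x hx, rightPart_of_pos _ hx]
    exact sub_eq_zero.1 (hD x hx)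

/-! ### Eigenfunctions -/

theorem green_congr {M N : ℝ → 𝕜} (h : EqOn M N (Ioi 0)) {x : ℝ} (hx : 0 < x) :
    green M x = green N x := by
  have h1 : greenInner M x = greenInner N x := by
    rw [greenInner, greenInner, intervalIntegral.integral_of_le hx.le,
      intervalIntegral.integral_of_le hx.le]
    exact setIntegral_congr_fun measurableSet_Ioc fun z hz => by rw [h hz.1]
  have h2 : greenOuter M x = greenOuter N x :=
    setIntegral_congr_fun measurableSet_Ioi fun z hz => by
      rw [h (lt_trans hx hz)]
  rw [green, green, h1, h2]

theorem rightPart_congr {f g : ℝ → 𝕜} (h : ∀ x, 0 < x → f x = g x) : rightPart f = rightPart g := by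
  ext x
  rcases le_or_gt x 0 with hx | hx
  · rw [rightPart_of_nonpos _ hx, rightPart_of_nonpos _ hx]
  · rw [rightPart_of_pos _ hx, rightPart_of_pos _ hx, h x hx]

theorem green_const_mul (c : 𝕜) (M : ℝ → 𝕜) (x : ℝ) :
    green (fun x => c * M x) x = c * green M x := by
  have h1 : greenInner (fun x => c * M x) x = c * greenInner M x := by
    rw [greenInner, greenInner, ← intervalIntegral.integral_const_mul]
    congr 1; ext z; ring
  have h2 : greenOuter (fun x => c * M x) x = c * greenOuter M x := by
    rw [greenOuter, greenOuter, ← integral_const_mul]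
    congr 1; ext z; ring
  rw [green, green, h1, h2]; ring

namespace SourceBound

variable {p l C D : ℝ} {M N : ℝ → 𝕜}

theorem congr (h : SourceBound p l C M) (hMN : EqOn M N (Ioi 0)) : SourceBound p l C N :=
  ⟨h.cont.congr fun x hx => (hMN hx).symm, fun x hx => by rw [← hMN hx]; exact h.bound x hx⟩

theorem const_mul (c : 𝕜) (h : SourceBound p l C M) :
    SourceBound p l (‖c‖ * C) (fun x => c * M x) :=
  ⟨continuousOn_const.mul h.cont, fun x hx => by
    rw [norm_mul, mul_assoc]; exact mul_le_mul_of_nonneg_left (h.bound x hx) (norm_nonneg _)⟩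

theorem green_sub (hM : SourceBound p l C M) (hN : SourceBound p l D N) (hp1 : 1 ≤ p)
    (hp : p < 3 / 2) (hl : 0 < l) (hl2 : l ≤ 2) {x : ℝ} (hx : 0 < x) :
    green (fun x => M x - N x) x = green M x - green N x := by
  have h1 : greenInner (fun x => M x - N x) x = greenInner M x - greenInner N x := by
    rw [greenInner, greenInner, greenInner, ← intervalIntegral.integral_sub
      (hM.intervalIntegrable_sinh hp hl hl2 hx) (hN.intervalIntegrable_sinh hp hl hl2 hx)]
    congr 1; ext z; ring
  have h2 : greenOuter (fun x => M x - N x) x = greenOuter M x - greenOuter N x := by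
    rw [greenOuter, greenOuter, greenOuter, ← integral_sub (hM.integrableOn_exp hp1 hp hl hx)
      (hN.integrableOn_exp hp1 hp hl hx)]
    congr 1; ext z; ring
  rw [green, green, green, h1, h2]; ring

theorem eq_zero_of_green (h : SourceBound p l C M) (hp1 : 1 ≤ p) (hp : p < 3 / 2) (hl : 0 < l)
    (hl2 : l ≤ 2) (h0 : ∀ x, 0 < x → green M x = 0) {x : ℝ} (hx : 0 < x) : M x = 0 := by
  have h1 : ∀ x, 0 < x → greenDeriv M x = 0 := fun x hx => by
    refine (h.hasDerivAt_green hp1 hp hl hl2 hx).unique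
      ((hasDerivAt_const x (0 : 𝕜)).congr_of_eventuallyEq ?_)
    filter_upwards [Ioi_mem_nhds hx] with y hy using h0 y hy
  have h2 := (h.hasDerivAt_greenDeriv hp1 hp hl hl2 hx).unique
    ((hasDerivAt_const x (0 : 𝕜)).congr_of_eventuallyEq (by
      filter_upwards [Ioi_mem_nhds hx] with y hy using h1 y hy))
  rw [h0 x hx, zero_sub, neg_eq_zero] at h2
  exact h2

end SourceBound

theorem exists_isEigenfunction {b : ℝ} {μ : 𝕜} (h0 : 0 < RCLike.re μ) (h1 : RCLike.re μ < 3 - b) :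
    ∃ w : ℝ → 𝕜, IsEigenfunction b μ w := by
  set q : 𝕜 := -((b : 𝕜) + μ) / 2 with hq
  have hre : RCLike.re q = -((b + RCLike.re μ) / 2) := by
    have : q = (((-1 / 2 : ℝ)) : 𝕜) * ((b : 𝕜) + μ) := by rw [hq]; push_cast; ring
    rw [this, RCLike.re_ofReal_mul, map_add, RCLike.ofReal_re]; ring
  set M := weightPow q μ with hMdef
  set p := max ((b + RCLike.re μ) / 2) 1
  set l := min (RCLike.re μ) 2
  have hp1 : 1 ≤ p := le_max_right _ _
  have hp : p < 3 / 2 := max_lt (by linarith) (by norm_num)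
  have hl : 0 < l := lt_min h0 two_pos
  have hl2 : l ≤ 2 := min_le_right _ _
  have hd := fun x (hx : 0 < x) => hasDerivAt_weightPow q μ hx
  have hM : SourceBound p l 1 M := by
    refine ⟨fun x hx => (hd x hx).continuousAt.continuousWithinAt, fun x hx => ?_⟩
    rw [hMdef, norm_weightPow q μ hx, one_mul]
    exact weight_le_weight hx (by rw [hre]; exact neg_le_neg (le_max_left _ _)) (min_le_left _ _)
  set M' : ℝ → 𝕜 := fun x => (2 * q * (Real.exp (-2 * x) : 𝕜) / (speed x : 𝕜) - μ) * M x with hM'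
  have hN : EqOn (fun x => -μ * M x)
      (fun x => (speed x : 𝕜) * M' x + b * (Real.exp (-2 * x) : 𝕜) * M x) (Ioi 0) := fun x hx => by
    have hs := speed_cast_ne (𝕜 := 𝕜) hx
    have hs1 : (speed x : 𝕜) = 1 - (Real.exp (-2 * x) : 𝕜) := by rw [speed]; push_cast; rfl
    simp only [hM']
    rw [sub_mul, mul_sub, div_mul_eq_mul_div, mul_div_assoc', mul_div_cancel_left₀ _ hs, hs1, hq]
    ring
  have hNb := (hM.const_mul (-μ)).congr hN
  obtain ⟨hdom, hL⟩ := linOp_green hp1 hp hl hl2 hM hd hNb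
  set v := rightPart (green M) with hv
  have hLv : linOp b v = fun x => -μ * v x := by
    rw [hL]
    ext x
    rcases le_or_gt x 0 with hx | hx
    · rw [hv, rightPart_of_nonpos _ hx, rightPart_of_nonpos _ hx, mul_zero]
    · rw [hv, rightPart_of_pos _ hx, rightPart_of_pos _ hx, ← green_congr hN hx, green_const_mul]
  have hne : v ≠ 0 := fun h => by
    have := hM.eq_zero_of_green hp1 hp hl hl2 (fun x hx => by
      rw [← rightPart_of_pos (green M) hx, ← hv, h]; rfl) one_pos
    have h2 := norm_weightPow q μ one_pos
    rw [← hMdef, this, norm_zero] at h2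
    exact (weight_pos one_pos).ne h2
  refine ⟨fun x => v (-x), hdom.comp_neg, fun h => hne ?_, ?_⟩
  · ext x
    simpa using congrFun h (-x)
  · ext x
    rw [linOp_comp_neg hdom.memH1.memLp, hLv]
    ring

theorem IsEigenfunction.isSolution {b : ℝ} {μ : 𝕜} {w : ℝ → 𝕜} (h : IsEigenfunction b μ w) :
    IsSolution b (fun t ξ => NormedSpace.exp ((t : 𝕜) * μ) * w ξ) := by
  obtain ⟨hd, -, hL⟩ := h
  set c : ℝ → 𝕜 := fun t => NormedSpace.exp ((t : 𝕜) * μ) with hc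
  have hcd : ∀ t, HasDerivAt c (μ * c t) t := fun t => by
    have := hasDerivAt_exp_comp ((hasDerivAt_ofReal (𝕜 := 𝕜) (hasDerivAt_id t)).mul_const μ)
    simpa using this
  have hct : ∀ (f : ℝ → 𝕜) (a : 𝕜) (t : ℝ),
      Tendsto (fun s => h1Norm fun ξ => a * c s * f ξ - a * c t * f ξ) (𝓝 t) (𝓝 0) := by
    intro f a t
    have h1 : Tendsto (fun s => ‖a * c s - a * c t‖ * h1Norm f) (𝓝 t) (𝓝 0) := by
      have := ((((hcd t).continuousAt.const_mul a).sub_const (a * c t)).norm.mul_const (h1Norm f))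
      simpa [ContinuousAt] using this
    refine h1.congr fun s => ?_
    rw [← h1Norm_const_mul]
    congr 1; ext ξ; ring
  have hLc : ∀ t, linOp b (fun ξ => c t * w ξ) = fun ξ => μ * c t * w ξ := fun t => by
    rw [linOp_const_mul _ hd.memH1.memLp, hL]; ext ξ; ring
  change IsSolution b fun t ξ => c t * w ξ
  refine .of_linOp (fun t => hd.const_mul _) (fun t => ?_) (fun t => ?_) fun t => ?_
  · simpa using hct w 1 t
  · simp only [hLc]
    exact hct w μ t
  · have h1 : Tendsto (fun h : ℝ => ‖h⁻¹ • (c (t + h) - c t) - μ * c t‖ * h1Norm w) (𝓝[≠] 0)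
        (𝓝 0) := by
      have := (((hasDerivAt_iff_tendsto_slope_zero.1 (hcd t)).sub_const (μ * c t)).norm.mul_const
        (h1Norm w))
      simpa using this
    refine h1.congr fun s => ?_
    rw [← h1Norm_const_mul]
    congr 1; ext ξ
    simp only [hLc, RCLike.real_smul_eq_coe_mul]
    ring

theorem h1Norm_exp_mul (μ : 𝕜) (w : ℝ → 𝕜) (t : ℝ) :
    h1Norm (fun ξ => NormedSpace.exp ((t : 𝕜) * μ) * w ξ) =
      Real.exp (RCLike.re μ * t) * h1Norm w := by
  rw [h1Norm_const_mul, norm_exp_eq, RCLike.re_ofReal_mul, mul_comm t]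

/-! ### Adjoint eigenfunctions -/

theorem isAdjointEigenfunction_rightPart {b : ℝ} {μ q : 𝕜} (hq : q = ((b - 2 : ℝ) - μ) / 2)
    (h0 : 0 < RCLike.re μ) (h1 : RCLike.re μ < b - 3) :
    IsAdjointEigenfunction b μ (rightPart (weightPow q μ)) := by
  have hre : RCLike.re q = (b - 2 - RCLike.re μ) / 2 := by
    have : q = (((1 / 2 : ℝ)) : 𝕜) * ((b - 2 : ℝ) - μ) := by rw [hq]; push_cast; ring
    rw [this, RCLike.re_ofReal_mul, map_sub, RCLike.ofReal_re]; ring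
  have hw := (halfH1_weightPow (q := q) (μ := μ) (by rw [hre]; linarith) h0).1
  have hcq : starRingEnd 𝕜 q = ((b - 2 : ℝ) - starRingEnd 𝕜 μ) / 2 := by
    rw [hq, map_div₀, map_sub, RCLike.conj_ofReal, map_ofNat]
  refine ⟨hw.memH1Zero, fun h => ?_, fun v hv => ?_⟩
  · have h2 := norm_weightPow q μ one_pos
    rw [← rightPart_of_pos (weightPow q μ) one_pos, h, Pi.zero_apply, norm_zero] at h2
    exact (weight_pos one_pos).ne h2
  · rw [h1Inner_const_mul_left, hw.h1Inner_rightPart hv.memH1,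
      hw.h1Inner_rightPart (hv.memH1Zero_linOp b).1]
    have e : ∀ x, starRingEnd 𝕜 ((2 * q * (Real.exp (-2 * x) : 𝕜) / (speed x : 𝕜) - μ) *
        weightPow q μ x) = (2 * starRingEnd 𝕜 q * (Real.exp (-2 * x) : 𝕜) / (speed x : 𝕜) -
          starRingEnd 𝕜 μ) * weightPow (starRingEnd 𝕜 q) (starRingEnd 𝕜 μ) x := fun x => by
      rw [map_mul, conj_weightPow]
      simp only [map_sub, map_div₀, map_mul, RCLike.conj_ofReal, map_ofNat]
    simp only [e, conj_weightPow]
    exact adjoint_identity hcq (by rwa [RCLike.conj_re]) (by rwa [RCLike.conj_re]) hv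

theorem IsAdjointEigenfunction.h1Inner_eq {b : ℝ} {μ : 𝕜} {w : ℝ → 𝕜}
    (hw : IsAdjointEigenfunction b μ w) {u : ℝ → ℝ → 𝕜} (hu : IsSolution b u) (t : ℝ) :
    h1Inner w (u t) = NormedSpace.exp ((t : 𝕜) * starRingEnd 𝕜 μ) * h1Inner w (u 0) := by
  set m := starRingEnd 𝕜 μ
  have h1 : ∀ t, HasDerivAt (fun t => h1Inner w (u t)) (m * h1Inner w (u t)) t := fun t => by
    have := hu.hasDerivAt_h1Inner hw.1.1 t
    rwa [hw.2.2 _ (hu.mem_dom t), h1Inner_const_mul_left] at this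
  have h2 : ∀ t : ℝ, HasDerivAt (fun t : ℝ => NormedSpace.exp (-((t : 𝕜) * m)))
      (-m * NormedSpace.exp (-((t : 𝕜) * m))) t := fun t => by
    have := hasDerivAt_exp_comp ((hasDerivAt_ofReal (𝕜 := 𝕜) (hasDerivAt_id t)).mul_const m).fun_neg
    simpa using this
  have h3 : ∀ t, HasDerivAt (fun t : ℝ => NormedSpace.exp (-((t : 𝕜) * m)) * h1Inner w (u t)) 0 t :=
    fun t => ((h2 t).fun_mul (h1 t)).congr_deriv (by ring)
  have h4 := is_const_of_deriv_eq_zero (fun t => (h3 t).differentiableAt) (fun t => (h3 t).deriv) t 0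
  simp only [RCLike.ofReal_zero, zero_mul, neg_zero, NormedSpace.exp_zero, one_mul] at h4
  rw [← h4, ← mul_assoc, ← NormedSpace.exp_add, add_neg_cancel, NormedSpace.exp_zero, one_mul]

/-! ### Transported sources -/

/-- The time that the flow of `x' = 1 - e^{-2x}` takes, up to a constant, to arrive at `x`. -/
def travelTime (x : ℝ) : ℝ := x + Real.log (speed x) / 2

theorem hasDerivAt_travelTime {x : ℝ} (hx : 0 < x) : HasDerivAt travelTime (speed x)⁻¹ x := by
  have hs := (speed_pos hx).ne'
  refine ((hasDerivAt_id x).fun_add (((hasDerivAt_speed x).log hs).div_const 2)).congr_deriv ?_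
  field_simp
  rw [speed]; ring_nf

theorem exp_two_mul_travelTime {x : ℝ} (hx : 0 < x) :
    Real.exp (2 * travelTime x) = Real.exp (2 * x) * speed x := by
  rw [travelTime, show 2 * (x + Real.log (speed x) / 2) = 2 * x + Real.log (speed x) by ring,
    Real.exp_add, Real.exp_log (speed_pos hx)]

theorem one_add_exp_travelTime {x : ℝ} (hx : 0 < x) :
    1 + Real.exp (2 * travelTime x) = Real.exp (2 * x) := by
  rw [exp_two_mul_travelTime hx, speed, mul_sub, ← Real.exp_add]; simp

theorem inv_speed_eq {x : ℝ} (hx : 0 < x) : (speed x)⁻¹ = 1 + Real.exp (-(2 * travelTime x)) := by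
  have h1 := exp_two_mul_travelTime hx
  have h2 := one_add_exp_travelTime hx
  have h3 := (speed_pos hx).ne'
  rw [Real.exp_neg]
  have h4 := Real.exp_pos (2 * travelTime x)
  field_simp
  rw [h1] at h2 ⊢
  linear_combination (-speed x) * h2

/-- The source `(1 - e^{-2x})^{-b/2} f(s(x))`, with `s` the travel time. -/
def timeSource (b : ℝ) (f : ℝ → ℝ) (x : ℝ) : 𝕜 :=
  ((speed x ^ (-(b / 2)) * f (travelTime x) : ℝ) : 𝕜)

theorem continuousOn_timeSource (b : ℝ) {f : ℝ → ℝ} (hf : Continuous f) :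
    ContinuousOn (timeSource (𝕜 := 𝕜) b f) (Ioi 0) := by
  refine RCLike.continuous_ofReal.comp_continuousOn (ContinuousOn.mul (fun x hx => ?_)
    (hf.comp_continuousOn fun x hx => (hasDerivAt_travelTime hx).continuousAt.continuousWithinAt))
  exact ((hasDerivAt_speed x).continuousAt.rpow_const
    (Or.inl (speed_pos hx).ne')).continuousWithinAt

theorem hasDerivAt_timeSource (b : ℝ) {f f' : ℝ → ℝ} (hf : ∀ s, HasDerivAt f (f' s) s) {x : ℝ}
    (hx : 0 < x) : HasDerivAt (timeSource (𝕜 := 𝕜) b f)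
      (((-b * (speed x ^ (-(b / 2) - 1) * Real.exp (-2 * x)) * f (travelTime x) +
        speed x ^ (-(b / 2)) * (f' (travelTime x) * (speed x)⁻¹) : ℝ)) : 𝕜) x := by
  refine hasDerivAt_ofReal (((hasDerivAt_speed_rpow hx).fun_mul
    ((hf _).comp x (hasDerivAt_travelTime hx))).congr_deriv ?_)
  simp only [Function.comp]
  ring_nf

theorem timeSource_deriv (b : ℝ) {f f' : ℝ → ℝ} {x : ℝ} (hx : 0 < x) :
    timeSource b f' x = (speed x : 𝕜) *
      (((-b * (speed x ^ (-(b / 2) - 1) * Real.exp (-2 * x)) * f (travelTime x) +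
        speed x ^ (-(b / 2)) * (f' (travelTime x) * (speed x)⁻¹) : ℝ)) : 𝕜) +
      b * (Real.exp (-2 * x) : 𝕜) * timeSource b f x := by
  have hs := speed_pos hx
  have h1 : speed x * speed x ^ (-(b / 2) - 1) = speed x ^ (-(b / 2)) := by
    rw [Real.rpow_sub_one hs.ne']; field_simp
  have h2 : speed x * (speed x)⁻¹ = 1 := mul_inv_cancel₀ hs.ne'
  rw [timeSource, timeSource, ← RCLike.ofReal_mul, ← RCLike.ofReal_mul, ← RCLike.ofReal_mul,
    ← RCLike.ofReal_add]
  congr 1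
  linear_combination (b * Real.exp (-2 * x) * f (travelTime x)) * h1 -
    (speed x ^ (-(b / 2)) * f' (travelTime x)) * h2

theorem exists_sourceBound_timeSource {b : ℝ} (hb : 0 ≤ b) (R : ℝ) :
    ∃ K : ℝ, 0 ≤ K ∧ ∀ (f : ℝ → ℝ) (ε : ℝ), Continuous f → (∀ s, |f s| ≤ ε) →
      (∀ s, R < |s| → f s = 0) → SourceBound 1 1 (K * ε) (timeSource (𝕜 := 𝕜) b f) := by
  set E := 1 + Real.exp (2 * R) with hE
  have hE1 : 1 ≤ E := by have := Real.exp_pos (2 * R); linarith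
  refine ⟨E ^ (b / 2) * E, by positivity, fun f ε hf hε hR => ⟨continuousOn_timeSource b hf, ?_⟩⟩
  intro x hx
  have hε0 : 0 ≤ ε := (abs_nonneg _).trans (hε 0)
  have hw := weight_nonneg (p := -1) (l := 1) hx
  rw [timeSource, RCLike.norm_ofReal, abs_mul, abs_of_pos (Real.rpow_pos_of_pos (speed_pos hx) _)]
  by_cases h : R < |travelTime x|
  · rw [hR _ h, abs_zero, mul_zero]; positivity
  · have h := abs_le.1 (not_lt.1 h)
    have h1 : (speed x)⁻¹ ≤ E := by
      rw [inv_speed_eq hx, hE]; gcongr; linarith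
    have h2 : Real.exp x ≤ E := by
      refine (Real.exp_le_exp.2 (by linarith : x ≤ 2 * x)).trans ?_
      rw [← one_add_exp_travelTime hx, hE]; gcongr; linarith
    have h3 : speed x ^ (-(b / 2)) ≤ E ^ (b / 2) := by
      rw [Real.rpow_neg (speed_pos hx).le, ← Real.inv_rpow (speed_pos hx).le]
      exact Real.rpow_le_rpow (inv_nonneg.2 (speed_pos hx).le) h1 (by linarith)
    have h4 : 1 ≤ E * weight (-1) 1 x := by
      rw [weight, Real.rpow_neg_one, neg_one_mul]
      have h5 : 1 ≤ (speed x)⁻¹ := by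
        rw [inv_speed_eq hx]; have := Real.exp_pos (-(2 * travelTime x)); linarith
      have h6 : 1 ≤ E * Real.exp (-x) := by
        have := mul_le_mul_of_nonneg_right h2 (Real.exp_pos (-x)).le
        rwa [← Real.exp_add, add_neg_cancel, Real.exp_zero] at this
      nlinarith
    calc speed x ^ (-(b / 2)) * |f (travelTime x)| ≤ E ^ (b / 2) * ε :=
          mul_le_mul h3 (hε _) (abs_nonneg _) (by positivity)
      _ ≤ E ^ (b / 2) * ε * (E * weight (-1) 1 x) := le_mul_of_one_le_right (by positivity) h4
      _ = _ := by ring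

/-- The function on the line, supported on the right, with `v - v'' = (1 - e^{-2x})^{-b/2} f(s(x))`
there. -/
def timeGreen (b : ℝ) (f : ℝ → ℝ) : ℝ → 𝕜 := rightPart (green (timeSource b f))

/-- A continuous function with compact support. -/
structure CompactlySupported (f : ℝ → ℝ) : Prop where
  cont : Continuous f
  supp : HasCompactSupport f

theorem CompactlySupported.sub {f g : ℝ → ℝ} (hf : CompactlySupported f)
    (hg : CompactlySupported g) : CompactlySupported fun s => f s - g s :=
  ⟨hf.cont.sub hg.cont, hf.supp.sub hg.supp⟩

theorem CompactlySupported.const_mul {f : ℝ → ℝ} (c : ℝ) (hf : CompactlySupported f) :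
    CompactlySupported fun s => c * f s :=
  ⟨continuous_const.mul hf.cont, hf.supp.mul_left⟩

theorem CompactlySupported.comp_add {f : ℝ → ℝ} (hf : CompactlySupported f) (t : ℝ) :
    CompactlySupported fun s => f (s + t) :=
  ⟨hf.cont.comp (continuous_add_const t), hf.supp.comp_homeomorph (Homeomorph.addRight t)⟩

theorem CompactlySupported.exists_bound {f : ℝ → ℝ} (hf : CompactlySupported f) :
    ∃ L, 0 ≤ L ∧ ∀ s, |f s| ≤ L := by
  obtain ⟨L, hL⟩ := hf.supp.exists_bound_of_continuous hf.cont
  exact ⟨L, (norm_nonneg _).trans (hL 0), hL⟩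

theorem CompactlySupported.exists_radius {f : ℝ → ℝ} (hf : CompactlySupported f) :
    ∃ R, ∀ s, R < |s| → f s = 0 := by
  obtain ⟨R, hR⟩ := hf.supp.isBounded.exists_norm_le
  exact ⟨R, fun s hs => by_contra fun h => (hR s (subset_tsupport f h)).not_gt hs⟩

theorem CompactlySupported.sourceBound {b : ℝ} (hb : 0 ≤ b) {f : ℝ → ℝ}
    (hf : CompactlySupported f) : ∃ C, SourceBound 1 1 C (timeSource (𝕜 := 𝕜) b f) := by
  obtain ⟨R, hR⟩ := hf.exists_radius
  obtain ⟨L, -, hL⟩ := hf.exists_bound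
  obtain ⟨K, -, hK⟩ := exists_sourceBound_timeSource (𝕜 := 𝕜) hb R
  exact ⟨_, hK f L hf.cont hL hR⟩

theorem timeSource_sub (b : ℝ) (f g : ℝ → ℝ) :
    timeSource (𝕜 := 𝕜) b (fun s => f s - g s) = fun x => timeSource b f x - timeSource b g x := by
  ext x; simp only [timeSource]; push_cast; ring

theorem timeSource_const_mul (b c : ℝ) (f : ℝ → ℝ) :
    timeSource (𝕜 := 𝕜) b (fun s => c * f s) = fun x => (c : 𝕜) * timeSource b f x := by
  ext x; simp only [timeSource]; push_cast; ring

theorem timeGreen_sub {b : ℝ} (hb : 0 ≤ b) {f g : ℝ → ℝ} (hf : CompactlySupported f)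
    (hg : CompactlySupported g) :
    timeGreen (𝕜 := 𝕜) b (fun s => f s - g s) = fun x => timeGreen b f x - timeGreen b g x := by
  obtain ⟨C, hC⟩ := hf.sourceBound (𝕜 := 𝕜) hb
  obtain ⟨D, hD⟩ := hg.sourceBound (𝕜 := 𝕜) hb
  ext x
  rcases le_or_gt x 0 with hx | hx
  · simp only [timeGreen, rightPart_of_nonpos _ hx, sub_zero]
  · simp only [timeGreen, rightPart_of_pos _ hx]
    rw [timeSource_sub]
    exact hC.green_sub hD le_rfl (by norm_num) one_pos one_le_two hx

theorem timeGreen_const_mul (b c : ℝ) (f : ℝ → ℝ) :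
    timeGreen (𝕜 := 𝕜) b (fun s => c * f s) = fun x => (c : 𝕜) * timeGreen b f x := by
  ext x
  rcases le_or_gt x 0 with hx | hx
  · simp only [timeGreen, rightPart_of_nonpos _ hx, mul_zero]
  · simp only [timeGreen, rightPart_of_pos _ hx]
    rw [timeSource_const_mul, green_const_mul]

theorem exists_h1Norm_timeGreen_le {b : ℝ} (hb : 0 ≤ b) (R : ℝ) :
    ∃ K : ℝ, ∀ (f : ℝ → ℝ) (ε : ℝ), Continuous f → (∀ s, |f s| ≤ ε) →
      (∀ s, R < |s| → f s = 0) → h1Norm (timeGreen (𝕜 := 𝕜) b f) ≤ K * ε := by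
  obtain ⟨K, -, hK⟩ := exists_sourceBound_timeSource (𝕜 := 𝕜) hb R
  obtain ⟨K', hK'⟩ := exists_h1Norm_green_le (𝕜 := 𝕜) (p := 1) (l := 1) le_rfl (by norm_num) one_pos
    one_le_two
  exact ⟨K' * K, fun f ε hf hε hR => by rw [mul_assoc]; exact hK' _ _ (hK f ε hf hε hR)⟩

theorem linOp_timeGreen {b : ℝ} (hb : 0 ≤ b) {f f' : ℝ → ℝ} (hf : CompactlySupported f)
    (hf' : CompactlySupported f') (hd : ∀ s, HasDerivAt f (f' s) s) :
    MemDom (timeGreen (𝕜 := 𝕜) b f) ∧ linOp b (timeGreen (𝕜 := 𝕜) b f) = timeGreen b f' := by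
  obtain ⟨C, hC⟩ := hf.sourceBound (𝕜 := 𝕜) hb
  obtain ⟨D, hD⟩ := hf'.sourceBound (𝕜 := 𝕜) hb
  have e := fun x (hx : x ∈ Ioi (0 : ℝ)) => timeSource_deriv (𝕜 := 𝕜) b (f := f) (f' := f') hx
  obtain ⟨h1, h2⟩ := linOp_green le_rfl (by norm_num) one_pos one_le_two hC
    (fun x hx => hasDerivAt_timeSource b hd hx) (hD.congr e)
  exact ⟨h1, h2.trans (rightPart_congr fun x hx => (green_congr e hx).symm)⟩

theorem abs_sub_le_of_hasDerivAt {f f' : ℝ → ℝ} {L : ℝ} (hd : ∀ s, HasDerivAt f (f' s) s)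
    (hL : ∀ s, |f' s| ≤ L) (x y : ℝ) : |f y - f x| ≤ L * |y - x| :=
  convex_univ.norm_image_sub_le_of_norm_hasDerivWithin_le (fun s _ => (hd s).hasDerivWithinAt)
    (fun s _ => hL s) (mem_univ x) (mem_univ y)

theorem abs_taylor_le {f f' f'' : ℝ → ℝ} {L : ℝ} (hd : ∀ s, HasDerivAt f (f' s) s)
    (hd' : ∀ s, HasDerivAt f' (f'' s) s) (hL0 : 0 ≤ L) (hL : ∀ s, |f'' s| ≤ L) (x h : ℝ) :
    |f (x + h) - f x - h * f' x| ≤ L * |h| * |h| := by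
  have h1 : ∀ s ∈ uIcc 0 h, HasDerivWithinAt (fun s => f (x + s) - s * f' x) (f' (x + s) - f' x)
      (uIcc 0 h) s := fun s _ => by
    have := (((hd (x + s)).comp_const_add x s).fun_sub
      ((hasDerivAt_id s).mul_const (f' x))).hasDerivWithinAt (s := uIcc 0 h)
    simpa using this
  have h2 := (convex_uIcc 0 h).norm_image_sub_le_of_norm_hasDerivWithin_le (C := L * |h|) h1
    (fun s hs => ?_) left_mem_uIcc right_mem_uIcc
  · simp only [Real.norm_eq_abs, add_zero, zero_mul, sub_zero] at h2
    rwa [sub_right_comm]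
  · have h3 := abs_sub_le_of_hasDerivAt hd' hL x (x + s)
    rw [add_sub_cancel_left] at h3
    refine h3.trans (mul_le_mul_of_nonneg_left ?_ hL0)
    rcases mem_uIcc.1 hs with h | h
    · rw [abs_of_nonneg h.1, abs_of_nonneg (h.1.trans h.2)]; exact h.2
    · rw [abs_of_nonpos h.2, abs_of_nonpos (h.1.trans h.2)]; linarith

theorem isSolution_timeGreen {b : ℝ} (hb : 0 ≤ b) {f f' f'' : ℝ → ℝ} (hf : CompactlySupported f)
    (hf' : CompactlySupported f') (hf'' : CompactlySupported f'')
    (hd : ∀ s, HasDerivAt f (f' s) s) (hd' : ∀ s, HasDerivAt f' (f'' s) s) :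
    IsSolution b fun t => timeGreen (𝕜 := 𝕜) b fun s => f (s + t) := by
  have hL : ∀ t, MemDom (timeGreen (𝕜 := 𝕜) b fun s => f (s + t)) ∧
      linOp b (timeGreen (𝕜 := 𝕜) b fun s => f (s + t)) = timeGreen b fun s => f' (s + t) := fun t =>
    linOp_timeGreen hb (hf.comp_add t) (hf'.comp_add t) fun s => (hd (s + t)).comp_add_const s t
  obtain ⟨L, hL0, hL1⟩ := hf'.exists_bound
  obtain ⟨L', hL0', hL1'⟩ := hf''.exists_bound
  obtain ⟨R₁, hR₁⟩ := hf.exists_radius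
  obtain ⟨R₂, hR₂⟩ := hf'.exists_radius
  have radius : ∀ {s t r : ℝ}, |r - t| < 1 → max R₁ R₂ + |t| + 1 < |s| →
      R₁ < |s + r| ∧ R₂ < |s + r| := fun {s t r} hr hs => by
    have h1 : |s| - |r| ≤ |s + r| := by
      have := abs_sub_abs_le_abs_sub s (-r); rwa [abs_neg, sub_neg_eq_add] at this
    have h2 : |r| ≤ |t| + |r - t| := by
      have := abs_add_le t (r - t); rwa [add_sub_cancel] at this
    exact ⟨by linarith [le_max_left R₁ R₂], by linarith [le_max_right R₁ R₂]⟩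
  have cont : ∀ {g g' : ℝ → ℝ} {D : ℝ} (t : ℝ), CompactlySupported g →
      (∀ s, HasDerivAt g (g' s) s) → (∀ s, |g' s| ≤ D) → (∀ s, R₁ < |s| → R₂ < |s| → g s = 0) →
      Tendsto (fun r => h1Norm fun ξ => timeGreen (𝕜 := 𝕜) b (fun s => g (s + r)) ξ -
        timeGreen b (fun s => g (s + t)) ξ) (𝓝 t) (𝓝 0) := by
    intro g g' D t hg hgd hD hR
    obtain ⟨K, hK⟩ := exists_h1Norm_timeGreen_le (𝕜 := 𝕜) hb (max R₁ R₂ + |t| + 1)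
    refine squeeze_zero' (Eventually.of_forall fun r => h1Norm_nonneg _)
      (g := fun r => K * (D * |r - t|)) ?_ ?_
    · filter_upwards [Metric.ball_mem_nhds t one_pos] with r hr
      rw [Metric.mem_ball, Real.dist_eq] at hr
      rw [← timeGreen_sub hb (hg.comp_add r) (hg.comp_add t)]
      refine hK _ _ ((hg.comp_add r).sub (hg.comp_add t)).cont (fun s => ?_) fun s hs => ?_
      · have := abs_sub_le_of_hasDerivAt hgd hD (s + t) (s + r)
        rwa [add_sub_add_left_eq_sub] at this
      · have h1 := radius hr hs
        have h2 := radius (r := t) (by simp) hs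
        rw [hR _ h1.1 h1.2, hR _ h2.1 h2.2, sub_zero]
    · have : ContinuousAt (fun r => K * (D * |r - t|)) t := by fun_prop
      simpa [ContinuousAt] using this
  refine .of_linOp (fun t => (hL t).1) (fun t => ?_) (fun t => ?_) fun t => ?_
  · exact cont t hf hd hL1 fun s h _ => hR₁ s h
  · simp only [(hL _).2]
    exact cont t hf' hd' hL1' fun s _ h => hR₂ s h
  · simp only [(hL _).2]
    obtain ⟨K, hK⟩ := exists_h1Norm_timeGreen_le (𝕜 := 𝕜) hb (max R₁ R₂ + |t| + 1)
    refine squeeze_zero' (Eventually.of_forall fun r => h1Norm_nonneg _)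
      (g := fun h => K * (L' * |h|)) ?_ ?_
    · filter_upwards [nhdsWithin_le_nhds (Metric.ball_mem_nhds (0 : ℝ) one_pos),
        self_mem_nhdsWithin] with h hh h0
      have h0 : h ≠ 0 := h0
      rw [Metric.mem_ball, dist_zero_right, Real.norm_eq_abs] at hh
      have c1 := ((hf.comp_add (t + h)).sub (hf.comp_add t))
      have e : (fun ξ => h⁻¹ • (timeGreen (𝕜 := 𝕜) b (fun s => f (s + (t + h))) ξ -
          timeGreen b (fun s => f (s + t)) ξ) - timeGreen b (fun s => f' (s + t)) ξ) =
          timeGreen b fun s => h⁻¹ * (f (s + (t + h)) - f (s + t)) - f' (s + t) := by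
        rw [timeGreen_sub hb (c1.const_mul _) (hf'.comp_add t), timeGreen_const_mul,
          timeGreen_sub hb (hf.comp_add _) (hf.comp_add _)]
        simp only [RCLike.real_smul_eq_coe_mul]
      rw [e]
      refine hK _ _ ((c1.const_mul _).sub (hf'.comp_add t)).cont (fun s => ?_) fun s hs => ?_
      · have h1 := abs_taylor_le hd hd' hL0' hL1' (s + t) h
        have h2 : h⁻¹ * (f (s + (t + h)) - f (s + t)) - f' (s + t) =
            h⁻¹ * (f (s + t + h) - f (s + t) - h * f' (s + t)) := by
          rw [add_assoc]; field_simp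
        rw [h2, abs_mul, abs_inv]
        refine (mul_le_mul_of_nonneg_left h1 (inv_nonneg.2 (abs_nonneg h))).trans (le_of_eq ?_)
        have := abs_ne_zero.2 h0
        field_simp
      · have h1 := radius (r := t + h) (by simpa using hh) hs
        have h2 := radius (r := t) (by simp) hs
        rw [hR₁ _ h1.1, hR₁ _ h2.1, hR₂ _ h2.2]; simp
    · have : ContinuousAt (fun h => K * (L' * |h|)) 0 := by fun_prop
      have := this.tendsto
      simp only [abs_zero, mul_zero] at this
      exact this.mono_left nhdsWithin_le_nhds

/-! ### Growing solutions -/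

theorem h1Inner_weightPow_green {q μ : 𝕜} (hq : 1 / 2 < RCLike.re q) (hμ : 0 < RCLike.re μ)
    {M : ℝ → 𝕜} {C : ℝ} (hM : SourceBound 1 1 C M) :
    IntegrableOn (fun x => starRingEnd 𝕜 (weightPow q μ x) * M x) (Ioi 0) ∧
    h1Inner (rightPart (weightPow q μ)) (rightPart (green M)) =
      ∫ x in Ioi 0, starRingEnd 𝕜 (weightPow q μ x) * M x := by
  obtain ⟨hW, -⟩ := halfH1_weightPow hq hμ
  set W := weightPow q μ with hWd
  set W' : ℝ → 𝕜 := fun x => (2 * q * (Real.exp (-2 * x) : 𝕜) / (speed x : 𝕜) - μ) * W x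
  have h32 : (1 : ℝ) < 3 / 2 := by norm_num
  have hG := hM.halfH1_green le_rfl h32 one_pos one_le_two
  have hgd := fun x (hx : 0 < x) => hM.hasDerivAt_greenDeriv le_rfl h32 one_pos one_le_two hx
  have cW : ContinuousOn W (Ioi 0) := fun x hx =>
    (hasDerivAt_weightPow q μ hx).continuousAt.continuousWithinAt
  have cM : ContinuousOn (fun x => starRingEnd 𝕜 (W x) * M x) (Ioi 0) :=
    (RCLike.continuous_conj.comp_continuousOn cW).mul hM.cont
  have iM : IntegrableOn (fun x => starRingEnd 𝕜 (W x) * M x) (Ioi 0) := by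
    refine ((integrableOn_weight (p := RCLike.re q + -1) (l := RCLike.re μ + 1) (by linarith)
      (by linarith)).const_mul C).mono' (cM.aestronglyMeasurable measurableSet_Ioi) ?_
    filter_upwards [ae_restrict_mem measurableSet_Ioi] with x hx
    have hx : 0 < x := hx
    rw [norm_mul, RCLike.norm_conj, hWd, norm_weightPow q μ hx, ← weight_mul_weight hx,
      mul_left_comm]
    exact mul_le_mul_of_nonneg_left (hM.bound x hx) (weight_nonneg hx)
  refine ⟨iM, ?_⟩
  have cg : ContinuousOn (fun x => green M x - M x) (Ioi 0) :=
    ContinuousOn.sub (fun x hx => (hM.hasDerivAt_green le_rfl h32 one_pos one_le_two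
      hx).continuousAt.continuousWithinAt) hM.cont
  have hprim := hW.prim.conj.mul isOpen_Ioi (IsPrimitiveOn.of_hasDerivAt (fun x hx => hgd x hx) cg)
  have i1 : IntegrableOn (fun x => starRingEnd 𝕜 (W' x) * greenDeriv M x) (Ioi 0) :=
    hW.memLp_deriv.integrable_conj_mul hG.memLp_deriv
  have i2 : IntegrableOn (fun x => starRingEnd 𝕜 (W x) * green M x) (Ioi 0) :=
    hW.memLp.integrable_conj_mul hG.memLp
  have i3 : IntegrableOn (fun x => starRingEnd 𝕜 (W x) * green M x +
      starRingEnd 𝕜 (W' x) * greenDeriv M x) (Ioi 0) := i2.add i1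
  have hi : IntegrableOn (fun x => starRingEnd 𝕜 (W' x) * greenDeriv M x +
      starRingEnd 𝕜 (W x) * (green M x - M x)) (Ioi 0) :=
    (i3.sub iM).congr (Eventually.of_forall fun x => by simp only [Pi.sub_apply]; ring)
  have hb : ∀ x, 0 < x → ‖starRingEnd 𝕜 (W x) * greenDeriv M x‖ ≤
      C * greenConst 1 1 * weight (RCLike.re q + -(1 / 2 - 1 / 4)) (RCLike.re μ + 1 / 2) x :=
    fun x hx => by
      rw [norm_mul, RCLike.norm_conj, hWd, norm_weightPow q μ hx, ← weight_mul_weight hx,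
        mul_left_comm]
      exact mul_le_mul_of_nonneg_left (hM.norm_greenDeriv_le le_rfl h32 one_pos one_le_two hx)
        (weight_nonneg hx)
  have h0 := hprim.integral_eq_zero hi (tendsto_zero_of_norm_le_weight (by linarith) hb) (by
    refine squeeze_zero_norm' ((eventually_gt_atTop 0).mono fun x hx => hb x hx) ?_
    simpa using (tendsto_weight_atTop (RCLike.re q + -(1 / 2 - 1 / 4))
      (l := RCLike.re μ + 1 / 2) (by linarith)).const_mul (C * greenConst 1 1))
  rw [hW.h1Inner_rightPart hG.memH1Zero.1, ← sub_eq_zero, ← h0]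
  have e : ∫ x in Ioi 0, (starRingEnd 𝕜 (W x) * rightPart (green M) x +
      starRingEnd 𝕜 (W' x) * deriv (rightPart (green M)) x) =
      ∫ x in Ioi 0, (starRingEnd 𝕜 (W x) * green M x + starRingEnd 𝕜 (W' x) * greenDeriv M x) :=
    setIntegral_congr_fun measurableSet_Ioi fun x hx => by
      simp only [rightPart_of_pos _ hx, (deriv_rightPart_of_pos hx
        (hM.hasDerivAt_green le_rfl h32 one_pos one_le_two hx)).deriv]
  rw [e, ← integral_sub i3 iM]
  congr 1; ext x; ring

theorem conj_weightPow_mul_timeSource {b : ℝ} {μ q : 𝕜} (hq : q = ((b - 2 : ℝ) - μ) / 2)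
    (f : ℝ → ℝ) {x : ℝ} (hx : 0 < x) :
    starRingEnd 𝕜 (weightPow q μ x) * timeSource b f x =
      (((speed x)⁻¹ * f (travelTime x) : ℝ) : 𝕜) *
        NormedSpace.exp (-((travelTime x : 𝕜) * starRingEnd 𝕜 μ)) := by
  have hcast : ∀ r : ℝ, ((Real.exp r : ℝ) : 𝕜) = NormedSpace.exp (r : 𝕜) := fun r => by
    rw [Real.exp_eq_exp_ℝ]; exact NormedSpace.map_exp (algebraMap ℝ 𝕜) RCLike.continuous_ofReal r
  have h1 : (speed x)⁻¹ = Real.exp (-Real.log (speed x)) := by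
    rw [Real.exp_neg, Real.exp_log (speed_pos hx)]
  have hcq : starRingEnd 𝕜 q = ((b - 2 : ℝ) - starRingEnd 𝕜 μ) / 2 := by
    rw [hq, map_div₀, map_sub, RCLike.conj_ofReal, map_ofNat]
  rw [conj_weightPow, weightPow, timeSource, Real.rpow_def_of_pos (speed_pos hx), h1,
    RCLike.ofReal_mul, RCLike.ofReal_mul, hcast, hcast, mul_right_comm, ← mul_assoc,
    ← NormedSpace.exp_add, ← NormedSpace.exp_add, hcq, travelTime]
  congr 2
  push_cast
  ring

theorem exists_growing_solution {b : ℝ} {μ q : 𝕜} (hq : q = ((b - 2 : ℝ) - μ) / 2)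
    (h0 : 0 < RCLike.re μ) (h1 : RCLike.re μ < b - 3) :
    ∃ u : ℝ → ℝ → 𝕜, IsSolution b u ∧ h1Inner (rightPart (weightPow q μ)) (u 0) ≠ 0 := by
  have hb : 0 ≤ b := by linarith
  have hre : RCLike.re q = (b - 2 - RCLike.re μ) / 2 := by
    have : q = (((1 / 2 : ℝ)) : 𝕜) * ((b - 2 : ℝ) - μ) := by rw [hq]; push_cast; ring
    rw [this, RCLike.re_ofReal_mul, map_sub, RCLike.ofReal_re]; ring
  set E : ℝ → ℝ := fun s => RCLike.re (NormedSpace.exp (-((s : 𝕜) * starRingEnd 𝕜 μ))) with hE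
  have hEc : Continuous E := RCLike.continuous_re.comp
    (NormedSpace.exp_continuous.comp ((RCLike.continuous_ofReal.mul continuous_const).neg))
  have hE0 : ∀ᶠ s in 𝓝 (0 : ℝ), 0 < E s :=
    hEc.continuousAt.eventually (lt_mem_nhds (by simp [hE]))
  obtain ⟨δ, hδ, hδE⟩ := Metric.eventually_nhds_iff_ball.1 hE0
  let ρ : ContDiffBump (0 : ℝ) := ⟨δ / 2, δ, half_pos hδ, half_lt_self hδ⟩
  have hρ0 : CompactlySupported ρ := ⟨ρ.continuous, ρ.hasCompactSupport⟩
  have hρ1 : ContDiff ℝ 2 ρ := ρ.contDiff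
  have hρ2 : ContDiff ℝ 1 (deriv ρ) := hρ1.deriv'
  have hd : ∀ s, HasDerivAt ρ (deriv ρ s) s := fun s =>
    (hρ1.differentiable two_ne_zero s).hasDerivAt
  have hd' : ∀ s, HasDerivAt (deriv ρ) (deriv (deriv ρ) s) s := fun s =>
    (hρ2.differentiable one_ne_zero s).hasDerivAt
  have hu := isSolution_timeGreen (𝕜 := 𝕜) hb hρ0 ⟨hρ2.continuous, ρ.hasCompactSupport.deriv⟩
    ⟨hρ2.continuous_deriv le_rfl, ρ.hasCompactSupport.deriv.deriv⟩ hd hd'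
  refine ⟨_, hu, ?_⟩
  simp only [add_zero]
  obtain ⟨C, hC⟩ := hρ0.sourceBound (𝕜 := 𝕜) hb
  obtain ⟨hi, hI⟩ := h1Inner_weightPow_green (q := q) (by rw [hre]; linarith) h0 hC
  rw [timeGreen, hI]
  intro h
  have h2 := congrArg RCLike.re h
  rw [← integral_re hi, map_zero] at h2
  have e : ∀ x ∈ Ioi (0 : ℝ), RCLike.re (starRingEnd 𝕜 (weightPow q μ x) * timeSource b ρ x) =
      (speed x)⁻¹ * ρ (travelTime x) * E (travelTime x) := fun x hx => by
    rw [conj_weightPow_mul_timeSource hq ρ hx, RCLike.re_ofReal_mul]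
  have hpos : ∀ s, ρ s ≠ 0 → 0 < E s := fun s hs => hδE s (by
    rw [← ρ.support_eq]; exact hs)
  have hnn : ∀ x ∈ Ioi (0 : ℝ), 0 ≤ (speed x)⁻¹ * ρ (travelTime x) * E (travelTime x) :=
    fun x hx => by
      by_cases hs : ρ (travelTime x) = 0
      · rw [hs, mul_zero, zero_mul]
      · exact mul_nonneg (mul_nonneg (inv_nonneg.2 (speed_pos hx).le) ρ.nonneg) (hpos _ hs).le
  refine (((setIntegral_pos_iff_support_of_nonneg_ae ?_ hi.re).2 ?_).ne' h2)
  · filter_upwards [ae_restrict_mem measurableSet_Ioi] with x hx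
    rw [e x hx]; exact hnn x hx
  · obtain ⟨x₀, hx₀, ht⟩ : ∃ x₀ : ℝ, 0 < x₀ ∧ travelTime x₀ = 0 := by
      refine ⟨Real.log 2 / 2, by positivity, ?_⟩
      have h3 := one_add_exp_travelTime (x := Real.log 2 / 2) (by positivity)
      rw [mul_div_cancel₀ _ two_ne_zero, Real.exp_log two_pos] at h3
      have h4 : Real.exp (2 * travelTime (Real.log 2 / 2)) = Real.exp 0 := by
        rw [Real.exp_zero]; linarith
      linarith [Real.exp_injective h4]
    have hev : ∀ᶠ x in 𝓝 x₀, ρ (travelTime x) ≠ 0 := by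
      refine (ρ.continuous.continuousAt.comp
        (hasDerivAt_travelTime hx₀).continuousAt).eventually_ne ?_
      rw [Function.comp_apply, ht]
      exact (ρ.pos_of_mem_ball (Metric.mem_ball_self hδ)).ne'
    refine Measure.measure_pos_of_mem_nhds volume (x := x₀) ?_
    filter_upwards [hev, Ioi_mem_nhds hx₀] with x hx hx0
    refine ⟨?_, hx0⟩
    rw [Function.mem_support, e x hx0]
    exact (mul_pos (mul_pos (inv_pos.2 (speed_pos hx0)) (ρ.nonneg.lt_of_ne' hx)) (hpos _ hx)).ne'

/-! ### Conservation of the norm for `b = 3` -/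

theorem re_conj_mul_comm (z w : 𝕜) :
    RCLike.re (starRingEnd 𝕜 z * w) = RCLike.re (starRingEnd 𝕜 w * z) := by
  rw [← RCLike.conj_re, map_mul, RCLike.conj_conj, mul_comm]

theorem setIntegral_re_linOp_three {v : ℝ → 𝕜} (hv : MemDom v) :
    RCLike.re (∫ x in Ioi 0, (starRingEnd 𝕜 (v x) * linOp 3 v x +
      starRingEnd 𝕜 (deriv v x) * deriv (linOp 3 v) x)) = 0 := by
  have hp : HalfH1 (flux v) (deriv (flux v)) := MemH1Zero.halfH1 hv.2
  have hv1 := hv.1.halfH1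
  have hF := halfH1_linOp hv 3
  have hF' := hF.ae_deriv_eq
  have hLF := (hv.memH1Zero_linOp 3).1
  have iA : IntegrableOn (fun x => starRingEnd 𝕜 (v x) * linOp 3 v x +
      starRingEnd 𝕜 (deriv v x) * deriv (linOp 3 v) x) (Ioi 0) :=
    (hv1.memLp.integrable_conj_mul (hLF.memLp.restrict _)).add
      (hv1.memLp_deriv.integrable_conj_mul (hLF.memLp_deriv.restrict _))
  have hr : ∀ x ∈ Ioi (0 : ℝ), HasDerivAt (fun x => (2 * speed x)⁻¹)
      (-(2 * (2 * Real.exp (-2 * x))) / (2 * speed x) ^ 2) x := fun x hx =>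
    ((hasDerivAt_speed x).const_mul 2).fun_inv (mul_pos two_pos (speed_pos hx)).ne'
  have cs := continuous_speed
  have hr' : ContinuousOn (fun x => -(2 * (2 * Real.exp (-2 * x))) / (2 * speed x) ^ 2) (Ioi 0) :=
    ContinuousOn.div (by fun_prop) (by fun_prop)
      fun x hx => pow_ne_zero _ (mul_pos two_pos (speed_pos hx)).ne'
  have hβ : ∀ x ∈ Ioi (0 : ℝ), HasDerivAt (fun x => (1 + Real.exp (-2 * x)) / 2)
      ((-2 * Real.exp (-2 * x)) / 2) x := fun x _ =>
    ((hasDerivAt_exp_const_mul (-2) x).const_add 1).div_const 2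
  have pB := ((hp.prim.norm_sq isOpen_Ioi).mul_real isOpen_Ioi hr hr').add
    ((hv1.prim.norm_sq isOpen_Ioi).mul_real isOpen_Ioi hβ (by fun_prop))
  simp only [RCLike.ofReal_real_eq_id, id] at pB
  have hpB := pB.congr (g' := fun x => RCLike.re (starRingEnd 𝕜 (v x) * linOp 3 v x +
      starRingEnd 𝕜 (deriv v x) * deriv (linOp 3 v) x)) (fun x _ => rfl) (by
    filter_upwards [hF'] with x hx hx0
    have hx0' : 0 < x := hx0
    have hne := (speed_pos hx0').ne'
    have hs : flux v x = (speed x : 𝕜) * deriv v x := by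
      rw [flux, ← speed_eq_peakon hx0'.le, RCLike.real_smul_eq_coe_mul]
    have e1 : starRingEnd 𝕜 (v x) * linOp 3 v x +
        starRingEnd 𝕜 (deriv v x) * deriv (linOp 3 v) x =
        (speed x : 𝕜) * (starRingEnd 𝕜 (v x) * deriv v x) -
        (Real.exp (-2 * x) : 𝕜) * (starRingEnd 𝕜 (v x) * v x) +
        starRingEnd 𝕜 (deriv v x) * deriv (flux v) x +
        ((2 * Real.exp (-2 * x) : ℝ) : 𝕜) * (starRingEnd 𝕜 (deriv v x) * v x) -
        (Real.exp (-2 * x) : 𝕜) * (starRingEnd 𝕜 (deriv v x) * deriv v x) := by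
      rw [hx hx0, linOp_eq_flux hv.memH1.memLp 3 hx0', hs]
      push_cast
      ring
    have e2 : 2 * RCLike.re (starRingEnd 𝕜 (flux v x) * deriv (flux v) x) =
        2 * speed x * RCLike.re (starRingEnd 𝕜 (deriv v x) * deriv (flux v) x) := by
      rw [hs, map_mul (starRingEnd 𝕜), RCLike.conj_ofReal, mul_assoc, RCLike.re_ofReal_mul]; ring
    have e3 : ‖flux v x‖ ^ 2 = speed x ^ 2 * ‖deriv v x‖ ^ 2 := by
      rw [hs, norm_mul, RCLike.norm_ofReal, mul_pow, sq_abs]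
    rw [e1, e2, e3]
    simp only [map_add, map_sub, RCLike.re_ofReal_mul, RCLike.conj_mul, ← RCLike.ofReal_pow,
      RCLike.ofReal_re, re_conj_mul_comm (deriv v x) (v x)]
    have e4 : Real.exp (-2 * x) = 1 - speed x := by rw [speed]; ring
    rw [e4]
    field_simp
    ring)
  rw [← integral_re iA]
  refine hpB.integral_eq_zero iA.re ?_ ?_
  · have t1 := (hp.tendsto_norm_sq_div_speed).div_const 2
    have t2 := ((Continuous.tendsto (f := fun x : ℝ => (1 + Real.exp (-2 * x)) / 2)
      (by fun_prop) 0).mono_left (nhdsWithin_le_nhds (s := Ioi 0))).mul (hv1.tendsto.norm.pow 2)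
    have t := t1.add t2
    simp only [norm_zero, zero_div, ne_eq, OfNat.ofNat_ne_zero, not_false_eq_true, zero_pow,
      mul_zero, add_zero] at t
    refine t.congr fun x => ?_
    rw [mul_inv, div_eq_mul_inv (‖flux v x‖ ^ 2)]
    ring
  · have e0 : Tendsto (fun x : ℝ => Real.exp (-2 * x)) atTop (𝓝 0) :=
      Real.tendsto_exp_atBot.comp (tendsto_id.const_mul_atTop_of_neg (by norm_num))
    have t := (((tendsto_speed_atTop.const_mul 2).inv₀ (by norm_num)).mul
      (hp.tendsto_atTop.norm.pow 2)).add
      (((e0.const_add 1).div_const 2).mul (hv1.tendsto_atTop.norm.pow 2))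
    simpa using t

theorem re_h1Inner_linOp_three {v : ℝ → 𝕜} (hv : MemDom v) :
    RCLike.re (h1Inner v (linOp 3 v)) = 0 := by
  rw [h1Inner_eq_add hv.memH1 (hv.memH1Zero_linOp 3).1, map_add, setIntegral_re_linOp_three hv,
    zero_add]
  have h := setIntegral_re_linOp_three hv.comp_neg
  have e : linOp 3 (fun x => v (-x)) = fun x => -linOp 3 v (-x) :=
    funext fun x => linOp_comp_neg hv.memH1.memLp 3 x
  have e' : ∀ x, deriv (fun x => -linOp 3 v (-x)) x = deriv (linOp 3 v) (-x) := fun x => by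
    rw [deriv.fun_neg, deriv_comp_neg, neg_neg]
  simp only [e, e', deriv_comp_neg, map_neg, neg_mul, mul_neg, ← neg_add, integral_neg,
    neg_eq_zero] at h
  exact h

theorem IsSolution.h1Norm_eq {u : ℝ → ℝ → 𝕜} (hu : IsSolution 3 u) (t : ℝ) :
    h1Norm (u t) = h1Norm (u 0) := by
  have h : ∀ t, HasDerivAt (fun t => h1Norm (u t) ^ 2) 0 t := fun t => by
    have := hu.hasDerivAt_h1Norm_sq t
    rwa [re_h1Inner_linOp_three (hu.mem_dom t), mul_zero] at this
  have h2 := is_const_of_deriv_eq_zero (fun t => (h t).differentiableAt) (fun t => (h t).deriv) t 0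
  exact (pow_left_inj₀ (h1Norm_nonneg _) (h1Norm_nonneg _) two_ne_zero).1 h2

theorem IsSolution.eq_of_initial {u u' : ℝ → ℝ → 𝕜} (hu : IsSolution 3 u) (hu' : IsSolution 3 u')
    (h : u' 0 = u 0) : u' = u := by
  ext t ξ
  have hs := hu'.sub hu
  have h1 := hs.h1Norm_eq t
  have h2 : h1Norm (fun ξ => u' 0 ξ - u 0 ξ) = 0 := by
    rw [h]; simp [h1Norm]
  have h3 := congrFun ((hs.mem_dom t).memH1.eq_zero_of_h1Norm (h1.trans h2)) ξ
  exact sub_eq_zero.1 h3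

section translation

open ENNReal

/-! ### Translations in `L²` and in `H¹` -/

theorem measurePreserving_add_const (t : ℝ) :
    MeasurePreserving (fun s : ℝ => s + t) volume volume :=
  measurePreserving_add_right volume t

theorem tendsto_eLpNorm_translate_sub {f : ℝ → 𝕜} (hf : MemLp f 2 volume) :
    Tendsto (fun r => eLpNorm (fun s => f (s + r) - f s) 2 volume) (𝓝 0) (𝓝 0) := by
  have hc : Continuous fun p : ℝ × ℝ => p.2 + p.1 := continuous_snd.add continuous_fst
  let g : C(ℝ, C(ℝ, ℝ)) := (ContinuousMap.mk _ hc).curry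
  have hg : ∀ r, MeasurePreserving (g r) volume volume := measurePreserving_add_const
  have h1 := (continuous_const (y := hf.toLp f)).compMeasurePreservingLp g.continuous hg
    (by norm_num)
  have h2 := ((continuous_iff_continuousAt.1 h1 0).sub_const (hf.toLp f)).enorm
  have e : ∀ r : ℝ, eLpNorm (fun s => f (s + r) - f s) 2 volume =
      ‖Lp.compMeasurePreserving (g r) (hg r) (hf.toLp f) - hf.toLp f‖ₑ :=
    fun r => by
      have h3 : Lp.compMeasurePreserving (g r) (hg r) (hf.toLp f) =
        (hf.comp_measurePreserving (hg r)).toLp _ := rfl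
      rw [h3, ← MemLp.toLp_sub, Lp.enorm_toLp]
      rfl
  simp only [e]
  have e0 := e 0
  simp only [add_zero, sub_self] at e0
  rw [eLpNorm_zero'] at e0
  have h3 : Tendsto (fun r => ‖Lp.compMeasurePreserving (g r) (hg r) (hf.toLp f) - hf.toLp f‖ₑ) (𝓝 0)
    (𝓝 ‖Lp.compMeasurePreserving (g 0) (hg 0) (hf.toLp f) - hf.toLp f‖ₑ) := h2
  rwa [← e0] at h3

theorem enorm_integral_Ioc_rpow_le {g : ℝ → 𝕜}
    (hg : AEStronglyMeasurable g (volume.restrict (Ioc 0 1))) :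
    ‖∫ θ in Ioc 0 1, g θ‖ₑ ^ (2 : ℝ) ≤ ∫⁻ θ in Ioc 0 1, ‖g θ‖ₑ ^ (2 : ℝ) := by
  have : IsProbabilityMeasure (volume.restrict (Ioc (0 : ℝ) 1)) := ⟨by simp⟩
  have h1 : ‖∫ θ in Ioc 0 1, g θ‖ₑ ≤ eLpNorm g 2 (volume.restrict (Ioc 0 1)) :=
    (enorm_integral_le_lintegral_enorm g).trans
      (by rw [← eLpNorm_one_eq_lintegral_enorm]
          exact eLpNorm_le_eLpNorm_of_exponent_le one_le_two hg)
  refine (ENNReal.rpow_le_rpow h1 two_pos.le).trans (le_of_eq ?_)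
  rw [eLpNorm_eq_lintegral_rpow_enorm_toReal two_ne_zero ofNat_ne_top, ← ENNReal.rpow_mul]
  simp

theorem eLpNorm_two_rpow (f : ℝ → 𝕜) :
    eLpNorm f 2 volume ^ (2 : ℝ) = ∫⁻ s, ‖f s‖ₑ ^ (2 : ℝ) := by
  rw [eLpNorm_eq_lintegral_rpow_enorm_toReal two_ne_zero ofNat_ne_top, ← ENNReal.rpow_mul]
  simp

theorem MemH1.diffQuot_eq {f : ℝ → 𝕜} (hf : MemH1 f) {h : ℝ} (hh : h ≠ 0) (s : ℝ) :
    h⁻¹ • (f (s + h) - f s) - deriv f s =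
      ∫ θ in Ioc (0 : ℝ) 1, (deriv f (s + h * θ) - deriv f s) := by
  have hi : IntervalIntegrable (fun θ => deriv f (s + h * θ)) volume 0 1 := by
    have := (hf.memLp_deriv.intervalIntegrable (s + h * 0) (s + h * 1)).comp_add_left s
    simpa [hh] using this.comp_mul_left (c := h)
  rw [← intervalIntegral.integral_of_le zero_le_one, intervalIntegral.integral_sub hi (by simp),
    intervalIntegral.integral_comp_add_mul _ hh, hf.sub_eq_integral]
  simp

theorem tendsto_eLpNorm_diffQuot_sub {f : ℝ → 𝕜} (hf : MemH1 f) :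
    Tendsto (fun h : ℝ => eLpNorm (fun s => h⁻¹ • (f (s + h) - f s) - deriv f s) 2 volume)
      (𝓝[≠] 0) (𝓝 0) := by
  rw [ENNReal.tendsto_nhds_zero]
  intro ε hε
  have h1 := ENNReal.tendsto_nhds_zero.1 (tendsto_eLpNorm_translate_sub hf.memLp_deriv) ε hε
  obtain ⟨δ, hδ, h2⟩ := Metric.eventually_nhds_iff_ball.1 h1
  filter_upwards [nhdsWithin_le_nhds (Metric.ball_mem_nhds (0 : ℝ) hδ), self_mem_nhdsWithin]
    with h hh h0
  have h0 : h ≠ 0 := h0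
  rw [Metric.mem_ball, dist_zero_right, Real.norm_eq_abs] at hh
  refine (ENNReal.rpow_le_rpow_iff two_pos).1 ?_
  rw [eLpNorm_two_rpow]
  have hm : Measurable (deriv f) := measurable_deriv f
  have hm2 : Measurable fun z : ℝ × ℝ => deriv f (z.1 + h * z.2) - deriv f z.1 :=
    (hm.comp (by fun_prop)).sub (hm.comp measurable_fst)
  calc ∫⁻ s, ‖h⁻¹ • (f (s + h) - f s) - deriv f s‖ₑ ^ (2 : ℝ)
      ≤ ∫⁻ s, ∫⁻ θ in Ioc (0 : ℝ) 1, ‖deriv f (s + h * θ) - deriv f s‖ₑ ^ (2 : ℝ) := by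
        refine lintegral_mono fun s => ?_
        rw [hf.diffQuot_eq h0]
        exact enorm_integral_Ioc_rpow_le
          (hm2.comp measurable_prodMk_left).aestronglyMeasurable
    _ = ∫⁻ θ in Ioc (0 : ℝ) 1, ∫⁻ s, ‖deriv f (s + h * θ) - deriv f s‖ₑ ^ (2 : ℝ) :=
        lintegral_lintegral_swap (hm2.enorm.pow_const _).aemeasurable
    _ ≤ ∫⁻ θ in Ioc (0 : ℝ) 1, ε ^ (2 : ℝ) := by
        refine setLIntegral_mono measurable_const fun θ hθ => ?_
        rw [← eLpNorm_two_rpow]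
        refine ENNReal.rpow_le_rpow (h2 (h * θ) ?_) two_pos.le
        rw [Metric.mem_ball, dist_zero_right, Real.norm_eq_abs, abs_mul, abs_of_pos hθ.1]
        exact (mul_le_of_le_one_right (abs_nonneg h) hθ.2).trans_lt hh
    _ = ε ^ (2 : ℝ) := by simp

namespace MemH1

variable {v : ℝ → 𝕜}

theorem comp_add (hv : MemH1 v) (t : ℝ) : MemH1 fun s => v (s + t) := by
  have e : deriv (fun s => v (s + t)) = fun s => deriv v (s + t) :=
    funext fun s => deriv_comp_add_const v t s
  refine ⟨hv.memLp.comp_measurePreserving (measurePreserving_add_const t), ?_, fun x y => ?_⟩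
  · rw [e]; exact hv.memLp_deriv.comp_measurePreserving (measurePreserving_add_const t)
  · rw [e, intervalIntegral.integral_comp_add_right (fun s => deriv v s) t, ← hv.sub_eq_integral]

theorem h1Norm_comp_add (v : ℝ → 𝕜) (t : ℝ) : h1Norm (fun s => v (s + t)) = h1Norm v := by
  have e : deriv (fun s => v (s + t)) = fun s => deriv v (s + t) :=
    funext fun s => deriv_comp_add_const v t s
  rw [h1Norm, h1Norm, e, integral_add_right_eq_self (fun s => ‖v s‖ ^ 2) t,
    integral_add_right_eq_self (fun s => ‖deriv v s‖ ^ 2) t]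

theorem h1Norm_le_eLpNorm (hv : MemH1 v) :
    h1Norm v ≤ (eLpNorm v 2 volume).toReal + (eLpNorm (deriv v) 2 volume).toReal := by
  have e : ∀ {f : ℝ → 𝕜}, MemLp f 2 volume → ∫ x, ‖f x‖ ^ 2 = (eLpNorm f 2 volume).toReal ^ 2 := by
    intro f hf
    have h1 := hf.eLpNorm_eq_integral_rpow_norm two_ne_zero ofNat_ne_top
    rw [h1, ENNReal.toReal_ofReal (by positivity), ← Real.rpow_natCast, ← Real.rpow_mul
      (integral_nonneg fun x => by positivity)]
    simp
  rw [h1Norm, e hv.memLp, e hv.memLp_deriv]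
  refine Real.sqrt_le_iff.2 ⟨by positivity, ?_⟩
  nlinarith [mul_nonneg (ENNReal.toReal_nonneg (a := eLpNorm v 2 volume))
    (ENNReal.toReal_nonneg (a := eLpNorm (deriv v) 2 volume))]

theorem tendsto_h1Norm_of_eLpNorm {ι : Type*} {l : Filter ι} {F F' : ι → ℝ → 𝕜}
    (hF : ∀ i, MemH1 (F i)) (hd : ∀ i, deriv (F i) =ᵐ[volume] F' i)
    (h1 : Tendsto (fun i => eLpNorm (F i) 2 volume) l (𝓝 0))
    (h2 : Tendsto (fun i => eLpNorm (F' i) 2 volume) l (𝓝 0)) :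
    Tendsto (fun i => h1Norm (F i)) l (𝓝 0) := by
  have h := ((ENNReal.tendsto_toReal zero_ne_top).comp h1).add
    ((ENNReal.tendsto_toReal zero_ne_top).comp h2)
  simp only [toReal_zero, add_zero] at h
  refine squeeze_zero (fun i => h1Norm_nonneg _) (fun i => ?_) h
  refine (hF i).h1Norm_le_eLpNorm.trans (le_of_eq ?_)
  rw [eLpNorm_congr_ae (hd i)]; rfl

theorem tendsto_h1Norm_translate_sub (hv : MemH1 v) (t : ℝ) :
    Tendsto (fun r => h1Norm fun s => v (s + r) - v (s + t)) (𝓝 t) (𝓝 0) := by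
  have h := tendsto_h1Norm_of_eLpNorm (l := 𝓝 (0 : ℝ))
    (F' := fun r s => deriv v (s + r) - deriv v s)
    (fun r => (hv.comp_add r).sub hv) (fun r => by
      filter_upwards [((hv.comp_add r).sub_aux hv).2] with s hs
      rw [hs, deriv_comp_add_const])
    (tendsto_eLpNorm_translate_sub hv.memLp) (tendsto_eLpNorm_translate_sub hv.memLp_deriv)
  have h2 : Tendsto (fun r : ℝ => r - t) (𝓝 t) (𝓝 0) := by
    have : ContinuousAt (fun r : ℝ => r - t) t := by fun_prop
    simpa [ContinuousAt] using this
  refine (h.comp h2).congr fun r => ?_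
  rw [Function.comp_apply, ← h1Norm_comp_add _ t]
  congr 1; ext s; rw [add_add_sub_cancel]

theorem tendsto_h1Norm_diffQuot_sub (hv : MemH1 v) (hv' : MemH1 (deriv v)) (t : ℝ) :
    Tendsto (fun h : ℝ => h1Norm fun s => h⁻¹ • (v (s + (t + h)) - v (s + t)) - deriv v (s + t))
      (𝓝[≠] 0) (𝓝 0) := by
  have e : ∀ (w : ℝ → 𝕜) (h : ℝ), (fun s => h⁻¹ • (w (s + h) - w s) - deriv w s) =
      fun s => ((h⁻¹ : ℝ) : 𝕜) * (w (s + h) - w s) - deriv w s := fun w h => by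
    simp only [RCLike.real_smul_eq_coe_mul]
  have h := tendsto_h1Norm_of_eLpNorm (l := 𝓝[≠] (0 : ℝ))
    (F := fun h s => ((h⁻¹ : ℝ) : 𝕜) * (v (s + h) - v s) - deriv v s)
    (F' := fun h s => ((h⁻¹ : ℝ) : 𝕜) * (deriv v (s + h) - deriv v s) - deriv (deriv v) s)
    (fun h => (((hv.comp_add h).sub hv).const_mul _).sub hv') (fun h => by
      filter_upwards [((hv.comp_add h).sub_aux hv).2,
        ((((hv.comp_add h).sub hv).const_mul ((h⁻¹ : ℝ) : 𝕜)).sub_aux hv').2] with s h1 h2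
      rw [h2, deriv_const_mul_apply, h1, deriv_comp_add_const])
    (by simpa only [e] using tendsto_eLpNorm_diffQuot_sub hv)
    (by simpa only [e] using tendsto_eLpNorm_diffQuot_sub hv')
  refine h.congr fun r => ?_
  rw [← h1Norm_comp_add _ t]
  congr 1; ext s
  rw [RCLike.real_smul_eq_coe_mul, add_assoc]

end MemH1

end translation

/-! ### A Hardy inequality -/

theorem HalfH1.integrableOn_norm_sq_div_speed_sq {f f' : ℝ → 𝕜} (hf : HalfH1 f f') :
    IntegrableOn (fun x => ‖f x‖ ^ 2 / speed x ^ 2) (Ioi 0) := by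
  have cf := hf.prim.continuousOn isOpen_Ioi
  have cs := continuous_speed
  have cΨ : ContinuousOn (fun x => ‖f x‖ ^ 2 / speed x ^ 2) (Ioi 0) :=
    (cf.norm.pow 2).div (by fun_prop) fun x hx => pow_ne_zero _ (speed_pos hx).ne'
  have hk : ∀ x ∈ Ioi (0 : ℝ), HasDerivAt (fun x => Real.exp (-2 * x) / speed x)
      (-(2 * Real.exp (-2 * x)) / speed x ^ 2) x := fun x hx => by
    refine ((hasDerivAt_exp_const_mul (-2) x).fun_div (hasDerivAt_speed x)
      (speed_pos hx).ne').congr_deriv ?_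
    congr 1
    rw [speed]; ring
  have hk' : ContinuousOn (fun x => -(2 * Real.exp (-2 * x)) / speed x ^ 2) (Ioi 0) :=
    ContinuousOn.div (by fun_prop) (by fun_prop) fun x hx => pow_ne_zero _ (speed_pos hx).ne'
  have pB := (hf.prim.norm_sq isOpen_Ioi).mul_real isOpen_Ioi hk hk'
  simp only [RCLike.ofReal_real_eq_id, id] at pB
  have i' := hf.integrableOn_deriv_norm_sq
  have hpt : ∀ x ∈ Ioi (0 : ℝ), Real.exp (-2 * x) * (‖f x‖ ^ 2 / speed x ^ 2) ≤
      ‖f' x‖ ^ 2 - (-(2 * Real.exp (-2 * x)) / speed x ^ 2 * ‖f x‖ ^ 2 +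
        Real.exp (-2 * x) / speed x * (2 * RCLike.re (starRingEnd 𝕜 (f x) * f' x))) := by
    intro x hx
    have hs := speed_pos hx
    have h1 : RCLike.re (starRingEnd 𝕜 (f x) * f' x) ≤ ‖f x‖ * ‖f' x‖ := by
      refine (RCLike.re_le_norm _).trans ?_
      rw [norm_mul, RCLike.norm_conj]
    have he := Real.exp_pos (-2 * x)
    have he1 : Real.exp (-2 * x) ≤ 1 := Real.exp_le_one_iff.2 (by linarith [mem_Ioi.1 hx])
    have h2 : 2 * (‖f x‖ / speed x) * ‖f' x‖ ≤ (‖f x‖ / speed x) ^ 2 + ‖f' x‖ ^ 2 :=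
      two_mul_le_add_sq _ _
    have h3 := mul_le_mul_of_nonneg_left h2 he.le
    have h4 : Real.exp (-2 * x) * ‖f' x‖ ^ 2 ≤ ‖f' x‖ ^ 2 :=
      mul_le_of_le_one_left (sq_nonneg _) he1
    have h5 := mul_le_mul_of_nonneg_left h1 (mul_nonneg two_pos.le (div_nonneg he.le hs.le))
    have h6 : 2 * (Real.exp (-2 * x) / speed x) * (‖f x‖ * ‖f' x‖) =
        Real.exp (-2 * x) * (2 * (‖f x‖ / speed x) * ‖f' x‖) := by ring
    have h7 : -(2 * Real.exp (-2 * x)) / speed x ^ 2 * ‖f x‖ ^ 2 =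
        -2 * (Real.exp (-2 * x) * (‖f x‖ / speed x) ^ 2) := by ring
    rw [← div_pow, h7]
    linarith
  have h01 : IntegrableOn (fun x => Real.exp (-2 * x) * (‖f x‖ ^ 2 / speed x ^ 2)) (Ioc 0 1) := by
    have cΦ : ContinuousOn (fun x => Real.exp (-2 * x) * (‖f x‖ ^ 2 / speed x ^ 2)) (Ioi 0) :=
      ContinuousOn.mul (by fun_prop) cΨ
    have hloc : ∀ δ : ℝ, 0 < δ → IntegrableOn
        (fun x => Real.exp (-2 * x) * (‖f x‖ ^ 2 / speed x ^ 2)) (Ioc δ 1) := fun δ hδ =>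
      ((cΦ.mono fun x hx => hδ.trans_le hx.1).integrableOn_compact isCompact_Icc).mono_set
        Ioc_subset_Icc_self
    have hlim : Tendsto (fun n : ℕ => 1 / ((n : ℝ) + 1)) atTop (𝓝[>] 0) :=
      tendsto_nhdsWithin_iff.2 ⟨tendsto_one_div_add_atTop_nhds_zero_nat,
        Eventually.of_forall fun n => mem_Ioi.2 (by positivity)⟩
    refine integrableOn_Ioc_of_intervalIntegral_norm_bounded_left (l := atTop)
      (a := fun n : ℕ => 1 / ((n : ℝ) + 1)) (I := 1 + ∫ x in Ioi 0, ‖f' x‖ ^ 2)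
      (fun n => hloc _ (by positivity)) (hlim.mono_right nhdsWithin_le_nhds) ?_
    have hB := hlim.eventually (hf.tendsto_norm_sq_div_speed.eventually (gt_mem_nhds one_pos))
    filter_upwards [hB] with n hn
    set δ : ℝ := 1 / ((n : ℝ) + 1)
    have hδ : 0 < δ := by positivity
    have hδ1 : δ ≤ 1 := by
      rw [div_le_one (by positivity)]; linarith [(n.cast_nonneg : (0 : ℝ) ≤ n)]
    obtain ⟨iB, eB⟩ := pB δ hδ 1 (mem_Ioi.2 one_pos)
    have iB := (intervalIntegrable_iff_integrableOn_Ioc_of_le hδ1).1 iB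
    have hsub : Ioc δ 1 ⊆ Ioi 0 := fun x hx => hδ.trans hx.1
    rw [intervalIntegral.integral_of_le hδ1] at eB
    have h1 : ∫ x in Ioc δ 1, ‖Real.exp (-2 * x) * (‖f x‖ ^ 2 / speed x ^ 2)‖ =
        ∫ x in Ioc δ 1, Real.exp (-2 * x) * (‖f x‖ ^ 2 / speed x ^ 2) :=
      integral_congr_ae (Eventually.of_forall fun x => Real.norm_of_nonneg (by positivity))
    have h2 := setIntegral_mono_on (hloc δ hδ) ((i'.mono_set hsub).sub iB) measurableSet_Ioc
      fun x hx => hpt x (hsub hx)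
    simp only [Pi.sub_apply] at h2
    rw [integral_sub (i'.mono_set hsub) iB, eB] at h2
    have h3 : ∫ x in Ioc δ 1, ‖f' x‖ ^ 2 ≤ ∫ x in Ioi 0, ‖f' x‖ ^ 2 :=
      setIntegral_mono_set i' (Eventually.of_forall fun x => sq_nonneg _) hsub.eventuallyLE
    have h4 : Real.exp (-2 * δ) / speed δ * ‖f δ‖ ^ 2 ≤ 1 := by
      refine le_trans (le_of_eq_of_le (by ring) (mul_le_of_le_one_left (div_nonneg (sq_nonneg ‖f δ‖)
        (speed_pos hδ).le) (Real.exp_le_one_iff.2 (by linarith : -2 * δ ≤ 0)))) hn.le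
    have h5 : 0 ≤ Real.exp (-2 * 1) / speed 1 * ‖f 1‖ ^ 2 :=
      mul_nonneg (div_nonneg (Real.exp_pos _).le (speed_pos one_pos).le) (sq_nonneg _)
    rw [h1]
    linarith
  rw [← Ioc_union_Ioi_eq_Ioi (zero_le_one (α := ℝ))]
  refine IntegrableOn.union ?_ ?_
  · refine (h01.const_mul (Real.exp 2)).mono' ((cΨ.mono fun x hx => hx.1).aestronglyMeasurable
      measurableSet_Ioc) ?_
    filter_upwards [ae_restrict_mem measurableSet_Ioc] with x hx
    rw [Real.norm_of_nonneg (by positivity), ← mul_assoc, ← Real.exp_add]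
    exact le_mul_of_one_le_left (by positivity) (Real.one_le_exp (by linarith [hx.2]))
  · have hsub : Ioi (1 : ℝ) ⊆ Ioi 0 := Ioi_subset_Ioi zero_le_one
    refine ((hf.integrableOn_norm_sq.mono_set hsub).div_const (speed 1 ^ 2)).mono'
      ((cΨ.mono hsub).aestronglyMeasurable measurableSet_Ioi) ?_
    filter_upwards [ae_restrict_mem measurableSet_Ioi] with x hx
    rw [Real.norm_of_nonneg (by positivity)]
    have h1 := speed_mono (le_of_lt (mem_Ioi.1 hx))
    have h2 := speed_pos one_pos
    gcongr

/-! ### The flow of `x' = 1 - e^{-2x}` straightened -/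

/-- The inverse of the travel time. -/
def position (s : ℝ) : ℝ := Real.log (1 + Real.exp (2 * s)) / 2

theorem position_pos (s : ℝ) : 0 < position s :=
  half_pos (Real.log_pos (by linarith [Real.exp_pos (2 * s)]))

theorem exp_two_mul_position (s : ℝ) : Real.exp (2 * position s) = 1 + Real.exp (2 * s) := by
  rw [position, mul_div_cancel₀ _ two_ne_zero, Real.exp_log (by positivity)]

theorem travelTime_position (s : ℝ) : travelTime (position s) = s := by
  have h := one_add_exp_travelTime (position_pos s)
  rw [exp_two_mul_position, add_right_inj, Real.exp_eq_exp] at h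
  linarith

theorem position_travelTime {x : ℝ} (hx : 0 < x) : position (travelTime x) = x := by
  rw [position, one_add_exp_travelTime hx, Real.log_exp]; ring

theorem hasDerivAt_position (s : ℝ) : HasDerivAt position (speed (position s)) s := by
  have h := (((hasDerivAt_exp_const_mul 2 s).const_add 1).log (by positivity)).div_const 2
  refine h.congr_deriv ?_
  have h2 : speed (position s) = 1 - (1 + Real.exp (2 * s))⁻¹ := by
    rw [speed, neg_mul, Real.exp_neg, exp_two_mul_position]
  rw [h2]
  have : 1 + Real.exp (2 * s) ≠ 0 := by positivity
  field_simp
  ring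

theorem injOn_travelTime : InjOn travelTime (Ioi 0) := fun x hx y hy h => by
  rw [← position_travelTime hx, h, position_travelTime hy]

theorem image_travelTime : travelTime '' Ioi 0 = univ :=
  eq_univ_of_forall fun s => ⟨position s, position_pos s, travelTime_position s⟩

theorem integrable_iff_travelTime (F : ℝ → ℝ) :
    Integrable F ↔ IntegrableOn (fun x => (speed x)⁻¹ * F (travelTime x)) (Ioi 0) := by
  rw [← integrableOn_univ, ← image_travelTime, integrableOn_image_iff_integrableOn_abs_deriv_smul
    measurableSet_Ioi (fun x hx => (hasDerivAt_travelTime hx).hasDerivWithinAt) injOn_travelTime]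
  refine integrableOn_congr_fun (fun x hx => ?_) measurableSet_Ioi
  rw [abs_of_pos (inv_pos.2 (speed_pos hx)), smul_eq_mul]

theorem integral_travelTime (F : ℝ → ℝ) :
    ∫ x in Ioi 0, (speed x)⁻¹ * F (travelTime x) = ∫ s, F s := by
  rw [← setIntegral_univ (f := F), ← image_travelTime, integral_image_eq_integral_abs_deriv_smul
    measurableSet_Ioi (fun x hx => (hasDerivAt_travelTime hx).hasDerivWithinAt) injOn_travelTime]
  refine setIntegral_congr_fun measurableSet_Ioi fun x hx => ?_
  simp only [abs_of_pos (inv_pos.2 (speed_pos hx)), smul_eq_mul]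

/-! ### For `b = 3` the operator is conjugate to the translation generator of `H¹(ℝ)` -/

/-- The conjugation from functions on the line to functions on the half-line. -/
def toHalfLine (g : ℝ → 𝕜) (x : ℝ) : 𝕜 := (Real.sqrt (speed x) : 𝕜) * g (travelTime x)

/-- The conjugation from functions on the half-line to functions on the line. -/
def toLine (v : ℝ → 𝕜) (s : ℝ) : 𝕜 :=
  (((Real.sqrt (speed (position s)))⁻¹ : ℝ) : 𝕜) * v (position s)

theorem toHalfLine_toLine (v : ℝ → 𝕜) {x : ℝ} (hx : 0 < x) : toHalfLine (toLine v) x = v x := by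
  have := (Real.sqrt_pos.2 (speed_pos hx)).ne'
  rw [toHalfLine, toLine, position_travelTime hx, ← mul_assoc, ← RCLike.ofReal_mul,
    mul_inv_cancel₀ this, RCLike.ofReal_one, one_mul]

theorem hasDerivAt_sqrt_speed {x : ℝ} (hx : 0 < x) :
    HasDerivAt (fun x => Real.sqrt (speed x)) (Real.exp (-2 * x) / Real.sqrt (speed x)) x := by
  refine ((hasDerivAt_speed x).sqrt (speed_pos hx).ne').congr_deriv ?_
  rw [mul_div_mul_left _ _ two_ne_zero]

theorem continuousOn_deriv_sqrt_speed :
    ContinuousOn (fun x => Real.exp (-2 * x) / Real.sqrt (speed x)) (Ioi 0) := by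
  have := continuous_speed
  exact ContinuousOn.div (by fun_prop) (by fun_prop) fun x hx =>
    (Real.sqrt_pos.2 (speed_pos hx)).ne'

theorem sqrt_speed_mul_inv {x : ℝ} (hx : 0 < x) :
    Real.sqrt (speed x) * (speed x)⁻¹ = (Real.sqrt (speed x))⁻¹ := by
  have h := Real.mul_self_sqrt (speed_pos hx).le
  refine eq_inv_of_mul_eq_one_left ?_
  rw [mul_right_comm, h, mul_inv_cancel₀ (speed_pos hx).ne']

theorem measurable_travelTime : Measurable travelTime := by
  have := continuous_speed.measurable
  unfold travelTime
  fun_prop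

theorem tendsto_travelTime : Tendsto travelTime (𝓝[>] 0) atBot := by
  have h1 : Tendsto speed (𝓝[>] 0) (𝓝[>] 0) := by
    refine tendsto_nhdsWithin_iff.2 ⟨?_, eventually_nhdsWithin_of_forall fun x hx => speed_pos hx⟩
    have := (continuous_speed.tendsto 0).mono_left (nhdsWithin_le_nhds (s := Ioi 0))
    rwa [speed_zero] at this
  exact ((continuous_id.tendsto (0 : ℝ)).mono_left nhdsWithin_le_nhds).add_atBot
    ((Real.tendsto_log_nhdsGT_zero.comp h1).atBot_div_const two_pos)

theorem MemH1.tendsto_atBot {v : ℝ → 𝕜} (hv : MemH1 v) : Tendsto v atBot (𝓝 0) := by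
  have h1 := hv.comp_neg
  have h2 := (h1.isPrimitiveOn.mono (subset_univ (Ioi 0))).norm_sq isOpen_Ioi
  have h3 := h2.tendsto_atTop_zero (h1.memLp.restrict _).norm.integrable_sq
    (((h1.memLp.restrict _).integrable_conj_mul (h1.memLp_deriv.restrict _)).re.const_mul 2)
  have h4 : Tendsto (fun x => ‖v (-x)‖) atTop (𝓝 0) := by
    have := h3.sqrt
    simpa using this
  have h5 := (tendsto_zero_iff_norm_tendsto_zero.2 h4).comp tendsto_neg_atBot_atTop
  refine h5.congr fun x => ?_
  simp

theorem IsPrimitiveOn.toHalfLine {g g' : ℝ → 𝕜} (hg : IsPrimitiveOn g g' univ) :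
    IsPrimitiveOn (toHalfLine g) (fun x => (((Real.sqrt (speed x))⁻¹ : ℝ) : 𝕜) *
      (g' (travelTime x) + (Real.exp (-2 * x) : 𝕜) * g (travelTime x))) (Ioi 0) := by
  have h1 := hg.comp_of_deriv_nonneg (T := Ioi 0) (fun x hx => hasDerivAt_travelTime hx)
    (fun x hx => (inv_pos.2 (speed_pos hx)).le) (mapsTo_univ _ _)
  refine (h1.mul_real isOpen_Ioi (fun x hx => hasDerivAt_sqrt_speed hx)
    continuousOn_deriv_sqrt_speed).congr (fun x _ => rfl) (Eventually.of_forall fun x hx => ?_)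
  rw [RCLike.real_smul_eq_coe_mul, ← mul_assoc, ← RCLike.ofReal_mul, sqrt_speed_mul_inv hx,
    div_eq_mul_inv]
  push_cast
  ring

theorem norm_sq_toHalfLine (g : ℝ → 𝕜) {x : ℝ} (hx : 0 < x) :
    ‖toHalfLine g x‖ ^ 2 = speed x * ‖g (travelTime x)‖ ^ 2 := by
  rw [toHalfLine, norm_mul, mul_pow, RCLike.norm_ofReal, sq_abs, Real.sq_sqrt (speed_pos hx).le]

theorem norm_sq_deriv_toHalfLine_le (y z : 𝕜) {x : ℝ} (hx : 0 < x) :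
    ‖(((Real.sqrt (speed x))⁻¹ : ℝ) : 𝕜) * (y + (Real.exp (-2 * x) : 𝕜) * z)‖ ^ 2 ≤
      (speed x)⁻¹ * (2 * ‖y‖ ^ 2 + 2 * ‖z‖ ^ 2) := by
  rw [norm_mul, mul_pow, RCLike.norm_ofReal, sq_abs, inv_pow, Real.sq_sqrt (speed_pos hx).le]
  refine mul_le_mul_of_nonneg_left ?_ (inv_pos.2 (speed_pos hx)).le
  have h1 : ‖(Real.exp (-2 * x) : 𝕜) * z‖ ≤ ‖z‖ := by
    rw [norm_mul, RCLike.norm_ofReal, abs_of_pos (Real.exp_pos _)]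
    exact mul_le_of_le_one_left (norm_nonneg _) (Real.exp_le_one_iff.2 (by linarith))
  have h2 := (norm_add_le y ((Real.exp (-2 * x) : 𝕜) * z)).trans (add_le_add_right h1 ‖y‖)
  have h3 := pow_le_pow_left₀ (norm_nonneg _) h2 2
  nlinarith [sq_nonneg (‖y‖ - ‖z‖)]

theorem MemH1.halfH1_toHalfLine {g : ℝ → 𝕜} (hg : MemH1 g) :
    HalfH1 (toHalfLine g) (fun x => (((Real.sqrt (speed x))⁻¹ : ℝ) : 𝕜) *
      (deriv g (travelTime x) + (Real.exp (-2 * x) : 𝕜) * g (travelTime x))) ∧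
    h1Norm (rightPart (toHalfLine g)) ≤ 2 * h1Norm g := by
  have cs := continuous_speed
  have i0 := hg.memLp.norm.integrable_sq
  have i1 := hg.memLp_deriv.norm.integrable_sq
  have j0 := (integrable_iff_travelTime _).1 i0
  have i2 : Integrable (fun s => 2 * ‖deriv g s‖ ^ 2 + 2 * ‖g s‖ ^ 2) :=
    (i1.const_mul 2).add (i0.const_mul 2)
  have j2 := (integrable_iff_travelTime _).1 i2
  have b0 : ∀ x ∈ Ioi (0 : ℝ), ‖toHalfLine g x‖ ^ 2 ≤ (speed x)⁻¹ * ‖g (travelTime x)‖ ^ 2 := by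
    intro x hx
    rw [norm_sq_toHalfLine g hx]
    exact mul_le_mul_of_nonneg_right ((speed_lt_one x).le.trans
      (one_le_inv_iff₀.2 ⟨speed_pos hx, (speed_lt_one x).le⟩)) (sq_nonneg _)
  have hprim := hg.isPrimitiveOn.toHalfLine
  have m0 : AEStronglyMeasurable (toHalfLine g) (volume.restrict (Ioi 0)) :=
    (hprim.continuousOn isOpen_Ioi).aestronglyMeasurable measurableSet_Ioi
  have m1 : Measurable (fun x => (((Real.sqrt (speed x))⁻¹ : ℝ) : 𝕜) *
      (deriv g (travelTime x) + (Real.exp (-2 * x) : 𝕜) * g (travelTime x))) := by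
    have h1 := (measurable_deriv g).comp measurable_travelTime
    have h2 := hg.continuous.measurable.comp measurable_travelTime
    have h3 : Measurable fun x => (((Real.sqrt (speed x))⁻¹ : ℝ) : 𝕜) :=
      RCLike.measurable_ofReal.comp (cs.sqrt.measurable.inv)
    have h4 : Measurable fun x => (Real.exp (-2 * x) : 𝕜) :=
      RCLike.measurable_ofReal.comp (by fun_prop)
    exact h3.mul (h1.add (h4.mul h2))
  have l0 : MemLp (toHalfLine g) 2 (volume.restrict (Ioi 0)) := by
    refine (memLp_two_iff_integrable_sq_norm m0).2 (j0.mono' (m0.norm.pow 2) ?_)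
    filter_upwards [ae_restrict_mem measurableSet_Ioi] with x hx
    rw [Real.norm_of_nonneg (by positivity)]
    exact b0 x hx
  have l1 : MemLp (fun x => (((Real.sqrt (speed x))⁻¹ : ℝ) : 𝕜) *
      (deriv g (travelTime x) + (Real.exp (-2 * x) : 𝕜) * g (travelTime x))) 2
      (volume.restrict (Ioi 0)) := by
    refine (memLp_two_iff_integrable_sq_norm m1.aestronglyMeasurable).2
      (j2.mono' (m1.norm.pow_const 2).aestronglyMeasurable ?_)
    filter_upwards [ae_restrict_mem measurableSet_Ioi] with x hx
    rw [Real.norm_of_nonneg (by positivity)]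
    exact norm_sq_deriv_toHalfLine_le _ _ hx
  have t0 : Tendsto (toHalfLine g) (𝓝[>] 0) (𝓝 0) := by
    have h := (hg.tendsto_atBot.comp tendsto_travelTime).norm
    rw [norm_zero] at h
    refine squeeze_zero_norm (fun x => ?_) h
    rw [toHalfLine, norm_mul, RCLike.norm_ofReal, abs_of_nonneg (Real.sqrt_nonneg _)]
    exact mul_le_of_le_one_left (norm_nonneg _) (Real.sqrt_le_one.2 (speed_lt_one x).le)
  have H : HalfH1 (toHalfLine g) _ := ⟨hprim, l0, l1, t0⟩
  refine ⟨H, le_of_sq_le_sq ?_ (mul_nonneg two_pos.le (h1Norm_nonneg g))⟩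
  have e1 : ∫ x in Ioi 0, ‖toHalfLine g x‖ ^ 2 ≤ ∫ s, ‖g s‖ ^ 2 := by
    rw [← integral_travelTime]
    exact setIntegral_mono_on H.integrableOn_norm_sq j0 measurableSet_Ioi b0
  have e2 := setIntegral_mono_on H.integrableOn_deriv_norm_sq j2 measurableSet_Ioi
    fun x hx => norm_sq_deriv_toHalfLine_le (deriv g (travelTime x)) (g (travelTime x)) hx
  rw [integral_travelTime (fun s => 2 * ‖deriv g s‖ ^ 2 + 2 * ‖g s‖ ^ 2),
    integral_add (i1.const_mul 2) (i0.const_mul 2), integral_const_mul, integral_const_mul] at e2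
  have n0 : 0 ≤ ∫ s, ‖g s‖ ^ 2 := integral_nonneg fun s => sq_nonneg _
  have n1 : 0 ≤ ∫ s, ‖deriv g s‖ ^ 2 := integral_nonneg fun s => sq_nonneg _
  rw [H.h1Norm_rightPart_sq, mul_pow, h1Norm, Real.sq_sqrt (add_nonneg n0 n1)]
  linarith

theorem memH1_toLine {v : ℝ → 𝕜} (hv : MemH1Zero v) : MemH1 (toLine v) := by
  have cs := continuous_speed
  have hr : ∀ x ∈ Ioi (0 : ℝ), HasDerivAt (fun x => (Real.sqrt (speed x))⁻¹)
      (-(Real.exp (-2 * x) / Real.sqrt (speed x)) / Real.sqrt (speed x) ^ 2) x := fun x hx =>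
    (hasDerivAt_sqrt_speed hx).fun_inv (Real.sqrt_pos.2 (speed_pos hx)).ne'
  have hr' : ContinuousOn (fun x => -(Real.exp (-2 * x) / Real.sqrt (speed x)) /
      Real.sqrt (speed x) ^ 2) (Ioi 0) :=
    continuousOn_deriv_sqrt_speed.neg.div (by fun_prop) fun x hx =>
      pow_ne_zero _ (Real.sqrt_pos.2 (speed_pos hx)).ne'
  have h1 := (hv.halfH1.prim.mul_real isOpen_Ioi hr hr').comp_of_deriv_nonneg (T := univ)
    (fun s _ => hasDerivAt_position s) (fun s _ => (speed_pos (position_pos s)).le)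
    (fun s _ => position_pos s)
  have cp : Continuous position :=
    continuous_iff_continuousAt.2 fun s => (hasDerivAt_position s).continuousAt
  have hD := hv.halfH1.integrableOn_norm_sq_div_speed_sq
  have c0 : Continuous (toLine v) := by
    refine (RCLike.continuous_ofReal.comp (((cs.comp cp).sqrt).inv₀ fun s =>
      (Real.sqrt_pos.2 (speed_pos (position_pos s))).ne')).mul (hv.1.continuous.comp cp)
  have e : ∀ s, speed (position s) •
      (((-(Real.exp (-2 * position s) / Real.sqrt (speed (position s))) /
        Real.sqrt (speed (position s)) ^ 2 : ℝ) : 𝕜) * v (position s) +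
        (((Real.sqrt (speed (position s)))⁻¹ : ℝ) : 𝕜) * deriv v (position s)) =
      (((Real.sqrt (speed (position s)))⁻¹ : ℝ) : 𝕜) *
        (speed (position s) * deriv v (position s) -
          (Real.exp (-2 * position s) : 𝕜) * v (position s)) := fun s => by
    have hs := speed_pos (position_pos s)
    have h2 : speed (position s) * (-(Real.exp (-2 * position s) / Real.sqrt (speed (position s))) /
        Real.sqrt (speed (position s)) ^ 2) =
        -((Real.sqrt (speed (position s)))⁻¹ * Real.exp (-2 * position s)) := by
      rw [Real.sq_sqrt hs.le]
      field_simp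
    rw [RCLike.real_smul_eq_coe_mul, mul_add, ← mul_assoc, ← RCLike.ofReal_mul, h2]
    push_cast
    ring
  simp only [e] at h1
  have m1 : Measurable fun s => (((Real.sqrt (speed (position s)))⁻¹ : ℝ) : 𝕜) *
        (speed (position s) * deriv v (position s) -
          (Real.exp (-2 * position s) : 𝕜) * v (position s)) := by
    have k1 := (measurable_deriv v).comp cp.measurable
    have k2 := (hv.1.continuous.comp cp).measurable
    have k3 : Measurable fun s => (((Real.sqrt (speed (position s)))⁻¹ : ℝ) : 𝕜) :=
      RCLike.measurable_ofReal.comp ((cs.comp cp).sqrt.measurable.inv)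
    have k4 : Measurable fun s => (Real.exp (-2 * position s) : 𝕜) :=
      RCLike.measurable_ofReal.comp (by fun_prop)
    have k5 : Measurable fun s => (speed (position s) : 𝕜) :=
      RCLike.measurable_ofReal.comp (cs.comp cp).measurable
    exact k3.mul ((k5.mul k1).sub (k4.mul k2))
  refine (MemH1.of_isPrimitiveOn h1 ?_ ?_).1
  · refine (memLp_two_iff_integrable_sq_norm c0.aestronglyMeasurable).2
      ((integrable_iff_travelTime _).2 (hD.congr_fun (fun x hx => ?_) measurableSet_Ioi))
    have hs := speed_pos hx
    rw [toLine, position_travelTime hx, norm_mul, mul_pow, RCLike.norm_ofReal, sq_abs, inv_pow,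
      Real.sq_sqrt hs.le]
    field_simp
  · refine (memLp_two_iff_integrable_sq_norm m1.aestronglyMeasurable).2
      ((integrable_iff_travelTime _).2 ?_)
    refine ((hv.halfH1.integrableOn_deriv_norm_sq.const_mul 2).add (hD.const_mul 2)).mono' ?_ ?_
    · exact (cs.measurable.inv.mul ((m1.comp measurable_travelTime).norm.pow_const
        2)).aestronglyMeasurable
    · filter_upwards [ae_restrict_mem measurableSet_Ioi] with x hx
      have hs := speed_pos hx
      have hinv := inv_pos.2 hs
      rw [Real.norm_of_nonneg (by positivity), position_travelTime hx, sub_eq_add_neg, ← mul_neg]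
      refine (mul_le_mul_of_nonneg_left (norm_sq_deriv_toHalfLine_le _ _ hx) hinv.le).trans
        (le_of_eq ?_)
      rw [norm_neg, norm_mul, RCLike.norm_ofReal, mul_pow, sq_abs]
      simp only [Pi.add_apply]
      field_simp

/-! ### Solutions for `b = 3` -/

theorem hasDerivAt_toHalfLine {g : ℝ → 𝕜} {g' : 𝕜} {x : ℝ} (hx : 0 < x)
    (hg : HasDerivAt g g' (travelTime x)) :
    HasDerivAt (toHalfLine g) ((((Real.sqrt (speed x))⁻¹ : ℝ) : 𝕜) *
      (g' + (Real.exp (-2 * x) : 𝕜) * g (travelTime x))) x := by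
  refine ((hasDerivAt_ofReal (hasDerivAt_sqrt_speed hx)).fun_mul
    (hg.scomp x (hasDerivAt_travelTime hx))).congr_deriv ?_
  have h := sqrt_speed_mul_inv hx
  rw [RCLike.real_smul_eq_coe_mul, ← mul_assoc, ← RCLike.ofReal_mul, h, div_eq_mul_inv]
  simp only [Function.comp_apply]
  push_cast
  ring

theorem linOp_toHalfLine {g : ℝ → 𝕜} (hg : MemH1 g) (hg' : MemH1 (deriv g))
    (hd : ∀ s, HasDerivAt g (deriv g s) s) :
    MemDom (rightPart (toHalfLine g)) ∧
      linOp 3 (rightPart (toHalfLine g)) = rightPart (toHalfLine (deriv g)) := by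
  obtain ⟨H, -⟩ := hg.halfH1_toHalfLine
  obtain ⟨H', -⟩ := hg'.halfH1_toHalfLine
  have hdd := fun x (hx : 0 < x) => hasDerivAt_toHalfLine hx (hd (travelTime x))
  have e : ∀ x, 0 < x → (speed x : 𝕜) * ((((Real.sqrt (speed x))⁻¹ : ℝ) : 𝕜) *
      (deriv g (travelTime x) + (Real.exp (-2 * x) : 𝕜) * g (travelTime x))) =
      toHalfLine (deriv g) x + (Real.exp (-2 * x) : 𝕜) * toHalfLine g x := fun x hx => by
    have h : speed x * (Real.sqrt (speed x))⁻¹ = Real.sqrt (speed x) := by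
      rw [← sqrt_speed_mul_inv hx, mul_left_comm, mul_inv_cancel₀ (speed_pos hx).ne', mul_one]
    rw [← mul_assoc, ← RCLike.ofReal_mul, h, toHalfLine, toHalfLine]
    ring
  have hdom : MemDom (rightPart (toHalfLine g)) := memDom_rightPart H hdd
    ((H'.add (halfH1_exp_mul H)).congr (fun x hx => (e x hx).symm)
      (Eventually.of_forall fun x _ => rfl))
  refine ⟨hdom, ?_⟩
  ext x
  rcases le_or_gt x 0 with hx | hx
  · rw [linOp_rightPart_of_nonpos hdom.memH1.memLp 3 hx, rightPart_of_nonpos _ hx]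
  · rw [linOp_eq_flux hdom.memH1.memLp 3 hx, flux_rightPart hdd, rightPart_of_pos _ hx,
      rightPart_of_pos _ hx, rightPart_of_pos _ hx, e x hx]
    push_cast
    ring

theorem isSolution_toHalfLine {g : ℝ → 𝕜} (hg : MemH1 g) (hg' : MemH1 (deriv g))
    (hd : ∀ s, HasDerivAt g (deriv g s) s) :
    IsSolution 3 fun t => rightPart (toHalfLine fun s => g (s + t)) := by
  have ed : ∀ t, deriv (fun s => g (s + t)) = fun s => deriv g (s + t) := fun t =>
    funext fun s => deriv_comp_add_const g t s
  have hL : ∀ t, MemDom (rightPart (toHalfLine fun s => g (s + t))) ∧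
      linOp 3 (rightPart (toHalfLine fun s => g (s + t))) =
        rightPart (toHalfLine fun s => deriv g (s + t)) := fun t => by
    have := linOp_toHalfLine (hg.comp_add t) (by rw [ed]; exact hg'.comp_add t) (fun s => by
      rw [ed]; exact (hd (s + t)).comp_add_const s t)
    rwa [ed] at this
  have hsub : ∀ f h : ℝ → 𝕜, (fun x => rightPart (toHalfLine f) x - rightPart (toHalfLine h) x) =
      rightPart (toHalfLine fun s => f s - h s) := fun f h => by
    ext x
    rcases le_or_gt x 0 with hx | hx
    · simp only [rightPart_of_nonpos _ hx, sub_zero]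
    · simp only [rightPart_of_pos _ hx, toHalfLine, mul_sub]
  have hsmul : ∀ (c : ℝ) (f : ℝ → 𝕜), (fun x => c • rightPart (toHalfLine f) x) =
      rightPart (toHalfLine fun s => c • f s) := fun c f => by
    ext x
    rcases le_or_gt x 0 with hx | hx
    · simp only [rightPart_of_nonpos _ hx, smul_zero]
    · simp only [rightPart_of_pos _ hx, toHalfLine, mul_smul_comm]
  have cont : ∀ {f : ℝ → 𝕜} (t : ℝ), MemH1 f → Tendsto (fun r => h1Norm fun x =>
      rightPart (toHalfLine fun s => f (s + r)) x - rightPart (toHalfLine fun s => f (s + t)) x)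
      (𝓝 t) (𝓝 0) := fun {f} t hf => by
    have h := (hf.tendsto_h1Norm_translate_sub t).const_mul 2
    rw [mul_zero] at h
    refine squeeze_zero (fun r => h1Norm_nonneg _) (fun r => ?_) h
    rw [hsub]
    exact ((hf.comp_add r).sub (hf.comp_add t)).halfH1_toHalfLine.2
  refine .of_linOp (fun t => (hL t).1) (fun t => cont t hg) (fun t => ?_) fun t => ?_
  · simp only [(hL _).2]
    exact cont t hg'
  · have h := (hg.tendsto_h1Norm_diffQuot_sub hg' t).const_mul 2
    rw [mul_zero] at h
    refine squeeze_zero (fun r => h1Norm_nonneg _) (fun r => ?_) h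
    have e : (fun ξ => r⁻¹ • (rightPart (toHalfLine fun s => g (s + (t + r))) ξ -
        rightPart (toHalfLine fun s => g (s + t)) ξ) -
        linOp 3 (rightPart (toHalfLine fun s => g (s + t))) ξ) =
        rightPart (toHalfLine fun s => r⁻¹ • (g (s + (t + r)) - g (s + t)) - deriv g (s + t)) := by
      rw [← hsub (fun s => r⁻¹ • (g (s + (t + r)) - g (s + t))) fun s => deriv g (s + t),
        ← hsmul, ← hsub, (hL t).2]
    rw [e]
    have hm : MemH1 fun s => r⁻¹ • (g (s + (t + r)) - g (s + t)) - deriv g (s + t) := by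
      simp only [RCLike.real_smul_eq_coe_mul]
      exact (((hg.comp_add _).sub (hg.comp_add t)).const_mul _).sub (hg'.comp_add t)
    exact hm.halfH1_toHalfLine.2

theorem MemDom.hasDerivAt_toLine {v : ℝ → 𝕜} (hv : MemDom v) (s : ℝ) :
    HasDerivAt (toLine v) (toLine (linOp 3 v) s) s := by
  have hx := position_pos s
  have h1 := (hasDerivAt_sqrt_speed hx).fun_inv (Real.sqrt_pos.2 (speed_pos hx)).ne'
  have h2 := (hasDerivAt_ofReal (𝕜 := 𝕜) h1).fun_mul (hv.hasDerivAt hx.ne')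
  refine (h2.scomp s (hasDerivAt_position s)).congr_deriv ?_
  rw [toLine, linOp_eq_flux hv.memH1.memLp 3 hx, flux, ← speed_eq_peakon hx.le,
    RCLike.real_smul_eq_coe_mul, RCLike.real_smul_eq_coe_mul, Real.sq_sqrt (speed_pos hx).le]
  have h3 := speed_cast_ne (𝕜 := 𝕜) hx
  have h4 : (Real.sqrt (speed (position s)) : 𝕜) ≠ 0 :=
    RCLike.ofReal_ne_zero.2 (Real.sqrt_pos.2 (speed_pos hx)).ne'
  push_cast
  field_simp
  ring

theorem exists_isSolution_rightPart {v : ℝ → 𝕜} (hv : MemDom v) :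
    ∃ u : ℝ → ℝ → 𝕜, IsSolution 3 u ∧ u 0 = rightPart v := by
  have hd := hv.hasDerivAt_toLine
  have e : deriv (toLine v) = toLine (linOp 3 v) := funext fun s => (hd s).deriv
  refine ⟨_, isSolution_toHalfLine (memH1_toLine hv.1)
    (by rw [e]; exact memH1_toLine (hv.memH1Zero_linOp 3)) (fun s => by rw [e]; exact hd s), ?_⟩
  simp only [add_zero]
  exact rightPart_congr fun x hx => toHalfLine_toLine v hx

theorem exists_isSolution {v : ℝ → 𝕜} (hv : MemDom v) :
    ∃ u : ℝ → ℝ → 𝕜, IsSolution 3 u ∧ u 0 = v := by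
  obtain ⟨u₁, h₁, e₁⟩ := exists_isSolution_rightPart hv
  obtain ⟨u₂, h₂, e₂⟩ := exists_isSolution_rightPart hv.comp_neg
  refine ⟨_, h₁.add h₂.reflect, ?_⟩
  simp only [neg_zero, e₁, e₂]
  exact (eq_rightPart_add hv.1.2).symm

theorem linearlyStable_three : LinearlyStable 𝕜 3 := fun _ hv => by
  obtain ⟨u, hu, e⟩ := exists_isSolution hv
  refine ⟨1, one_pos, u, hu, e, fun u' hu' e' => hu.eq_of_initial hu' (e'.trans e.symm),
    fun t _ => ?_⟩
  rw [one_mul, hu.h1Norm_eq t, e]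

/-! ### Instability -/

theorem not_bounded_of_exp_le {c D r : ℝ} (hc : 0 < c) (hr : 0 < r)
    (h : ∀ t : ℝ, 0 < t → c * Real.exp (r * t) ≤ D) : False := by
  have h1 : Tendsto (fun t : ℝ => c * Real.exp (r * t)) atTop atTop :=
    (Real.tendsto_exp_atTop.comp (tendsto_id.const_mul_atTop hr)).const_mul_atTop hc
  obtain ⟨t, h2, h3⟩ := ((h1.eventually_gt_atTop D).and (eventually_gt_atTop 0)).exists
  exact (h t h3).not_gt h2

theorem not_linearlyStable_of_growth {b c r : ℝ} (hc : 0 < c) (hr : 0 < r) {u : ℝ → ℝ → 𝕜}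
    (hu : IsSolution b u) (h : ∀ t : ℝ, c * Real.exp (r * t) ≤ h1Norm (u t)) :
    ¬LinearlyStable 𝕜 b := fun hs => by
  obtain ⟨C, -, v, -, -, huniq, hb⟩ := hs (u 0) (hu.mem_dom 0)
  refine not_bounded_of_exp_le hc hr (D := C * h1Norm (u 0)) fun t ht => (h t).trans ?_
  rw [huniq u hu rfl]
  have := hb t ht
  rwa [huniq u hu rfl] at this

theorem exists_growing_eigenfunction {b : ℝ} {μ : 𝕜} (h0 : 0 < RCLike.re μ)
    (h1 : RCLike.re μ < 3 - b) :
    ∃ w : ℝ → 𝕜, IsEigenfunction b μ w ∧ 0 < h1Norm w ∧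
      IsSolution b (fun t ξ => NormedSpace.exp ((t : 𝕜) * μ) * w ξ) ∧
      ∀ t : ℝ, h1Norm (fun ξ => NormedSpace.exp ((t : 𝕜) * μ) * w ξ) =
        Real.exp (RCLike.re μ * t) * h1Norm w := by
  obtain ⟨w, hw⟩ := exists_isEigenfunction h0 h1
  exact ⟨w, hw, hw.1.memH1.h1Norm_pos hw.2.1, hw.isSolution, h1Norm_exp_mul μ w⟩

theorem exists_growing_adjoint_eigenfunction {b : ℝ} {μ : 𝕜} (h0 : 0 < RCLike.re μ)
    (h1 : RCLike.re μ < b - 3) :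
    ∃ w : ℝ → 𝕜, IsAdjointEigenfunction b μ w ∧ 0 < h1Norm w ∧
      (∀ u : ℝ → ℝ → 𝕜, IsSolution b u → ∀ t : ℝ,
        h1Inner w (u t) = NormedSpace.exp ((t : 𝕜) * (starRingEnd 𝕜) μ) * h1Inner w (u 0)) ∧
      ∃ u : ℝ → ℝ → 𝕜, IsSolution b u ∧ h1Inner w (u 0) ≠ 0 ∧
        ∃ c : ℝ, 0 < c ∧ ∀ t : ℝ, c * Real.exp (RCLike.re μ * t) ≤ h1Norm (u t) := by
  have hw := isAdjointEigenfunction_rightPart (b := b) (μ := μ) rfl h0 h1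
  obtain ⟨u, hu, hne⟩ := exists_growing_solution (b := b) (μ := μ) rfl h0 h1
  set w := rightPart (weightPow (((b - 2 : ℝ) - μ) / 2) μ)
  have hpos := hw.1.1.h1Norm_pos hw.2.1
  refine ⟨w, hw, hpos, fun u hu => hw.h1Inner_eq hu, u, hu, hne, ‖h1Inner w (u 0)‖ / h1Norm w,
    div_pos (norm_pos_iff.2 hne) hpos, fun t => ?_⟩
  have h2 := hw.1.1.norm_h1Inner_le (hu.mem_dom t).memH1
  rw [hw.h1Inner_eq hu t, norm_mul, norm_exp_eq, RCLike.re_ofReal_mul, RCLike.conj_re,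
    mul_comm t] at h2
  rw [div_mul_eq_mul_div, div_le_iff₀ hpos]
  linarith

theorem linearlyStable_iff {b : ℝ} : LinearlyStable 𝕜 b ↔ b = 3 := by
  refine ⟨fun hs => ?_, fun h => h ▸ linearlyStable_three⟩
  by_contra hne
  have hre : ∀ r : ℝ, RCLike.re ((r : ℝ) : 𝕜) = r := fun r => RCLike.ofReal_re r
  rcases lt_or_gt_of_ne hne with h | h
  · obtain ⟨w, -, hw, hu, hn⟩ := exists_growing_eigenfunction (b := b)
      (μ := (((3 - b) / 2 : ℝ) : 𝕜)) (by rw [hre]; linarith) (by rw [hre]; linarith)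
    refine not_linearlyStable_of_growth hw (r := (3 - b) / 2) (by linarith) hu (fun t => ?_) hs
    rw [hn t, hre, mul_comm]
  · obtain ⟨w, -, -, -, u, hu, -, c, hc, hn⟩ := exists_growing_adjoint_eigenfunction (b := b)
      (μ := (((b - 3) / 2 : ℝ) : 𝕜)) (by rw [hre]; linarith) (by rw [hre]; linarith)
    refine not_linearlyStable_of_growth hc (r := (b - 3) / 2) (by linarith) hu (fun t => ?_) hs
    have := hn t
    rwa [hre] at this

end Novikov

end

theorem mainTheorem9 {𝕜 : Type*} [RCLike 𝕜] (b : ℝ) :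
    (Novikov.LinearlyStable 𝕜 b ↔ b = 3) ∧
    (∀ μ : 𝕜, 0 < RCLike.re μ → RCLike.re μ < 3 - b →
      ∃ w : ℝ → 𝕜, Novikov.IsEigenfunction b μ w ∧ 0 < Novikov.h1Norm w ∧
        Novikov.IsSolution b (fun t ξ => NormedSpace.exp ((t : 𝕜) * μ) * w ξ) ∧
        ∀ t : ℝ, Novikov.h1Norm (fun ξ => NormedSpace.exp ((t : 𝕜) * μ) * w ξ) =
          Real.exp (RCLike.re μ * t) * Novikov.h1Norm w) ∧
    (∀ μ : 𝕜, 0 < RCLike.re μ → RCLike.re μ < b - 3 →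
      ∃ w : ℝ → 𝕜, Novikov.IsAdjointEigenfunction b μ w ∧ 0 < Novikov.h1Norm w ∧
        (∀ u : ℝ → ℝ → 𝕜, Novikov.IsSolution b u → ∀ t : ℝ,
          Novikov.h1Inner w (u t) =
            NormedSpace.exp ((t : 𝕜) * (starRingEnd 𝕜) μ) * Novikov.h1Inner w (u 0)) ∧
        ∃ u : ℝ → ℝ → 𝕜, Novikov.IsSolution b u ∧ Novikov.h1Inner w (u 0) ≠ 0 ∧
          ∃ c : ℝ, 0 < c ∧ ∀ t : ℝ,
            c * Real.exp (RCLike.re μ * t) ≤ Novikov.h1Norm (u t)) := by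
  exact ⟨Novikov.linearlyStable_iff, fun _ h0 h1 => Novikov.exists_growing_eigenfunction h0 h1,
    fun _ h0 h1 => Novikov.exists_growing_adjoint_eigenfunction h0 h1⟩
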